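/- **Setting.** Let $d\in\mathbb N$ and let $P=(P_t)_{t\ge 0}$ be a semigroup of Markov kernels on $\mathbb R^d$, realised by a (jointly measurable) Markov process $Z=(Z(t))_{t\ge0}$, which can be started at any $z\in\mathbb R^d$. Let $\phi$ be a probability distribution on $[0,\infty)$ with $\phi(\{0\})=0$, let $L$ be a random variable of distribution $\phi$, and let $\mu(x)=\gamma\delta x^{\delta-1}\mathrm e^{\gamma x^\delta}$ with $\gamma>0$ and $\delta\in(0,1)$. The *monkey walk* $X=(X(t))_{t\ge0}$ of semigroup $P$, run-length distribution $\phi$ and memory kernel $\mu$ is defined as follows. Sample i.i.d. run lengths $(L_n)_{n\ge1}$ of distribution $\phi$ and set $T_n=\sum_{i=1}^nL_i$ for $n\ge 0$. Let $(X(s))_{0\le s<T_1}$ be the Markov process of semigroup $P$ started at the origin. Then, for every $n\ge1$, given the run lengths and everything sampled before, let $R_n$ be a random time in $[0,T_n)$ with density $\mu/\int_0^{T_n}\mu$, and let $(X(s))_{T_n\le s<T_{n+1}}$ be the Markov process of semigroup $P$ started at $X(R_n)$. **Assumptions.** * (A1) There are functions $a:[0,\infty)\to\mathbb R^d$ and $b:[0,\infty)\to(0,\infty)$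 and a probability distribution $\nu$ on $\mathbb R^d$ such that, for all $z\in\mathbb R^d$, if $Z$ is started at $z$, then $(Z(t)-a(t))/b(t)\Rightarrow\nu$ in distribution as $t\to\infty$. * (A2) There are functions $f:\mathbb R\to\mathbb R^d$ and $g:\mathbb R\to\mathbb R$ such that, for all $x\in\mathbb R$ and all $\varepsilon:[0,\infty)\to\mathbb R$ with $\varepsilon(t)=o(\sqrt t)$ as $t\to\infty$, $$f(x)=\lim_{t\to\infty}\frac{a(t+x\sqrt t+\varepsilon(t))-a(t)}{b(t)},\qquad g(x)=\lim_{t\to\infty}\frac{b(t+x\sqrt t+\varepsilon(t))}{b(t)} .$$ * $\mathbb E[L^p]<\infty$, where $p=\max\{8,\lfloor 1/(1-\delta)\rfloor+1\}$. **Theorem.** Let $$s(t)=\frac{\gamma\delta t^\delta}{\mathbb E[L]}\sum_{k=0}^{\lfloor\frac{\delta}{2-2\delta}\rfloor}\frac{(-\gamma\delta)^k\,\mathbb E[L^{k+2}]}{(k+2)!\,(\delta-(1-\delta)k)}\;t^{k(\delta-1)} .$$ Then, in distribution as $t\to\infty$, $$\frac{X(t)-a(s(t))}{b(s(t))}\Rightarrow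 f(\Omega)+\Lambda\, g(\Omega),$$ where $\Omega\sim\mathcal N\big(0,\,2\mathbb E[L^3]/(3\mathbb E[L^2])\big)$ and $\Lambda\sim\nu$ are independent. -/

import Mathlib

open MeasureTheory ProbabilityTheory Filter Topology Asymptotics
open scoped NNReal ENNReal

noncomputable section

namespace MonkeyWalk

/-- `Y` has conditional law `κ` given the σ-algebra `m`, under `Pr`. -/
def HasCondLaw {Ω S : Type*} [MeasurableSpace Ω] [MeasurableSpace S] (Pr : Measure Ω)
    (m : MeasurableSpace Ω) (Y : Ω → S) (κ : Ω → Measure S) : Prop :=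
  ∀ A : Set Ω, MeasurableSet[m] A → ∀ B : Set S, MeasurableSet B →
    Pr (A ∩ Y ⁻¹' B) = ∫⁻ ω in A, κ ω B ∂Pr

/-- A semigroup of Markov transition kernels on `E`. -/
structure MarkovSemigroup (E : Type*) [MeasurableSpace E] where
  kernel : ℝ≥0 → Kernel E E
  isMarkovKernel : ∀ t, IsMarkovKernel (kernel t)
  zero : kernel 0 = Kernel.id
  add : ∀ s t, kernel (s + t) = kernel t ∘ₖ kernel s

/-- A (measurable) Markov process of semigroup `P`: a process `Z` on a measurable space `W`,
together with the laws `law z` on `W` under which `Z` is Markov of semigroup `P` (with respect to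
its natural filtration) and starts at `z`. -/
structure MarkovProcess {E : Type*} [MeasurableSpace E] (P : MarkovSemigroup E)
    (W : Type*) [MeasurableSpace W] where
  Z : ℝ≥0 → W → E
  measurable_Z : Measurable (Function.uncurry Z)
  law : Kernel E W
  isMarkovKernel : IsMarkovKernel law
  start : ∀ z, ∀ᵐ w ∂(law z), Z 0 w = z
  markov : ∀ z s t, HasCondLaw (law z)
    (⨆ r : {r : ℝ≥0 // r ≤ s}, MeasurableSpace.comap (Z r) inferInstance)
    (Z (s + t)) (fun w => P.kernel t (Z s w))

attribute [instance] MarkovProcess.isMarkovKernel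

/-- The probability law on `[0, t)` with density `μ / ∫₀ᵗ μ`. -/
def memoryLaw (μ : ℝ → ℝ) (t : ℝ) : Measure ℝ :=
  cond (volume.withDensity fun x => ENNReal.ofReal (μ x)) (Set.Ico 0 t)

/-- The memory kernel `x ↦ γ δ x^(δ-1) exp (γ x^δ)`. -/
def memoryKernel (γ δ : ℝ) (x : ℝ) : ℝ :=
  γ * δ * x ^ (δ - 1) * Real.exp (γ * x ^ δ)

/-- The `n`-th relocation time, i.e. the sum of the first `n` run lengths. -/
def relocTime {Ω : Type*} (L : ℕ → Ω → ℝ≥0) (n : ℕ) (ω : Ω) : ℝ≥0 :=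
  ∑ i ∈ Finset.range n, L i ω

/-- The information available just before relocation `n + 1`: all run lengths, the times chosen at
the first `n` relocations and the trajectories of the first `n + 1` runs. -/
@[reducible]
def past {Ω W : Type*} [MeasurableSpace W] (L R : ℕ → Ω → ℝ≥0) (ξ : ℕ → Ω → W) (n : ℕ) :
    MeasurableSpace Ω :=
  (⨆ i : ℕ, MeasurableSpace.comap (L i) inferInstance) ⊔
  (⨆ i : {i : ℕ // i < n}, MeasurableSpace.comap (R i) inferInstance) ⊔
  (⨆ i : {i : ℕ // i ≤ n}, MeasurableSpace.comap (ξ i) inferInstance)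

/-- `X` is the monkey walk built from the run lengths `L`, the times `R` and the trajectories `ξ`.
Everything is indexed from `0`: the run `n` has length `L n`, follows the trajectory
`M.Z · (ξ n)` and occupies the time interval `[relocTime L n, relocTime L (n + 1))`, and `R n` is
the time in the past that is chosen at its end. -/
structure IsBuiltFrom {E W Ω : Type*} [MeasurableSpace E] [Zero E] [MeasurableSpace W]
    [MeasurableSpace Ω] {P : MarkovSemigroup E} (M : MarkovProcess P W) (φ : Measure ℝ≥0)
    (μ : ℝ → ℝ) (Pr : Measure Ω) (X : ℝ≥0 → Ω → E) (L R : ℕ → Ω → ℝ≥0) (ξ : ℕ → Ω → W) :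
    Prop where
  measurable_L : ∀ n, Measurable (L n)
  measurable_R : ∀ n, Measurable (R n)
  measurable_ξ : ∀ n, Measurable (ξ n)
  indep : iIndepFun L Pr
  law_L : ∀ n, HasLaw (L n) φ Pr
  first_run : HasCondLaw Pr (⨆ i : ℕ, MeasurableSpace.comap (L i) inferInstance) (ξ 0)
    (fun _ => M.law 0)
  choice : ∀ n, HasCondLaw Pr (past L R ξ n) (fun ω => (R n ω : ℝ))
    (fun ω => memoryLaw μ (relocTime L (n + 1) ω))
  next_run : ∀ n, HasCondLaw Pr
    (past L R ξ n ⊔ MeasurableSpace.comap (R n) inferInstance) (ξ (n + 1))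
    (fun ω => M.law (X (R n ω) ω))
  path : ∀ᵐ ω ∂Pr, ∀ n t, relocTime L n ω ≤ t → t < relocTime L (n + 1) ω →
    X t ω = M.Z (t - relocTime L n ω) (ξ n ω)

/-- `X` is a monkey walk with underlying Markov process `M`, run-length distribution `φ` and
memory kernel `μ`. -/
def IsMonkeyWalk {E W Ω : Type*} [MeasurableSpace E] [Zero E] [MeasurableSpace W]
    [MeasurableSpace Ω] {P : MarkovSemigroup E} (M : MarkovProcess P W) (φ : Measure ℝ≥0)
    (μ : ℝ → ℝ) (Pr : Measure Ω) (X : ℝ≥0 → Ω → E) : Prop :=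
  ∃ (L R : ℕ → Ω → ℝ≥0) (ξ : ℕ → Ω → W), IsBuiltFrom M φ μ Pr X L R ξ

/-- The Markov process is `(a, b)`-ergodic with limit `ν`: from every starting point,
`(Z t - a t) / b t` converges in distribution to `ν`. Only the values of `a` and `b` on `[0, ∞)`
matter. -/
def IsErgodic {d : ℕ} {W : Type*} [MeasurableSpace W]
    {P : MarkovSemigroup (EuclideanSpace ℝ (Fin d))} (M : MarkovProcess P W)
    (a : ℝ → EuclideanSpace ℝ (Fin d)) (b : ℝ → ℝ)
    (ν : Measure (EuclideanSpace ℝ (Fin d))) [IsProbabilityMeasure ν] : Prop :=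
  (∀ t, 0 ≤ t → 0 < b t) ∧
  ∀ z, TendstoInDistribution (fun (t : ℝ≥0) (w : W) => (b t)⁻¹ • (M.Z t w - a t)) atTop
    (fun y : EuclideanSpace ℝ (Fin d) => y) (fun _ => M.law z) ν

/-- The functions `a`, `b` have the scaling limits `f`, `g` on the scale `√t`. -/
def HasScalingLimits {d : ℕ} (a : ℝ → EuclideanSpace ℝ (Fin d)) (b : ℝ → ℝ)
    (f : ℝ → EuclideanSpace ℝ (Fin d)) (g : ℝ → ℝ) : Prop :=
  ∀ (x : ℝ) (ε : ℝ → ℝ), ε =o[atTop] (fun t => √t) →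
    Tendsto (fun t => (b t)⁻¹ • (a (t + x * √t + ε t) - a t)) atTop (𝓝 (f x)) ∧
    Tendsto (fun t => b (t + x * √t + ε t) / b t) atTop (𝓝 (g x))

/-- The `k`-th moment of the run-length distribution. -/
def moment (φ : Measure ℝ≥0) (k : ℕ) : ℝ := ∫ l, (l : ℝ) ^ k ∂φ

/-- The centring time `s(t)`, for `0 < δ < 1`. -/
def centring (γ δ : ℝ) (φ : Measure ℝ≥0) (t : ℝ) : ℝ :=
  γ * δ * t ^ δ / moment φ 1 *
    ∑ k ∈ Finset.range (⌊δ / (2 - 2 * δ)⌋₊ + 1),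
      (-(γ * δ)) ^ k * moment φ (k + 2) / ((k + 2).factorial * (δ - (1 - δ) * k)) *
        t ^ (k * (δ - 1))

end MonkeyWalk

end

/-! The law of `X t` is that of `Z`, started at the origin and observed at a random age built from
the run lengths and the memory times. The memory time chosen at the end of run `n` falls either
inside that run or in the earlier past `[0, T_n)`. In the second case its conditional law is `μ`
normalised on `[0, T_n)`, which is the law of the previous memory time, so the new starting point is
distributed like the starting point of run `n`. In the first case the new starting point is that of
run `n` moved along the semigroup by `r - T_n`. Hence, given all run lengths and for one-dimensional
laws, every relocation adds to the age of the starting point an independent increment of law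
`stepLaw`, with an atom at `0` for old memory times. No genealogical tree has to be analysed. This
is `IsBuiltFrom.lintegral_startPoint_step`, which iterates to `IsBuiltFrom.lintegral_startPoint` and
`IsBuiltFrom.lintegral_walk`.

The age is thus conditionally a sum of independent small increments. The characteristic function of
an increment is close to `exp (iθA - θ²B/2)`, where `A`, `B` are its first two moments as functions
of the start `x` and the length `l` of the run. On the run the memory density is nearly `κ exp (-κ
(l - y))` with rate `κ = γδ(1 + x)^(δ-1)`; expanding the exponential gives `A` as a sum of terms of
order `κ^(j+1) l^(j+2)`, and `B ≈ κ l³/3`. Summing over the runs before `t` produces the centring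
`s(t)`, up to `o(t^(δ/2))`, and the variance `γ E[L³] t^δ / (3 E[L])`, up to `o(t^δ)`. Dividing the
latter by `s(t) ~ γ E[L²] t^δ / (2 E[L])` gives the variance of `Ω`. The number of terms in `s(t)`
is what the fluctuation scale `√s(t) ≍ t^(δ/2)` requires.

Sums over runs become integrals without a renewal theorem. A function `F(T_k, L_k)` is split into a
centred part, controlled in `L²` by orthogonality, and the compensator `(L_k / E[L]) * Fbar(T_k)`,
where `Fbar` is the mean over the length. Since the compensator carries the run length as a factor,
its sum is a Riemann sum and is compared with the integral pathwise by telescoping. This is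
`IsRunSequence.integral_abs_visitSum_sub_le`, and it leads to the Gaussian limit
`IsRunSequence.tendsto_normalisedAgeLaw`.

Finally, at an age `s + x√s` the normalised process converges to `f x + g x • Λ`, by ergodicity, the
scaling limits and Slutsky's theorem. The convergence is joint in `(s, x)`, so it can be integrated
against the converging law of the normalised age. -/

noncomputable section

namespace MonkeyWalk

/-! ### Renewal estimates for i.i.d. run lengths -/

/-- `L` is an i.i.d. sequence of random variables of law `φ`. -/
structure IsRunSequence {Ω : Type*} [MeasurableSpace Ω] (Pr : Measure Ω) (φ : Measure ℝ≥0)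
    (L : ℕ → Ω → ℝ≥0) : Prop where
  measurable : ∀ n, Measurable (L n)
  indep : iIndepFun L Pr
  law : ∀ n, HasLaw (L n) φ Pr

/-- The sum of `F (T k) (L k)` over the runs `k < n` that start at a time `T k ≤ t`. -/
def visitSum {Ω : Type*} (L : ℕ → Ω → ℝ≥0) (t : ℝ≥0) (n : ℕ) (F : ℝ≥0 → ℝ≥0 → ℝ) (ω : Ω) : ℝ :=
  ∑ k ∈ Finset.range n, if relocTime L k ω ≤ t then F (relocTime L k ω) (L k ω) else 0

section

variable {Ω : Type*} {L : ℕ → Ω → ℝ≥0}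

lemma relocTime_succ (n : ℕ) (ω : Ω) : relocTime L (n + 1) ω = relocTime L n ω + L n ω := by
  simp [relocTime, Finset.sum_range_succ]

@[simp]
lemma relocTime_zero (ω : Ω) : relocTime L 0 ω = 0 := by simp [relocTime]

lemma relocTime_mono (ω : Ω) : Monotone fun n => relocTime L n ω :=
  monotone_nat_of_le_succ fun n => by simp [relocTime_succ]

lemma visitSum_succ (t : ℝ≥0) (n : ℕ) (F : ℝ≥0 → ℝ≥0 → ℝ) (ω : Ω) :
    visitSum L t (n + 1) F ω = visitSum L t n F ω +
      if relocTime L n ω ≤ t then F (relocTime L n ω) (L n ω) else 0 := by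
  simp [visitSum, Finset.sum_range_succ]

lemma visitSum_add (t : ℝ≥0) (n : ℕ) (F G : ℝ≥0 → ℝ≥0 → ℝ) (ω : Ω) :
    visitSum L t n (fun x l => F x l + G x l) ω = visitSum L t n F ω + visitSum L t n G ω := by
  simp only [visitSum, ← Finset.sum_add_distrib]
  refine Finset.sum_congr rfl fun k _ => ?_
  split_ifs <;> simp

lemma visitSum_const_mul (t : ℝ≥0) (n : ℕ) (c : ℝ) (F : ℝ≥0 → ℝ≥0 → ℝ) (ω : Ω) :
    visitSum L t n (fun x l => c * F x l) ω = c * visitSum L t n F ω := by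
  simp only [visitSum, Finset.mul_sum]
  refine Finset.sum_congr rfl fun k _ => ?_
  split_ifs <;> simp

lemma visitSum_sum {ι : Type*} (s : Finset ι) (t : ℝ≥0) (n : ℕ) (F : ι → ℝ≥0 → ℝ≥0 → ℝ) (ω : Ω) :
    visitSum L t n (fun x l => ∑ i ∈ s, F i x l) ω = ∑ i ∈ s, visitSum L t n (F i) ω := by
  simp only [visitSum]
  rw [Finset.sum_comm]
  refine Finset.sum_congr rfl fun k _ => ?_
  split_ifs <;> simp

lemma visitSum_mono (t : ℝ≥0) (n : ℕ) {F G : ℝ≥0 → ℝ≥0 → ℝ} (h : ∀ x l, F x l ≤ G x l) (ω : Ω) :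
    visitSum L t n F ω ≤ visitSum L t n G ω := by
  refine Finset.sum_le_sum fun k _ => ?_
  split_ifs
  · exact h _ _
  · exact le_rfl

lemma visitSum_nonneg (t : ℝ≥0) (n : ℕ) {F : ℝ≥0 → ℝ≥0 → ℝ} (h : ∀ x l, 0 ≤ F x l) (ω : Ω) :
    0 ≤ visitSum L t n F ω := by
  refine Finset.sum_nonneg fun k _ => ?_
  split_ifs
  · exact h _ _
  · exact le_rfl

lemma abs_visitSum_le (t : ℝ≥0) (n : ℕ) {F G : ℝ≥0 → ℝ≥0 → ℝ} (h : ∀ x l, |F x l| ≤ G x l) (ω : Ω) :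
    |visitSum L t n F ω| ≤ visitSum L t n G ω := by
  refine (Finset.abs_sum_le_sum_abs _ _).trans (Finset.sum_le_sum fun k _ => ?_)
  split_ifs
  · exact h _ _
  · simp

/-- Telescoping bound: if `h * v x` is at most an increment of `V`, the truncated visit sum of `v`
is at most the total variation of `V`. -/
lemma visitSum_min_le (t : ℝ≥0) (n : ℕ) {v V : ℝ≥0 → ℝ}
    (hV : ∀ x y, x ≤ y → y ≤ t + 1 → V x ≤ V y)
    (hv : ∀ x h : ℝ≥0, x ≤ t → h ≤ 1 → h * v x ≤ V (x + h) - V x) (ω : Ω) :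
    visitSum L t n (fun x l => min (l : ℝ) 1 * v x) ω ≤ V (t + 1) - V 0 := by
  -- The potential is evaluated at `T_n` stopped at `t + 1`: a run that starts before `t`, cut to
  -- length at most `1`, ends before `t + 1`, so each summand is paid for by an increment of the
  -- stopped potential.
  have key : visitSum L t n (fun x l => min (l : ℝ) 1 * v x) ω ≤
      V (min (relocTime L n ω) (t + 1)) - V 0 := by
    induction n with
    | zero => simp [visitSum]
    | succ n ih =>
      rw [visitSum_succ, relocTime_succ]
      split_ifs with h
      · have h1 := hv (relocTime L n ω) (min (L n ω) 1) h (min_le_right _ _)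
        have h2 : min (relocTime L n ω) (t + 1) = relocTime L n ω :=
          min_eq_left (h.trans (by simp))
        rw [h2] at ih
        have h3 : V (relocTime L n ω + min (L n ω) 1) ≤ V (min (relocTime L n ω + L n ω) (t + 1)) := by
          refine hV _ _ (le_min ?_ ?_) (min_le_right _ _)
          · gcongr; exact min_le_left _ _
          · gcongr; exact min_le_right _ _
        push_cast at h1
        linarith
      · have h3 : V (min (relocTime L n ω) (t + 1)) ≤ V (min (relocTime L n ω + L n ω) (t + 1)) := by
          refine hV _ _ (min_le_min_right _ (by simp)) (min_le_right _ _)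
        linarith
  refine key.trans ?_
  have := hV _ _ (min_le_right (relocTime L n ω) (t + 1)) le_rfl
  linarith

end

/-! ### Independence of the next run length from the past, and renewal bounds in mean -/

section

variable {Ω : Type*} [MeasurableSpace Ω] {Pr : Measure Ω} {φ : Measure ℝ≥0} {L : ℕ → Ω → ℝ≥0}

lemma IsRunSequence.measurable_relocTime (hL : IsRunSequence Pr φ L) (k : ℕ) :
    Measurable (relocTime L k) := by
  have := hL.measurable
  unfold relocTime
  fun_prop

/-- A function of the first `k` run lengths is independent of the next one. -/
lemma IsRunSequence.indepFun_of_prefix (hL : IsRunSequence Pr φ L) {S : Type*} [MeasurableSpace S]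
    (k : ℕ) {H : (ℕ → ℝ≥0) → S} (hH : Measurable H)
    (hpre : ∀ a b : ℕ → ℝ≥0, (∀ i < k, a i = b i) → H a = H b) :
    IndepFun (fun ω => H fun i => L i ω) (L k) Pr := by
  have h := hL.indep.indepFun_finset (Finset.range k) {k} (by simp) hL.measurable
  -- A finite prefix is completed by zeros; `H` does not see the added values.
  let e : (Finset.range k → ℝ≥0) → ℕ → ℝ≥0 := fun v i => if hi : i ∈ Finset.range k then v ⟨i, hi⟩ else 0
  have he : Measurable e := by
    refine measurable_pi_lambda _ fun i => ?_
    by_cases hi : i ∈ Finset.range k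
    · simp only [e, hi, dif_pos]; fun_prop
    · simp only [e, hi, dif_neg, not_false_eq_true]; fun_prop
  have h2 := h.comp (hH.comp he) (measurable_pi_apply (⟨k, by simp⟩ : ({k} : Finset ℕ)))
  have e1 : (fun ω => H fun i => L i ω) = (H ∘ e) ∘ fun a (i : Finset.range k) => L i a := by
    funext ω
    simp only [Function.comp_apply]
    refine hpre _ _ fun i hi => ?_
    simp [e, hi]
  rw [e1]
  exact h2

lemma IsRunSequence.map_prod (hL : IsRunSequence Pr φ L) [IsProbabilityMeasure Pr] {S : Type*}
    [MeasurableSpace S] (k : ℕ) {H : (ℕ → ℝ≥0) → S} (hH : Measurable H)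
    (hpre : ∀ a b : ℕ → ℝ≥0, (∀ i < k, a i = b i) → H a = H b) :
    Pr.map (fun ω => (H fun i => L i ω, L k ω)) = (Pr.map fun ω => H fun i => L i ω).prod φ := by
  have hm : Measurable fun ω => H fun i => L i ω :=
    hH.comp (measurable_pi_lambda _ hL.measurable)
  rw [(hL.indepFun_of_prefix k hH hpre).map_prod_eq_prod_map_map hm.aemeasurable
    (hL.measurable k).aemeasurable, (hL.law k).map_eq]

lemma relocTime_congr_of_prefix {k : ℕ} {a b : ℕ → ℝ≥0} (h : ∀ i < k, a i = b i) :
    (∑ i ∈ Finset.range k, a i) = ∑ i ∈ Finset.range k, b i :=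
  Finset.sum_congr rfl fun i hi => h i (Finset.mem_range.1 hi)

/-- Conditioning on the first `k` run lengths. -/
lemma IsRunSequence.integral_prefix (hL : IsRunSequence Pr φ L) [IsProbabilityMeasure Pr]
    [IsProbabilityMeasure φ] {S : Type*}
    [MeasurableSpace S] (k : ℕ) {H : (ℕ → ℝ≥0) → S} (hH : Measurable H)
    (hpre : ∀ a b : ℕ → ℝ≥0, (∀ i < k, a i = b i) → H a = H b) {G : S → ℝ≥0 → ℝ}
    (hG : Measurable (Function.uncurry G))
    (hInt : Integrable (fun ω => G (H fun i => L i ω) (L k ω)) Pr) :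
    ∫ ω, G (H fun i => L i ω) (L k ω) ∂Pr = ∫ ω, (∫ l, G (H fun i => L i ω) l ∂φ) ∂Pr := by
  have hm : Measurable fun ω => H fun i => L i ω :=
    hH.comp (measurable_pi_lambda _ hL.measurable)
  have hm2 : Measurable fun ω => (H fun i => L i ω, L k ω) := hm.prodMk (hL.measurable k)
  have : IsProbabilityMeasure (Pr.map fun ω => H fun i => L i ω) :=
    Measure.isProbabilityMeasure_map hm.aemeasurable
  have e1 : ∫ ω, G (H fun i => L i ω) (L k ω) ∂Pr =
      ∫ p, Function.uncurry G p ∂(Pr.map fun ω => (H fun i => L i ω, L k ω)) := by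
    rw [integral_map hm2.aemeasurable hG.aestronglyMeasurable]; rfl
  have hint2 : Integrable (Function.uncurry G) ((Pr.map fun ω => H fun i => L i ω).prod φ) := by
    rw [← hL.map_prod k hH hpre, integrable_map_measure hG.aestronglyMeasurable hm2.aemeasurable]
    exact hInt
  rw [e1, hL.map_prod k hH hpre, integral_prod _ hint2, integral_map hm.aemeasurable]
  · rfl
  · exact hG.stronglyMeasurable.integral_prod_right.aestronglyMeasurable

lemma IsRunSequence.integrable_comp (hL : IsRunSequence Pr φ L) (k : ℕ) {q : ℝ≥0 → ℝ}
    (hq : Integrable q φ) : Integrable (fun ω => q (L k ω)) Pr := by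
  rw [← (hL.law k).map_eq] at hq
  exact hq.comp_measurable (hL.measurable k)

lemma IsRunSequence.measurable_visitTerm (hL : IsRunSequence Pr φ L) (t : ℝ≥0) (k : ℕ)
    {F : ℝ≥0 → ℝ≥0 → ℝ} (hF : Measurable (Function.uncurry F)) :
    Measurable fun ω => if relocTime L k ω ≤ t then F (relocTime L k ω) (L k ω) else 0 := by
  have h1 := hL.measurable_relocTime k
  refine Measurable.ite (measurableSet_le h1 measurable_const) ?_ measurable_const
  exact hF.comp (h1.prodMk (hL.measurable k))

lemma IsRunSequence.measurable_visitSum (hL : IsRunSequence Pr φ L) (t : ℝ≥0) (n : ℕ)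
    {F : ℝ≥0 → ℝ≥0 → ℝ} (hF : Measurable (Function.uncurry F)) :
    Measurable (visitSum L t n F) := by
  unfold visitSum
  exact Finset.measurable_fun_sum _ fun k _ => hL.measurable_visitTerm t k hF

lemma IsRunSequence.integrable_visitTerm (hL : IsRunSequence Pr φ L) (t : ℝ≥0) (k : ℕ)
    {F : ℝ≥0 → ℝ≥0 → ℝ} (hF : Measurable (Function.uncurry F)) {q : ℝ≥0 → ℝ}
    (hq : Integrable q φ) (hFq : ∀ x l, |F x l| ≤ q l) :
    Integrable (fun ω => if relocTime L k ω ≤ t then F (relocTime L k ω) (L k ω) else 0) Pr := by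
  refine (hL.integrable_comp k hq).mono' (hL.measurable_visitTerm t k hF).aestronglyMeasurable
    (Eventually.of_forall fun ω => ?_)
  split_ifs
  · exact hFq _ _
  · simpa using (abs_nonneg _).trans (hFq 0 (L k ω))

lemma IsRunSequence.integrable_visitSum (hL : IsRunSequence Pr φ L) (t : ℝ≥0) (n : ℕ)
    {F : ℝ≥0 → ℝ≥0 → ℝ} (hF : Measurable (Function.uncurry F)) {q : ℝ≥0 → ℝ}
    (hq : Integrable q φ) (hFq : ∀ x l, |F x l| ≤ q l) :
    Integrable (visitSum L t n F) Pr := by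
  unfold visitSum
  exact integrable_finsetSum _ fun k _ => hL.integrable_visitTerm t k hF hq hFq

variable [IsProbabilityMeasure Pr] [IsProbabilityMeasure φ]

lemma IsRunSequence.integral_visitTerm (hL : IsRunSequence Pr φ L) (t : ℝ≥0) (k : ℕ)
    {F : ℝ≥0 → ℝ≥0 → ℝ} (hF : Measurable (Function.uncurry F)) {q : ℝ≥0 → ℝ}
    (hq : Integrable q φ) (hFq : ∀ x l, |F x l| ≤ q l) :
    ∫ ω, (if relocTime L k ω ≤ t then F (relocTime L k ω) (L k ω) else 0) ∂Pr =
      ∫ ω, (if relocTime L k ω ≤ t then ∫ l, F (relocTime L k ω) l ∂φ else 0) ∂Pr := by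
  have := hL.integral_prefix (S := ℝ≥0) k (H := fun a => ∑ i ∈ Finset.range k, a i)
    (by fun_prop) (fun a b h => relocTime_congr_of_prefix h)
    (G := fun x l => if x ≤ t then F x l else 0)
    (Measurable.ite (measurableSet_le measurable_fst measurable_const) hF measurable_const)
    (hL.integrable_visitTerm t k hF hq hFq)
  refine this.trans (integral_congr_ae (Eventually.of_forall fun ω => ?_))
  change (∫ l, if relocTime L k ω ≤ t then F (relocTime L k ω) l else 0 ∂φ) = _
  by_cases h : relocTime L k ω ≤ t <;> simp [h]

lemma IsRunSequence.integral_visitSum (hL : IsRunSequence Pr φ L) (t : ℝ≥0) (n : ℕ)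
    {F : ℝ≥0 → ℝ≥0 → ℝ} (hF : Measurable (Function.uncurry F)) {q : ℝ≥0 → ℝ}
    (hq : Integrable q φ) (hFq : ∀ x l, |F x l| ≤ q l) :
    ∫ ω, visitSum L t n F ω ∂Pr = ∫ ω, visitSum L t n (fun x _ => ∫ l, F x l ∂φ) ω ∂Pr := by
  unfold visitSum
  rw [integral_finsetSum _ fun k _ => hL.integrable_visitTerm t k hF hq hFq, integral_finsetSum]
  · exact Finset.sum_congr rfl fun k _ => hL.integral_visitTerm t k hF hq hFq
  · intro k _
    refine hL.integrable_visitTerm (F := fun x _ => ∫ l, F x l ∂φ) t k ?_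
      (integrable_const (∫ l, q l ∂φ)) (fun x _ => ?_)
    · exact (hF.stronglyMeasurable.integral_prod_right.measurable).comp measurable_fst
    · refine (abs_integral_le_integral_abs).trans (integral_mono_of_nonneg
        (Eventually.of_forall fun _ => abs_nonneg _) hq (Eventually.of_forall fun l => hFq x l))

/-- The expected truncated run length. -/
def truncMean (φ : Measure ℝ≥0) : ℝ := ∫ l, min (l : ℝ) 1 ∂φ

lemma integrable_min_one : Integrable (fun l : ℝ≥0 => min (l : ℝ) 1) φ :=
  Integrable.of_bound (by fun_prop : Measurable fun l : ℝ≥0 => min (l : ℝ) 1).aestronglyMeasurable 1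
    (Eventually.of_forall fun l => by
      rw [Real.norm_eq_abs, abs_of_nonneg (by positivity)]; exact min_le_right _ _)

lemma ae_pos_of_singleton_zero {φ : Measure ℝ≥0} (hφ : φ {0} = 0) : ∀ᵐ l ∂φ, 0 < l := by
  rw [ae_iff]; simpa [Set.ofPred_eq_eq_singleton] using hφ

lemma truncMean_pos (hφ : φ {0} = 0) : 0 < truncMean φ := by
  rw [truncMean, integral_pos_iff_support_of_nonneg (fun l => by positivity) integrable_min_one]
  have : Function.support (fun l : ℝ≥0 => min (l : ℝ) 1) = {0}ᶜ := by
    ext l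
    simp only [Function.mem_support, Set.mem_compl_iff, Set.mem_singleton_iff]
    constructor
    · rintro h rfl; simp at h
    · intro h
      have : 0 < (l : ℝ) := by exact_mod_cast pos_iff_ne_zero.2 h
      positivity
  rw [this, prob_compl_eq_one_iff (measurableSet_singleton _) |>.2 hφ]
  exact one_pos

/-- Renewal bound for expected visit sums. -/
lemma IsRunSequence.integral_visitSum_le (hL : IsRunSequence Pr φ L) (hφ : φ {0} = 0) (t : ℝ≥0)
    (n : ℕ) {v V : ℝ≥0 → ℝ} {q : ℝ≥0 → ℝ} (hvm : Measurable v) (hv0 : ∀ x, 0 ≤ v x)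
    (hv1 : ∀ x, v x ≤ 1) (hq : Integrable q φ) (hqm : Measurable q) (hq0 : ∀ l, 0 ≤ q l)
    (hV : ∀ x y, x ≤ y → y ≤ t + 1 → V x ≤ V y)
    (hv : ∀ x h : ℝ≥0, x ≤ t → h ≤ 1 → h * v x ≤ V (x + h) - V x) :
    ∫ ω, visitSum L t n (fun x l => q l * v x) ω ∂Pr ≤
      (∫ l, q l ∂φ) / truncMean φ * (V (t + 1) - V 0) := by
  have hm := truncMean_pos hφ
  -- Each `L_k` is independent of `T_k`, so a factor `q (L_k)` may be replaced by its mean. Used for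
  -- `q` and for `min l 1`, this shows that the two expected sums are in the ratio of the means, and
  -- the second one is bounded pathwise by telescoping.
  have e1 : ∫ ω, visitSum L t n (fun x l => q l * v x) ω ∂Pr =
      (∫ l, q l ∂φ) * ∫ ω, visitSum L t n (fun x _ => v x) ω ∂Pr := by
    rw [hL.integral_visitSum t n (by fun_prop) hq (fun x l => ?_)]
    · rw [← integral_const_mul]
      congr 1
      funext ω
      rw [← visitSum_const_mul]
      congr 1
      funext x l
      rw [integral_mul_const]
    · rw [abs_of_nonneg (mul_nonneg (hq0 l) (hv0 x))]
      exact mul_le_of_le_one_right (hq0 l) (hv1 x)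
  have e2 : ∫ ω, visitSum L t n (fun x l => min (l : ℝ) 1 * v x) ω ∂Pr =
      truncMean φ * ∫ ω, visitSum L t n (fun x _ => v x) ω ∂Pr := by
    rw [hL.integral_visitSum t n (by fun_prop) (integrable_min_one) (fun x l => ?_)]
    · rw [← integral_const_mul]
      congr 1
      funext ω
      rw [← visitSum_const_mul]
      congr 1
      funext x l
      rw [integral_mul_const, truncMean]
    · rw [abs_of_nonneg (mul_nonneg (by positivity) (hv0 x))]
      exact mul_le_of_le_one_right (by positivity) (hv1 x)
  have e3 : ∫ ω, visitSum L t n (fun x l => min (l : ℝ) 1 * v x) ω ∂Pr ≤ V (t + 1) - V 0 := by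
    have : ∫ ω, visitSum L t n (fun x l => min (l : ℝ) 1 * v x) ω ∂Pr ≤ ∫ ω, (V (t + 1) - V 0) ∂Pr := by
      refine integral_mono_of_nonneg (Eventually.of_forall fun ω => ?_) (integrable_const _)
        (Eventually.of_forall fun ω => visitSum_min_le t n hV hv ω)
      exact visitSum_nonneg t n (fun x l => mul_nonneg (by positivity) (hv0 x)) ω
    simpa using this
  rw [e2] at e3
  rw [e1, div_mul_eq_mul_div, mul_div_assoc]
  refine mul_le_mul_of_nonneg_left ?_ (integral_nonneg hq0)
  rw [le_div_iff₀ hm]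
  linarith

end

/-! ### Power weights and the comparison of sums with integrals -/

/-- The weight `x ↦ (1 + x) ^ (β - 1)`. -/
def powWeight (β : ℝ) (x : ℝ≥0) : ℝ := (1 + (x : ℝ)) ^ (β - 1)

lemma measurable_powWeight (β : ℝ) : Measurable (powWeight β) := by
  unfold powWeight; fun_prop

lemma powWeight_pos (β : ℝ) (x : ℝ≥0) : 0 < powWeight β x := by
  unfold powWeight; positivity

lemma powWeight_le_one {β : ℝ} (hβ : β ≤ 1) (x : ℝ≥0) : powWeight β x ≤ 1 := by
  unfold powWeight
  exact Real.rpow_le_one_of_one_le_of_nonpos (by simp) (by linarith)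

lemma powWeight_mono {β β' : ℝ} (h : β ≤ β') (x : ℝ≥0) : powWeight β x ≤ powWeight β' x := by
  unfold powWeight
  exact Real.rpow_le_rpow_of_exponent_le (by simp) (by linarith)

/-- The inequality `2(δ - 1) ≤ δ² - 1` is `(δ - 1)² ≥ 0`. The exponent `δ²` is used for squares
because it is always positive, unlike `2δ - 1`, and still smaller than `δ`. -/
lemma powWeight_sq_le (δ : ℝ) (x : ℝ≥0) : powWeight δ x ^ 2 ≤ powWeight (δ ^ 2) x := by
  unfold powWeight
  rw [← Real.rpow_natCast, ← Real.rpow_mul (by positivity)]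
  refine Real.rpow_le_rpow_of_exponent_le (by simp) ?_
  push_cast
  nlinarith [sq_nonneg (δ - 1)]

/-- Concavity of `z ↦ z ^ β`, as Bernoulli's inequality at `-h / (a + h)`. -/
lemma rpow_sub_rpow_ge {a h β : ℝ} (ha : 0 < a) (hh : 0 ≤ h) (hβ0 : 0 ≤ β) (hβ1 : β ≤ 1) :
    β * h * (a + h) ^ (β - 1) ≤ (a + h) ^ β - a ^ β := by
  have hb : 0 < a + h := by linarith
  have h1 := rpow_one_add_le_one_add_mul_self (s := -(h / (a + h)))
    (by rw [neg_le_neg_iff, div_le_one hb]; linarith) hβ0 hβ1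
  have h2 : a = (a + h) * (1 + -(h / (a + h))) := by field_simp; ring
  have h3 : 0 ≤ 1 + -(h / (a + h)) := by
    have : h / (a + h) ≤ 1 := by rw [div_le_one hb]; linarith
    linarith
  have h4 : a ^ β = (a + h) ^ β * (1 + -(h / (a + h))) ^ β := by
    conv_lhs => rw [h2]
    rw [Real.mul_rpow hb.le h3]
  have h5 : (a + h) ^ β = (a + h) * (a + h) ^ (β - 1) := by
    rw [mul_comm, ← Real.rpow_add_one hb.ne']; simp
  rw [h4]
  have h6 : (a + h) ^ β * (1 + -(h / (a + h))) ^ β ≤ (a + h) ^ β * (1 + β * -(h / (a + h))) :=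
    mul_le_mul_of_nonneg_left h1 (by positivity)
  have h7 : (a + h) ^ β * (1 + β * -(h / (a + h))) = (a + h) ^ β - β * h * (a + h) ^ (β - 1) := by
    rw [h5]; field_simp; ring
  linarith

lemma rpow_add_le {a h β : ℝ} (ha : 0 < a) (hh : 0 ≤ h) (hβ0 : 0 ≤ β) (hβ1 : β ≤ 1) :
    (a + h) ^ β - a ^ β ≤ β * h * a ^ (β - 1) := by
  have h1 := rpow_one_add_le_one_add_mul_self (s := h / a)
    (by have : 0 ≤ h / a := by positivity
        linarith) hβ0 hβ1
  have h2 : (a + h) ^ β = a ^ β * (1 + h / a) ^ β := by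
    rw [← Real.mul_rpow ha.le (by positivity)]; congr 1; field_simp
  have h5 : a ^ β = a * a ^ (β - 1) := by
    rw [mul_comm, ← Real.rpow_add_one ha.ne']; simp
  have h6 : a ^ β * (1 + h / a) ^ β ≤ a ^ β * (1 + β * (h / a)) :=
    mul_le_mul_of_nonneg_left h1 (by positivity)
  have h7 : a ^ β * (1 + β * (h / a)) = a ^ β + β * h * a ^ (β - 1) := by
    rw [h5]; field_simp
  linarith

lemma rpow_sub_rpow_neg_le {a h β : ℝ} (ha : 0 < a) (hh : 0 ≤ h) (hβ0 : 0 ≤ β) :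
    a ^ (β - 1) - (a + h) ^ (β - 1) ≤ h * a ^ (β - 2) := by
  have h2 : (a + h) ^ (β - 1) = a ^ (β - 1) * (1 + h / a) ^ (β - 1) := by
    rw [← Real.mul_rpow ha.le (by positivity)]; congr 1; field_simp
  have h3 : 1 - h / a ≤ (1 + h / a) ^ (β - 1) := by
    have h0 : 0 ≤ h / a := by positivity
    have : (1 + h / a) ^ (-1 : ℝ) ≤ (1 + h / a) ^ (β - 1) :=
      Real.rpow_le_rpow_of_exponent_le (by linarith) (by linarith)
    refine le_trans ?_ this
    rw [Real.rpow_neg_one, ← one_div, le_div_iff₀ (by positivity)]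
    nlinarith
  have h5 : a ^ (β - 1) = a * a ^ (β - 2) := by
    rw [mul_comm, ← Real.rpow_add_one ha.ne']; ring_nf
  have h6 : a ^ (β - 1) * (1 - h / a) ≤ a ^ (β - 1) * (1 + h / a) ^ (β - 1) :=
    mul_le_mul_of_nonneg_left h3 (by positivity)
  have h7 : a ^ (β - 1) * (1 - h / a) = a ^ (β - 1) - h * a ^ (β - 2) := by
    rw [h5]; field_simp
  linarith

/-- Supplies the potential `(2 / β)(1 + x)^β` for the renewal bound. The factor `2` is the price of
comparing `1 + x + h` with `1 + x` when `h ≤ 1`. -/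
lemma mul_powWeight_le {β : ℝ} (hβ0 : 0 < β) (hβ1 : β ≤ 1) (x h : ℝ≥0) (hh : h ≤ 1) :
    h * powWeight β x ≤ 2 / β * (1 + ((x + h : ℝ≥0) : ℝ)) ^ β - 2 / β * (1 + (x : ℝ)) ^ β := by
  have h1 := rpow_sub_rpow_ge (a := 1 + (x : ℝ)) (h := h) (by positivity) (by positivity) hβ0.le hβ1
  have h2 : 1 / 2 * powWeight β x ≤ (1 + (x : ℝ) + h) ^ (β - 1) := by
    have hh' : (h : ℝ) ≤ 1 := by exact_mod_cast hh
    calc 1 / 2 * powWeight β x ≤ 2 ^ (β - 1) * (1 + (x : ℝ)) ^ (β - 1) := by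
          unfold powWeight
          gcongr
          rw [show (1 / 2 : ℝ) = 2 ^ (-1 : ℝ) by rw [Real.rpow_neg_one]; norm_num]
          exact Real.rpow_le_rpow_of_exponent_le (by norm_num) (by linarith)
      _ = (2 * (1 + (x : ℝ))) ^ (β - 1) := by rw [Real.mul_rpow (by norm_num) (by positivity)]
      _ ≤ _ := by
          refine Real.rpow_le_rpow_of_nonpos (by positivity) ?_ (by linarith)
          have : (0 : ℝ) ≤ x := x.2
          linarith
  have h3 : h * (1 / 2 * powWeight β x) ≤ h * (1 + (x : ℝ) + h) ^ (β - 1) :=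
    mul_le_mul_of_nonneg_left h2 h.2
  rw [← mul_sub, div_mul_eq_mul_div, le_div_iff₀ hβ0]
  push_cast
  rw [← add_assoc]
  nlinarith

/-- Second-order control of the increments of `(1 + x) ^ α / α`. -/
lemma abs_increment_sub_le {α η : ℝ} (hα0 : 0 < α) (hα1 : α ≤ 1) (hη : 0 ≤ η) (x l : ℝ≥0) :
    |((1 + ((x + l : ℝ≥0) : ℝ)) ^ α / α - (1 + (x : ℝ)) ^ α / α) - l * powWeight α x| ≤
      (l : ℝ) ^ 2 * powWeight η x := by
  have h0 : (0 : ℝ) < 1 + x := by positivity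
  have hl : (0 : ℝ) ≤ l := l.2
  have h1 := rpow_add_le h0 hl hα0.le hα1
  have h2 := rpow_sub_rpow_ge h0 hl hα0.le hα1
  have h3 := rpow_sub_rpow_neg_le h0 hl hα0.le
  have h4 : (1 + (x : ℝ)) ^ (α - 2) ≤ powWeight η x :=
    Real.rpow_le_rpow_of_exponent_le (by simp) (by linarith)
  push_cast
  rw [← add_assoc, ← sub_div, abs_le]
  constructor
  · have h5 : l * (1 + (x : ℝ) + l) ^ (α - 1) ≤ ((1 + (x : ℝ) + l) ^ α - (1 + (x : ℝ)) ^ α) / α := by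
      rw [le_div_iff₀ hα0]; linarith
    have h6 := mul_le_mul_of_nonneg_left h3 hl
    have h7 := mul_le_mul_of_nonneg_left h4 (sq_nonneg (l : ℝ))
    unfold powWeight at *
    nlinarith
  · have h5 : ((1 + (x : ℝ) + l) ^ α - (1 + (x : ℝ)) ^ α) / α ≤ l * (1 + (x : ℝ)) ^ (α - 1) := by
      rw [div_le_iff₀ hα0]; linarith
    have h8 : 0 ≤ (l : ℝ) ^ 2 * powWeight η x := by have := powWeight_pos η x; positivity
    unfold powWeight at *
    linarith

/-- The length of a run that straddles `t`, and `0` for the other runs. -/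
def straddle (t x l : ℝ≥0) : ℝ := if t < x + l then l else 0

lemma measurable_straddle (t : ℝ≥0) : Measurable (Function.uncurry (straddle t)) := by
  unfold straddle Function.uncurry
  exact Measurable.ite (measurableSet_lt measurable_const (by fun_prop)) (by fun_prop)
    measurable_const

lemma straddle_nonneg (t x l : ℝ≥0) : 0 ≤ straddle t x l := by
  unfold straddle; split_ifs <;> simp

section

variable {Ω : Type*} {L : ℕ → Ω → ℝ≥0}

/-- Telescoping of increments along the runs started before `t`. -/
lemma visitSum_increment (t : ℝ≥0) (n : ℕ) (V : ℝ≥0 → ℝ) (ω : Ω) :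
    (relocTime L n ω ≤ t → visitSum L t n (fun x l => V (x + l) - V x) ω = V (relocTime L n ω) - V 0 ∧
      visitSum L t n (straddle t) ω = 0) ∧
    (t < relocTime L n ω → ∃ τ : ℝ≥0, t ≤ τ ∧ (τ : ℝ) ≤ t + visitSum L t n (straddle t) ω ∧
      visitSum L t n (fun x l => V (x + l) - V x) ω = V τ - V 0) := by
  induction n with
  | zero => simp [visitSum]
  | succ n ih =>
    obtain ⟨ih1, ih2⟩ := ih
    rw [visitSum_succ, visitSum_succ, relocTime_succ]
    rcases le_or_gt (relocTime L n ω) t with h | h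
    -- Run `n` starts before `t`. If it ends after `t`, it is the straddling run and `τ` is its end;
    -- later runs add nothing to either sum.
    · obtain ⟨e1, e2⟩ := ih1 h
      simp only [h, if_true, e1, e2]
      refine ⟨fun h2 => ⟨by ring, by simp [straddle, h2]⟩, fun h2 => ⟨_, h2.le, ?_, by ring⟩⟩
      simp only [straddle, h2, if_true]
      push_cast
      have : (relocTime L n ω : ℝ) ≤ t := by exact_mod_cast h
      linarith
    · obtain ⟨τ, h1, h2, h3⟩ := ih2 h
      refine ⟨fun h4 => absurd ((le_self_add).trans h4) (not_le.2 h), fun _ => ⟨τ, h1, ?_, ?_⟩⟩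
      · simpa [not_le.2 h] using h2
      · simpa [not_le.2 h] using h3

/-- The sum is a left Riemann sum of `(1 + x)^(α-1)` along the runs. Increments of the primitive `(1
+ x)^α / α` telescope up to the first renewal time after `t`, which overshoots `t` by at most the
straddling length. The second-order errors are of order `l² (1 + x)^(α-2)`, which any weight with `η
≥ 0` dominates. -/
lemma abs_visitSum_mul_powWeight_sub_le {α η : ℝ} (hα0 : 0 < α) (hα1 : α ≤ 1) (hη : 0 ≤ η) (t : ℝ≥0)
    (n : ℕ) (ω : Ω) (ht : t < relocTime L n ω) :
    |visitSum L t n (fun x l => l * powWeight α x) ω - (t : ℝ) ^ α / α| ≤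
      visitSum L t n (fun x l => (l : ℝ) ^ 2 * powWeight η x) ω +
        (1 + visitSum L t n (straddle t) ω) / α := by
  obtain ⟨τ, h1, h2, h3⟩ := (visitSum_increment (L := L) t n
    (fun x => (1 + (x : ℝ)) ^ α / α) ω).2 ht
  set s := visitSum L t n (straddle t) ω with hs
  have hs0 : 0 ≤ s := visitSum_nonneg t n (straddle_nonneg t) ω
  have e1 : visitSum L t n (fun x l => l * powWeight α x) ω =
      visitSum L t n (fun x l => (1 + ((x + l : ℝ≥0) : ℝ)) ^ α / α - (1 + (x : ℝ)) ^ α / α) ω -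
      visitSum L t n (fun x l => ((1 + ((x + l : ℝ≥0) : ℝ)) ^ α / α - (1 + (x : ℝ)) ^ α / α) -
        l * powWeight α x) ω := by
    rw [eq_sub_iff_add_eq, ← visitSum_add]
    congr 1
    funext x l
    ring
  have b1 := abs_visitSum_le (L := L) t n (abs_increment_sub_le hα0 hα1 hη) ω
  have b2 : |((1 + (τ : ℝ)) ^ α / α - (1 + ((0 : ℝ≥0) : ℝ)) ^ α / α) - (t : ℝ) ^ α / α| ≤
      (1 + s) / α := by
    have ht' : (t : ℝ) ≤ τ := by exact_mod_cast h1
    rw [← sub_div, ← sub_div, abs_div, abs_of_pos hα0]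
    gcongr
    have u1 : (t : ℝ) ^ α ≤ (1 + (τ : ℝ)) ^ α := by gcongr; linarith
    have u2 : (1 + (τ : ℝ)) ^ α ≤ (t : ℝ) ^ α + (1 + s) ^ α :=
      calc (1 + (τ : ℝ)) ^ α ≤ (t + (1 + s)) ^ α :=
            Real.rpow_le_rpow (by positivity) (by linarith) hα0.le
        _ ≤ _ := Real.rpow_add_le_add_rpow t.2 (by positivity) hα0.le hα1
    have u3 : (1 + s) ^ α ≤ 1 + s := by
      calc (1 + s) ^ α ≤ (1 + s) ^ (1 : ℝ) :=
            Real.rpow_le_rpow_of_exponent_le (by linarith) hα1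
        _ = 1 + s := Real.rpow_one _
    simp only [NNReal.coe_zero, add_zero, Real.one_rpow]
    rw [abs_le]; constructor <;> linarith
  rw [h3] at e1
  rw [e1]
  calc _ = |(((1 + (τ : ℝ)) ^ α / α - (1 + ((0 : ℝ≥0) : ℝ)) ^ α / α) - (t : ℝ) ^ α / α) -
        visitSum L t n (fun x l => ((1 + ((x + l : ℝ≥0) : ℝ)) ^ α / α - (1 + (x : ℝ)) ^ α / α) -
        l * powWeight α x) ω| := by congr 1; ring
    _ ≤ _ := (abs_sub _ _).trans (by linarith)

end

/-! ### Expected visit sums, the straddling run and non-explosion -/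

section

variable {Ω : Type*} [MeasurableSpace Ω] {Pr : Measure Ω} {φ : Measure ℝ≥0} {L : ℕ → Ω → ℝ≥0}
  [IsProbabilityMeasure Pr] [IsProbabilityMeasure φ]

/-- Up to constants this replaces the renewal measure by Lebesgue measure, uniformly in the
truncation `n`. -/
lemma IsRunSequence.integral_visitSum_powWeight_le (hL : IsRunSequence Pr φ L) (hφ : φ {0} = 0)
    {β : ℝ} (hβ0 : 0 < β) (hβ1 : β ≤ 1) {q : ℝ≥0 → ℝ} (hq : Integrable q φ) (hqm : Measurable q)
    (hq0 : ∀ l, 0 ≤ q l) (t : ℝ≥0) (n : ℕ) :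
    ∫ ω, visitSum L t n (fun x l => q l * powWeight β x) ω ∂Pr ≤
      (∫ l, q l ∂φ) / truncMean φ * (4 / β) * (1 + (t : ℝ)) ^ β := by
  have h := hL.integral_visitSum_le hφ t n (v := powWeight β)
    (V := fun x => 2 / β * (1 + (x : ℝ)) ^ β) (measurable_powWeight β)
    (fun x => (powWeight_pos β x).le) (powWeight_le_one hβ1) hq hqm hq0
    (fun x y hxy _ => by have : (x : ℝ) ≤ y := by exact_mod_cast hxy
                         gcongr)
    (fun x h _ hh => mul_powWeight_le hβ0 hβ1 x h hh)
  refine h.trans ?_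
  rw [mul_assoc]
  have h1 : 0 ≤ (∫ l, q l ∂φ) / truncMean φ :=
    div_nonneg (integral_nonneg hq0) (truncMean_pos hφ).le
  refine mul_le_mul_of_nonneg_left ?_ h1
  have h2 : (1 + ((t + 1 : ℝ≥0) : ℝ)) ^ β ≤ 2 * (1 + (t : ℝ)) ^ β := by
    calc (1 + ((t + 1 : ℝ≥0) : ℝ)) ^ β ≤ (2 * (1 + (t : ℝ))) ^ β := by
          have : (0 : ℝ) ≤ t := t.2
          gcongr; push_cast; linarith
      _ = 2 ^ β * (1 + (t : ℝ)) ^ β := by rw [Real.mul_rpow (by norm_num) (by positivity)]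
      _ ≤ 2 ^ (1 : ℝ) * (1 + (t : ℝ)) ^ β := by gcongr; norm_num
      _ = _ := by rw [Real.rpow_one]
  have h3 := mul_le_mul_of_nonneg_left h2 (by positivity : 0 ≤ 2 / β)
  have h4 : 0 ≤ 2 / β * (1 + ((0 : ℝ≥0) : ℝ)) ^ β := by positivity
  calc _ ≤ 2 / β * (2 * (1 + (t : ℝ)) ^ β) := by linarith
    _ = _ := by ring

/-- The expected length of the run straddling `t` is bounded. -/
lemma IsRunSequence.integral_visitSum_straddle_le (hL : IsRunSequence Pr φ L) (hφ : φ {0} = 0)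
    (hq : Integrable (fun l : ℝ≥0 => (l : ℝ) * (2 + l) ^ 2) φ) (t : ℝ≥0) (n : ℕ) :
    ∫ ω, visitSum L t n (straddle t) ω ∂Pr ≤ (∫ l, (l : ℝ) * (2 + l) ^ 2 ∂φ) / truncMean φ := by
  -- On a straddling run `t - x ≤ l`, so its length is at most `l (2 + l)² / (2 + t - x)²`. The
  -- weight `(2 + t - x)⁻²` has potential `(2 + t - x)⁻¹`, whose total increase is at most `1`
  -- whatever `t` is; the `2` keeps the denominator at least `1` up to time `t + 1`.
  have h := hL.integral_visitSum_le hφ t n (v := fun x => ((2 + ((t - x : ℝ≥0) : ℝ)) ^ 2)⁻¹)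
    (V := fun x => (2 + (t : ℝ) - x)⁻¹) (q := fun l => (l : ℝ) * (2 + l) ^ 2)
    (by fun_prop) (fun x => by positivity)
    (fun x => by
      have : (0 : ℝ) ≤ ((t - x : ℝ≥0) : ℝ) := NNReal.coe_nonneg _
      refine inv_le_one_of_one_le₀ ?_
      nlinarith) hq (by fun_prop) (fun l => by positivity)
    (fun x y hxy hy => by
      have h1 : (x : ℝ) ≤ y := by exact_mod_cast hxy
      have h2 : (y : ℝ) ≤ t + 1 := by exact_mod_cast hy
      exact inv_anti₀ (by linarith) (by linarith))
    (fun x h hx hh => by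
      have h1 : (x : ℝ) ≤ t := by exact_mod_cast hx
      have h2 : (h : ℝ) ≤ 1 := by exact_mod_cast hh
      have h3 : (0 : ℝ) ≤ h := h.2
      rw [NNReal.coe_sub hx]
      push_cast
      have a1 : 0 < 2 + (t : ℝ) - x := by linarith
      have a2 : 0 < 2 + (t : ℝ) - (x + h) := by linarith
      rw [inv_sub_inv a2.ne' a1.ne', ← div_eq_mul_inv]
      rw [div_le_div_iff₀ (by positivity) (by positivity)]
      have e : 2 + ((t : ℝ) - x) = 2 + t - x := by ring
      rw [e]
      have : 0 ≤ h * (2 + (t : ℝ) - x) * h := by positivity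
      nlinarith)
  have hb : (2 + (t : ℝ) - ((t + 1 : ℝ≥0) : ℝ))⁻¹ - (2 + (t : ℝ) - ((0 : ℝ≥0) : ℝ))⁻¹ ≤ 1 := by
    have : 0 ≤ (2 + (t : ℝ) - ((0 : ℝ≥0) : ℝ))⁻¹ := by simp; positivity
    push_cast at *
    have e : 2 + (t : ℝ) - (t + 1) = 1 := by ring
    rw [e]; norm_num at *; linarith
  have h1 : 0 ≤ (∫ l, (l : ℝ) * (2 + l) ^ 2 ∂φ) / truncMean φ :=
    div_nonneg (integral_nonneg fun l => by positivity) (truncMean_pos hφ).le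
  refine le_trans ?_ (h.trans (mul_le_of_le_one_right h1 hb))
  refine integral_mono_of_nonneg (Eventually.of_forall fun ω =>
    visitSum_nonneg t n (straddle_nonneg t) ω) ?_ (Eventually.of_forall fun ω =>
    visitSum_mono t n (fun x l => ?_) ω)
  · refine hL.integrable_visitSum t n (by unfold Function.uncurry; fun_prop) hq (fun x l => ?_)
    rw [abs_of_nonneg (by positivity)]
    have : (0 : ℝ) ≤ ((t - x : ℝ≥0) : ℝ) := NNReal.coe_nonneg _
    refine mul_le_of_le_one_right (by positivity) (inv_le_one_of_one_le₀ ?_)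
    nlinarith
  · unfold straddle
    split_ifs with hlt
    · have h2 : ((t - x : ℝ≥0) : ℝ) ≤ l := by
        exact_mod_cast tsub_le_iff_left.2 hlt.le
      have h3 : (0 : ℝ) ≤ ((t - x : ℝ≥0) : ℝ) := NNReal.coe_nonneg _
      rw [mul_assoc]
      refine le_mul_of_one_le_right l.2 ?_
      rw [← div_eq_mul_inv, one_le_div (by positivity)]
      gcongr
    · positivity

/-- The expected number of renewals before `t` is finite, by the renewal bound with weight `1` and
potential `x`. Since `P(T_k ≤ t)` decreases in `k`, it is `O(1 / n)` at `k = n`. -/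
lemma IsRunSequence.tendsto_measureReal_relocTime_le (hL : IsRunSequence Pr φ L) (hφ : φ {0} = 0)
    (t : ℝ≥0) : Tendsto (fun n => Pr.real {ω | relocTime L n ω ≤ t}) atTop (𝓝 0) := by
  have hmeas : ∀ k, MeasurableSet {ω | relocTime L k ω ≤ t} := fun k =>
    measurableSet_le (hL.measurable_relocTime k) measurable_const
  have h : ∀ n : ℕ, n * Pr.real {ω | relocTime L n ω ≤ t} ≤ (t + 1) / truncMean φ := by
    intro n
    have h := hL.integral_visitSum_le hφ t n (v := fun _ => 1)
      (V := fun x => (x : ℝ)) (q := fun _ => 1)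
      (by fun_prop) (fun x => by positivity) (fun x => le_rfl) (integrable_const _) (by fun_prop)
      (fun l => by positivity) (fun x y hxy _ => by exact_mod_cast hxy)
      (fun x h _ _ => by push_cast; linarith)
    have e : ∫ ω, visitSum L t n (fun _ _ => 1 * 1) ω ∂Pr =
        ∑ k ∈ Finset.range n, Pr.real {ω | relocTime L k ω ≤ t} := by
      unfold visitSum
      rw [integral_finsetSum _ fun k _ => hL.integrable_visitTerm (F := fun _ _ => 1 * 1) t k
        (by unfold Function.uncurry; fun_prop) (integrable_const 1) (fun _ _ => by simp)]
      refine Finset.sum_congr rfl fun k _ => ?_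
      rw [← integral_indicator_one (hmeas k)]
      congr 1
      funext ω
      simp [Set.indicator_apply]
    rw [e] at h
    have h2 : n * Pr.real {ω | relocTime L n ω ≤ t} ≤
        ∑ k ∈ Finset.range n, Pr.real {ω | relocTime L k ω ≤ t} := by
      have := Finset.card_nsmul_le_sum (Finset.range n)
        (fun k => Pr.real {ω | relocTime L k ω ≤ t}) (Pr.real {ω | relocTime L n ω ≤ t}) ?_
      · simpa using this
      intro k hk
      refine measureReal_mono fun ω hω => ?_
      exact le_trans (relocTime_mono ω (Finset.mem_range.1 hk).le) hω
    refine h2.trans (h.trans (le_of_eq ?_))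
    simp; ring
  refine squeeze_zero' (Eventually.of_forall fun n => measureReal_nonneg)
    ((eventually_gt_atTop 0).mono fun n hn => ?_)
    (tendsto_const_div_atTop_nhds_zero_nat ((t + 1) / truncMean φ))
  rw [le_div_iff₀ (by exact_mod_cast hn)]
  linarith [h n]

lemma IsRunSequence.ae_exists_lt_relocTime (hL : IsRunSequence Pr φ L) (hφ : φ {0} = 0) :
    ∀ᵐ ω ∂Pr, ∀ t : ℝ≥0, ∃ n, t < relocTime L n ω := by
  have h : ∀ᵐ ω ∂Pr, ∀ t : ℕ, ∃ n, (t : ℝ≥0) < relocTime L n ω := by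
    rw [ae_all_iff]
    intro t
    rw [ae_iff]
    refine le_antisymm (ge_of_tendsto' (x := atTop) (f := fun n : ℕ => Pr {ω | relocTime L n ω ≤ t}) ?_
      fun n => ?_) bot_le
    · have := ENNReal.tendsto_ofReal (hL.tendsto_measureReal_relocTime_le hφ t)
      simpa [measureReal_def] using this
    · refine measure_mono fun ω hω => ?_
      simp only [not_exists, not_lt] at hω
      exact hω n
  filter_upwards [h] with ω hω t
  obtain ⟨m, hm⟩ := exists_nat_gt t
  obtain ⟨n, hn⟩ := hω m
  exact ⟨n, hm.trans hn⟩

end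

/-! ### Second moments and the ergodic estimate for visit sums -/

section

variable {Ω : Type*} [MeasurableSpace Ω] {Pr : Measure Ω} {φ : Measure ℝ≥0} {L : ℕ → Ω → ℝ≥0}

lemma IsRunSequence.memLp_visitTerm (hL : IsRunSequence Pr φ L) (t : ℝ≥0) (k : ℕ)
    {F : ℝ≥0 → ℝ≥0 → ℝ} (hF : Measurable (Function.uncurry F)) {q : ℝ≥0 → ℝ}
    (hq : MemLp q 2 φ) (hFq : ∀ x l, |F x l| ≤ q l) :
    MemLp (fun ω => if relocTime L k ω ≤ t then F (relocTime L k ω) (L k ω) else 0) 2 Pr := by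
  have h1 : MemLp (fun ω => q (L k ω)) 2 Pr := by
    rw [← (hL.law k).map_eq] at hq
    exact hq.comp_of_map (hL.measurable k).aemeasurable
  refine h1.mono' (hL.measurable_visitTerm t k hF).aestronglyMeasurable
    (Eventually.of_forall fun ω => ?_)
  split_ifs
  · exact hFq _ _
  · simpa using (abs_nonneg _).trans (hFq 0 (L k ω))

lemma IsRunSequence.memLp_visitSum (hL : IsRunSequence Pr φ L) (t : ℝ≥0) (n : ℕ)
    {F : ℝ≥0 → ℝ≥0 → ℝ} (hF : Measurable (Function.uncurry F)) {q : ℝ≥0 → ℝ}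
    (hq : MemLp q 2 φ) (hFq : ∀ x l, |F x l| ≤ q l) : MemLp (visitSum L t n F) 2 Pr := by
  unfold visitSum
  exact memLp_finsetSum _ fun k _ => hL.memLp_visitTerm t k hF hq hFq

variable [IsProbabilityMeasure Pr] [IsProbabilityMeasure φ]

/-- Orthogonality of the increments of a visit sum of centred terms. -/
lemma IsRunSequence.integral_visitSum_sq (hL : IsRunSequence Pr φ L) (t : ℝ≥0) (n : ℕ)
    {D : ℝ≥0 → ℝ≥0 → ℝ} (hD : Measurable (Function.uncurry D)) {q : ℝ≥0 → ℝ}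
    (hq : MemLp q 2 φ) (hDq : ∀ x l, |D x l| ≤ q l) (hD0 : ∀ x, ∫ l, D x l ∂φ = 0) :
    ∫ ω, visitSum L t n D ω ^ 2 ∂Pr = ∫ ω, visitSum L t n (fun x l => D x l ^ 2) ω ∂Pr := by
  have hq2 : Integrable (fun l => q l ^ 2) φ := hq.integrable_sq
  have hD2 : ∀ x l, |D x l ^ 2| ≤ q l ^ 2 := fun x l => by
    rw [abs_pow]; exact pow_le_pow_left₀ (abs_nonneg _) (hDq x l) 2
  have hD2m : Measurable (Function.uncurry fun x l => D x l ^ 2) := hD.pow_const 2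
  induction n with
  | zero => simp [visitSum]
  | succ n ih =>
    set Y := fun ω => visitSum L t n D ω
    set u := fun ω => if relocTime L n ω ≤ t then D (relocTime L n ω) (L n ω) else 0 with hu
    have hY : MemLp Y 2 Pr := hL.memLp_visitSum t n hD hq hDq
    have hum : MemLp u 2 Pr := hL.memLp_visitTerm t n hD hq hDq
    have hYu : Integrable (fun ω => Y ω * u ω) Pr := hY.integrable_mul hum
    -- Both `Y` and `T_n` are functions of the first `n` run lengths, while `D x` has mean zero in
    -- the next one.
    have hcross : ∫ ω, Y ω * u ω ∂Pr = 0 := by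
      have hH : Measurable fun a : ℕ → ℝ≥0 =>
          (visitSum (fun i (a : ℕ → ℝ≥0) => a i) t n D a, ∑ i ∈ Finset.range n, a i) := by
        refine Measurable.prodMk ?_ (by fun_prop)
        unfold visitSum
        refine Finset.measurable_fun_sum _ fun k _ => ?_
        have hr : Measurable (relocTime (fun i (a : ℕ → ℝ≥0) => a i) k) := by
          unfold relocTime; fun_prop
        exact Measurable.ite (measurableSet_le hr measurable_const)
          (hD.comp (hr.prodMk (measurable_pi_apply k))) measurable_const
      have := hL.integral_prefix (S := ℝ × ℝ≥0) n hH ?_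
        (G := fun p l => p.1 * if p.2 ≤ t then D p.2 l else 0) ?_ hYu
      · refine this.trans ?_
        rw [← integral_zero Ω ℝ]
        congr 1
        funext ω
        rw [integral_const_mul]
        split_ifs <;> simp [hD0]
      · intro a b hab
        have h1 : ∀ k ≤ n, relocTime (fun i (a : ℕ → ℝ≥0) => a i) k a =
            relocTime (fun i (a : ℕ → ℝ≥0) => a i) k b := fun k hk =>
          relocTime_congr_of_prefix (a := a) (b := b) fun i hi => hab i (hi.trans_le hk)
        refine Prod.ext ?_ (h1 n le_rfl)
        change visitSum _ t n D a = visitSum _ t n D b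
        unfold visitSum
        refine Finset.sum_congr rfl fun k hk => ?_
        have hk := Finset.mem_range.1 hk
        rw [h1 k hk.le]
        simp only [hab k hk]
      · refine (measurable_fst.comp measurable_fst).mul (Measurable.ite (measurableSet_le
          (measurable_snd.comp measurable_fst) measurable_const) ?_ measurable_const)
        exact hD.comp ((measurable_snd.comp measurable_fst).prodMk measurable_snd)
    have e1 : ∀ ω, visitSum L t (n + 1) D ω ^ 2 = Y ω ^ 2 + (2 * (Y ω * u ω) + u ω ^ 2) := by
      intro ω; rw [visitSum_succ]; ring
    have e2 : ∀ ω, visitSum L t (n + 1) (fun x l => D x l ^ 2) ω =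
        visitSum L t n (fun x l => D x l ^ 2) ω + u ω ^ 2 := by
      intro ω; rw [visitSum_succ, hu]
      by_cases h : relocTime L n ω ≤ t <;> simp [h]
    simp_rw [e1, e2]
    have hsum : Integrable (fun ω => 2 * (Y ω * u ω) + u ω ^ 2) Pr :=
      (hYu.const_mul 2).add hum.integrable_sq
    rw [integral_add hY.integrable_sq hsum,
      integral_add (hYu.const_mul 2) hum.integrable_sq, integral_const_mul, hcross, ih,
      integral_add (hL.integrable_visitSum t n hD2m hq2 hD2) hum.integrable_sq]
    ring

lemma integrable_one_add_pow {p : ℕ} (hp : Integrable (fun l : ℝ≥0 => (l : ℝ) ^ p) φ) {k : ℕ}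
    (hk : k ≤ p) : Integrable (fun l : ℝ≥0 => (1 + (l : ℝ)) ^ k) φ := by
  refine ((integrable_const ((2 : ℝ) ^ p)).add (hp.const_mul (2 ^ p))).mono'
    (by fun_prop : Measurable fun l : ℝ≥0 => (1 + (l : ℝ)) ^ k).aestronglyMeasurable
    (Eventually.of_forall fun l => ?_)
  have hl : (0 : ℝ) ≤ l := l.2
  rw [Real.norm_eq_abs, abs_of_nonneg (by positivity)]
  simp only [Pi.add_apply]
  calc (1 + (l : ℝ)) ^ k ≤ (1 + (l : ℝ)) ^ p := pow_le_pow_right₀ (by linarith) hk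
    _ ≤ 2 ^ p + 2 ^ p * (l : ℝ) ^ p := by
      rcases le_total (l : ℝ) 1 with h | h
      · have : (1 + (l : ℝ)) ^ p ≤ 2 ^ p := pow_le_pow_left₀ (by positivity) (by linarith) p
        have : 0 ≤ 2 ^ p * (l : ℝ) ^ p := by positivity
        linarith
      · have : (1 + (l : ℝ)) ^ p ≤ (2 * l) ^ p := pow_le_pow_left₀ (by positivity) (by linarith) p
        rw [mul_pow] at this
        have : (0 : ℝ) ≤ 2 ^ p := by positivity
        linarith

/-- A visit sum of centred terms dominated by `(1 + l) ^ 4 * powWeight δ x` is of order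
`t ^ (δ ^ 2 / 2)`. -/
lemma IsRunSequence.integral_abs_visitSum_le (hL : IsRunSequence Pr φ L) (hφ : φ {0} = 0)
    (hmom : Integrable (fun l : ℝ≥0 => (1 + (l : ℝ)) ^ 8) φ) {δ : ℝ} (hδ0 : 0 < δ) (hδ1 : δ < 1)
    {D : ℝ≥0 → ℝ≥0 → ℝ} (hD : Measurable (Function.uncurry D)) {C : ℝ}
    (hDC : ∀ x l, |D x l| ≤ C * (1 + (l : ℝ)) ^ 4 * powWeight δ x) (hD0 : ∀ x, ∫ l, D x l ∂φ = 0) :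
    ∃ K : ℝ, 0 ≤ K ∧ ∀ (t : ℝ≥0) (n : ℕ),
      ∫ ω, |visitSum L t n D ω| ∂Pr ≤ K * (1 + (t : ℝ)) ^ (δ ^ 2 / 2) := by
  have hC : 0 ≤ C := by
    have h1 := (abs_nonneg _).trans (hDC 0 0)
    simp [powWeight] at h1
    exact h1
  have hδ2 : 0 < δ ^ 2 := by positivity
  have hδ2' : δ ^ 2 ≤ 1 := by nlinarith
  -- The eighth moment is needed because the dominating function `(1 + l)^4` is squared.
  have hq : MemLp (fun l : ℝ≥0 => C * (1 + (l : ℝ)) ^ 4) 2 φ := by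
    rw [memLp_two_iff_integrable_sq
      (by fun_prop : Measurable fun l : ℝ≥0 => C * (1 + (l : ℝ)) ^ 4).aestronglyMeasurable]
    refine (hmom.const_mul (C ^ 2)).congr (Eventually.of_forall fun l => ?_)
    simp only; ring
  have hDq : ∀ x l, |D x l| ≤ C * (1 + (l : ℝ)) ^ 4 := fun x l =>
    (hDC x l).trans (mul_le_of_le_one_right (by positivity) (powWeight_le_one hδ1.le x))
  set A := (∫ l, C ^ 2 * (1 + (l : ℝ)) ^ 8 ∂φ) / truncMean φ * (4 / δ ^ 2) with hA
  have hA0 : 0 ≤ A := mul_nonneg (div_nonneg (integral_nonneg fun l => by positivity)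
    (truncMean_pos hφ).le) (by positivity)
  refine ⟨(A + 1) / 2, by positivity, fun t n => ?_⟩
  have h2 : ∫ ω, visitSum L t n D ω ^ 2 ∂Pr ≤ A * (1 + (t : ℝ)) ^ (δ ^ 2) := by
    rw [hL.integral_visitSum_sq t n hD hq hDq hD0]
    refine le_trans ?_ (hL.integral_visitSum_powWeight_le hφ hδ2 hδ2' (hmom.const_mul (C ^ 2))
      (by fun_prop) (fun l => by positivity) t n)
    refine integral_mono_of_nonneg (Eventually.of_forall fun ω => visitSum_nonneg t n
      (fun x l => sq_nonneg _) ω) ?_ (Eventually.of_forall fun ω => visitSum_mono t n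
      (fun x l => ?_) ω)
    · refine hL.integrable_visitSum t n ?_ (hmom.const_mul (C ^ 2)) (fun x l => ?_)
      · have := measurable_powWeight (δ ^ 2)
        unfold Function.uncurry; fun_prop
      · have := powWeight_pos (δ ^ 2) x
        rw [abs_of_nonneg (by positivity)]
        exact mul_le_of_le_one_right (by positivity) (powWeight_le_one hδ2' x)
    · have h3 : D x l ^ 2 ≤ (C * (1 + (l : ℝ)) ^ 4 * powWeight δ x) ^ 2 := by
        rw [← sq_abs]; exact pow_le_pow_left₀ (abs_nonneg _) (hDC x l) 2
      calc D x l ^ 2 ≤ _ := h3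
        _ = C ^ 2 * (1 + (l : ℝ)) ^ 8 * powWeight δ x ^ 2 := by ring
        _ ≤ _ := mul_le_mul_of_nonneg_left (powWeight_sq_le δ x) (by positivity)
  set r := (1 + (t : ℝ)) ^ (δ ^ 2 / 2) with hr
  have hr0 : 0 < r := by positivity
  have hr2 : (1 + (t : ℝ)) ^ (δ ^ 2) = r ^ 2 := by
    rw [hr, ← Real.rpow_mul_natCast (by positivity)]; congr 1; push_cast; ring
  have hY := hL.memLp_visitSum t n hD hq hDq
  -- From `L²` to `L¹` by `|Y| ≤ Y² / (2r) + r / 2`, with `r` of the order of the standard deviation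
  -- of `Y`.
  have h4 : ∫ ω, |visitSum L t n D ω| ∂Pr ≤ ∫ ω, ((2 * r)⁻¹ * visitSum L t n D ω ^ 2 + r / 2) ∂Pr := by
    refine integral_mono_of_nonneg (Eventually.of_forall fun ω => abs_nonneg _)
      ((hY.integrable_sq.const_mul _).add (integrable_const _)) (Eventually.of_forall fun ω => ?_)
    simp only
    rw [← sq_abs]
    have : 0 ≤ (2 * r)⁻¹ * (|visitSum L t n D ω| - r) ^ 2 := by positivity
    have e : (2 * r)⁻¹ * (|visitSum L t n D ω| - r) ^ 2 =
      (2 * r)⁻¹ * |visitSum L t n D ω| ^ 2 + r / 2 - |visitSum L t n D ω| := by field_simp; ring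
    linarith
  rw [integral_add (hY.integrable_sq.const_mul _) (integrable_const _), integral_const_mul] at h4
  simp only [integral_const, probReal_univ, smul_eq_mul, one_mul] at h4
  rw [hr2] at h2
  have h5 : (2 * r)⁻¹ * ∫ ω, visitSum L t n D ω ^ 2 ∂Pr ≤ (2 * r)⁻¹ * (A * r ^ 2) :=
    mul_le_mul_of_nonneg_left h2 (by positivity)
  have e5 : (2 * r)⁻¹ * (A * r ^ 2) = A * r / 2 := by field_simp
  calc _ ≤ A * r / 2 + r / 2 := by linarith
    _ = _ := by ring

lemma moment_one_pos (hφ : φ {0} = 0) (h1 : Integrable (fun l : ℝ≥0 => (l : ℝ)) φ) :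
    0 < moment φ 1 := by
  refine (truncMean_pos hφ).trans_le ?_
  unfold moment truncMean
  simp only [pow_one]
  exact integral_mono integrable_min_one h1 fun l => min_le_left _ _

/-- Ergodic estimate for visit sums: the mean of `F x` replaces `F x`, and sums over renewal times
are replaced by integrals. -/
lemma IsRunSequence.integral_abs_visitSum_sub_le (hL : IsRunSequence Pr φ L) (hφ : φ {0} = 0)
    (hmom : Integrable (fun l : ℝ≥0 => (1 + (l : ℝ)) ^ 8) φ) {δ : ℝ} (hδ0 : 0 < δ) (hδ1 : δ < 1)
    {F : ℝ≥0 → ℝ≥0 → ℝ} (hF : Measurable (Function.uncurry F)) {C : ℝ}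
    (hFC : ∀ x l, |F x l| ≤ C * (1 + (l : ℝ)) ^ 4 * powWeight δ x)
    {ι : Type*} (s : Finset ι) {c α : ι → ℝ} (hα0 : ∀ i ∈ s, 0 < α i) (hα1 : ∀ i ∈ s, α i ≤ 1)
    {ρ C' : ℝ} (hρ0 : 0 < ρ) (hρ1 : ρ ≤ 1) (hρδ : δ ^ 2 / 2 ≤ ρ)
    (hmean : ∀ x, |∫ l, F x l ∂φ - ∑ i ∈ s, c i * powWeight (α i) x| ≤ C' * powWeight ρ x) :
    ∃ K : ℝ, 0 ≤ K ∧ ∀ (t : ℝ≥0) (n : ℕ),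
      ∫ ω, (if t < relocTime L n ω then
        |visitSum L t n F ω - (moment φ 1)⁻¹ * ∑ i ∈ s, c i * ((t : ℝ) ^ α i / α i)| else 0) ∂Pr ≤
        K * (1 + (t : ℝ)) ^ ρ := by
  have hi : ∀ k ≤ 8, Integrable (fun l : ℝ≥0 => (1 + (l : ℝ)) ^ k) φ := fun k hk =>
    hmom.mono' (by fun_prop : Measurable fun l : ℝ≥0 => (1 + (l : ℝ)) ^ k).aestronglyMeasurable
      (Eventually.of_forall fun l => by
        rw [Real.norm_eq_abs, abs_of_nonneg (by positivity)]
        exact pow_le_pow_right₀ (by simp) hk)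
  have hdom : ∀ {g : ℝ≥0 → ℝ} {k : ℕ}, k ≤ 8 → Measurable g → (∀ l, |g l| ≤ 4 * (1 + (l : ℝ)) ^ k) →
      Integrable g φ := fun {g k} hk hg hb =>
    ((hi k hk).const_mul 4).mono' hg.aestronglyMeasurable (Eventually.of_forall hb)
  have hl1 : Integrable (fun l : ℝ≥0 => (l : ℝ)) φ := hdom (k := 1) (by norm_num) (by fun_prop)
    fun l => by rw [abs_of_nonneg (NNReal.coe_nonneg l)]; have : (0 : ℝ) ≤ l := l.2; nlinarith
  have hl2 : Integrable (fun l : ℝ≥0 => (l : ℝ) ^ 2) φ := hdom (k := 2) (by norm_num) (by fun_prop)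
    fun l => by rw [abs_of_nonneg (by positivity)]; have : (0 : ℝ) ≤ l := l.2; nlinarith
  have hl3 : Integrable (fun l : ℝ≥0 => (l : ℝ) * (2 + l) ^ 2) φ :=
    hdom (k := 3) (by norm_num) (by fun_prop) fun l => by
      rw [abs_of_nonneg (by positivity)]
      have : (0 : ℝ) ≤ l := l.2
      nlinarith [pow_nonneg this 2, pow_nonneg this 3]
  have hm1 := moment_one_pos hφ hl1
  set m := moment φ 1 with hm
  set Fbar := fun x => ∫ l, F x l ∂φ with hFbar
  have hFbm : Measurable Fbar := hF.stronglyMeasurable.integral_prod_right.measurable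
  have hC : 0 ≤ C := by
    have h1 := (abs_nonneg _).trans (hFC 0 0)
    simp [powWeight] at h1
    exact h1
  have hC' : 0 ≤ C' := by
    have h1 := (abs_nonneg _).trans (hmean 0)
    simp only [powWeight, NNReal.coe_zero, add_zero, Real.one_rpow, mul_one] at h1
    exact h1
  have hFint : ∀ x, Integrable (F x) φ := fun x =>
    ((hi 4 (by norm_num)).const_mul C).mono'
      (hF.comp measurable_prodMk_left).aestronglyMeasurable (Eventually.of_forall fun l =>
        (hFC x l).trans (mul_le_of_le_one_right (by positivity) (powWeight_le_one hδ1.le x)))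
  set m4 := ∫ l : ℝ≥0, (1 + (l : ℝ)) ^ 4 ∂φ with hm4
  have hm40 : 0 ≤ m4 := integral_nonneg fun l => by positivity
  have hFb : ∀ x, |Fbar x| ≤ C * m4 * powWeight δ x := fun x => by
    refine abs_integral_le_integral_abs.trans ?_
    refine (integral_mono (hFint x).abs (((hi 4 (by norm_num)).const_mul C).mul_const _)
      (hFC x)).trans (le_of_eq ?_)
    rw [integral_mul_const, integral_const_mul]
  -- the centred part
  set D := fun x (l : ℝ≥0) => F x l - l / m * Fbar x with hD
  have hDm : Measurable (Function.uncurry D) := by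
    refine hF.sub ?_
    have : Measurable fun p : ℝ≥0 × ℝ≥0 => Fbar p.1 := hFbm.comp measurable_fst
    exact (Measurable.div_const (by fun_prop) m).mul this
  obtain ⟨K₁, hK₁0, hK₁⟩ := hL.integral_abs_visitSum_le hφ hmom hδ0 hδ1 hDm
    (C := C + C * m4 / m) (fun x l => by
      have hl : (0 : ℝ) ≤ l := l.2
      have hp := powWeight_pos δ x
      have h1 : |(l : ℝ) / m * Fbar x| ≤ (1 + (l : ℝ)) ^ 4 / m * (C * m4 * powWeight δ x) := by
        rw [abs_mul, abs_of_nonneg (by positivity)]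
        refine mul_le_mul ?_ (hFb x) (abs_nonneg _) (by positivity)
        gcongr
        nlinarith [pow_nonneg hl 2, pow_nonneg hl 3, pow_nonneg hl 4]
      calc |D x l| ≤ |F x l| + |(l : ℝ) / m * Fbar x| := abs_sub _ _
        _ ≤ _ := add_le_add (hFC x l) h1
        _ = _ := by ring)
    (fun x => by
      simp only [hD]
      rw [integral_sub (hFint x) ((hl1.div_const m).mul_const _), integral_mul_const,
        integral_div]
      have : ∫ l : ℝ≥0, (l : ℝ) ∂φ = m := by simp [hm, moment]
      rw [this, div_self hm1.ne', one_mul, sub_self])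
  set B₂ := (∫ l : ℝ≥0, (l : ℝ) ^ 2 ∂φ) / truncMean φ * (4 / ρ) with hB₂
  set B₁ := (∫ l : ℝ≥0, (l : ℝ) ∂φ) / truncMean φ * (4 / ρ) with hB₁
  set B₀ := (∫ l : ℝ≥0, (l : ℝ) * (2 + l) ^ 2 ∂φ) / truncMean φ with hB₀
  have htm := truncMean_pos hφ
  have hB₂0 : 0 ≤ B₂ := mul_nonneg (div_nonneg (integral_nonneg fun l => by positivity) htm.le)
    (by positivity)
  have hB₁0 : 0 ≤ B₁ := mul_nonneg (div_nonneg (integral_nonneg fun l => by positivity) htm.le)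
    (by positivity)
  have hB₀0 : 0 ≤ B₀ := div_nonneg (integral_nonneg fun l => by positivity) htm.le
  refine ⟨K₁ + m⁻¹ * ∑ i ∈ s, |c i| * (B₂ + (1 + B₀) / α i) + m⁻¹ * C' * B₁, ?_, fun t n => ?_⟩
  · have : 0 ≤ ∑ i ∈ s, |c i| * (B₂ + (1 + B₀) / α i) := Finset.sum_nonneg fun i hi' => by
      have := hα0 i hi'; positivity
    positivity
  set S₂ := fun ω => visitSum L t n (fun x l => (l : ℝ) ^ 2 * powWeight ρ x) ω with hS₂
  set S₁ := fun ω => visitSum L t n (fun x l => (l : ℝ) * powWeight ρ x) ω with hS₁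
  set S₀ := fun ω => visitSum L t n (straddle t) ω with hS₀
  have hpm : Measurable fun p : ℝ≥0 × ℝ≥0 => powWeight ρ p.1 :=
    (measurable_powWeight ρ).comp measurable_fst
  have i2 : Integrable S₂ Pr := hL.integrable_visitSum t n
    (by unfold Function.uncurry; fun_prop) hl2 fun x l => by
      have := powWeight_pos ρ x
      rw [abs_of_nonneg (by positivity)]
      exact mul_le_of_le_one_right (by positivity) (powWeight_le_one hρ1 x)
  have i1 : Integrable S₁ Pr := hL.integrable_visitSum t n
    (by unfold Function.uncurry; fun_prop) hl1 fun x l => by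
      have := powWeight_pos ρ x
      rw [abs_of_nonneg (by positivity)]
      exact mul_le_of_le_one_right (by positivity) (powWeight_le_one hρ1 x)
  have i0 : Integrable S₀ Pr := hL.integrable_visitSum t n (measurable_straddle t) hl1 fun x l => by
    rw [abs_of_nonneg (straddle_nonneg _ _ _)]
    unfold straddle; split_ifs <;> simp
  have hqD : ∀ x l, |D x l| ≤ C * (1 + (l : ℝ)) ^ 4 + l / m * (C * m4) := fun x l => by
    have hl : (0 : ℝ) ≤ l := l.2
    refine (abs_sub _ _).trans (add_le_add ((hFC x l).trans
      (mul_le_of_le_one_right (by positivity) (powWeight_le_one hδ1.le x))) ?_)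
    rw [abs_mul, abs_of_nonneg (by positivity)]
    gcongr
    exact (hFb x).trans (mul_le_of_le_one_right (by positivity) (powWeight_le_one hδ1.le x))
  have iD : Integrable (fun ω => |visitSum L t n D ω|) Pr :=
    (hL.integrable_visitSum t n hDm (((hi 4 (by norm_num)).const_mul C).add
      ((hl1.div_const m).mul_const (C * m4))) hqD).abs
  set G := fun ω => |visitSum L t n D ω| + (m⁻¹ * ∑ i ∈ s, |c i| * (S₂ ω + (1 + S₀ ω) / α i) +
    m⁻¹ * C' * S₁ ω) with hG
  have hS₀0 : ∀ ω, 0 ≤ S₀ ω := fun ω => visitSum_nonneg t n (straddle_nonneg t) ω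
  have hS₁0 : ∀ ω, 0 ≤ S₁ ω := fun ω => visitSum_nonneg t n
    (fun x l => mul_nonneg l.2 (powWeight_pos ρ x).le) ω
  have hS₂0 : ∀ ω, 0 ≤ S₂ ω := fun ω => visitSum_nonneg t n
    (fun x l => mul_nonneg (by positivity) (powWeight_pos ρ x).le) ω
  have hG0 : ∀ ω, 0 ≤ G ω := fun ω => by
    have : 0 ≤ ∑ i ∈ s, |c i| * (S₂ ω + (1 + S₀ ω) / α i) := Finset.sum_nonneg fun i hi' => by
      have := hα0 i hi'; have := hS₀0 ω; have := hS₂0 ω; positivity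
    have := hS₁0 ω
    simp only [hG]; positivity
  have hpoint : ∀ ω, (if t < relocTime L n ω then
      |visitSum L t n F ω - m⁻¹ * ∑ i ∈ s, c i * ((t : ℝ) ^ α i / α i)| else 0) ≤ G ω := by
    intro ω
    split_ifs with hlt
    swap
    · exact hG0 ω
    set r := fun x => Fbar x - ∑ i ∈ s, c i * powWeight (α i) x with hr
    -- Since `l / m` has mean one, `F` is the centred `D` plus `(l / m) * Fbar x`, and `Fbar` is its
    -- power expansion plus `r`. Keeping the factor `l` in the compensator turns the main terms into
    -- Riemann sums along the runs.
    have e1 : visitSum L t n F ω = visitSum L t n D ω +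
        (m⁻¹ * ∑ i ∈ s, c i * visitSum L t n (fun x l => l * powWeight (α i) x) ω +
        m⁻¹ * visitSum L t n (fun x l => l * r x) ω) := by
      simp_rw [← visitSum_const_mul]
      rw [← visitSum_sum, ← visitSum_const_mul, ← visitSum_add, ← visitSum_add]
      congr 1
      funext x l
      simp only [hD, hr]
      have : ∑ i ∈ s, c i * ((l : ℝ) * powWeight (α i) x) =
          l * ∑ i ∈ s, c i * powWeight (α i) x := by
        rw [Finset.mul_sum]; exact Finset.sum_congr rfl fun i _ => by ring
      rw [this]
      field_simp
      ring
    have e2 : visitSum L t n F ω - m⁻¹ * ∑ i ∈ s, c i * ((t : ℝ) ^ α i / α i) =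
        visitSum L t n D ω + (m⁻¹ * ∑ i ∈ s, c i *
          (visitSum L t n (fun x l => l * powWeight (α i) x) ω - (t : ℝ) ^ α i / α i) +
        m⁻¹ * visitSum L t n (fun x l => l * r x) ω) := by
      rw [e1]; simp_rw [mul_sub, Finset.sum_sub_distrib]; ring
    rw [e2]
    refine (abs_add_le _ _).trans (add_le_add le_rfl ((abs_add_le _ _).trans (add_le_add ?_ ?_)))
    · rw [abs_mul, abs_of_pos (inv_pos.2 hm1)]
      gcongr
      refine (Finset.abs_sum_le_sum_abs _ _).trans (Finset.sum_le_sum fun i hi' => ?_)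
      rw [abs_mul]
      gcongr
      exact abs_visitSum_mul_powWeight_sub_le (hα0 i hi') (hα1 i hi') hρ0.le t n ω hlt
    · rw [abs_mul, abs_of_pos (inv_pos.2 hm1), mul_assoc]
      gcongr
      rw [hS₁, ← visitSum_const_mul]
      refine abs_visitSum_le t n (fun x l => ?_) ω
      rw [abs_mul, abs_of_nonneg (NNReal.coe_nonneg l)]
      calc (l : ℝ) * |r x| ≤ l * (C' * powWeight ρ x) :=
            mul_le_mul_of_nonneg_left (hmean x) l.2
        _ = _ := by ring
  have iSum : Integrable (fun ω => ∑ i ∈ s, |c i| * (S₂ ω + (1 + S₀ ω) / α i)) Pr :=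
    integrable_finsetSum _ fun i _ =>
      (i2.add (((integrable_const 1).add i0).div_const (α i))).const_mul _
  have iG : Integrable G Pr := iD.add ((iSum.const_mul _).add (i1.const_mul _))
  have hle : ∀ ω, 0 ≤ (if t < relocTime L n ω then
      |visitSum L t n F ω - m⁻¹ * ∑ i ∈ s, c i * ((t : ℝ) ^ α i / α i)| else 0) := fun ω => by
    split_ifs <;> positivity
  refine (integral_mono_of_nonneg (Eventually.of_forall hle) iG (Eventually.of_forall hpoint)).trans ?_
  have eG : ∫ ω, G ω ∂Pr = ∫ ω, |visitSum L t n D ω| ∂Pr +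
      (m⁻¹ * ∑ i ∈ s, |c i| * (∫ ω, S₂ ω ∂Pr + (1 + ∫ ω, S₀ ω ∂Pr) / α i) +
        m⁻¹ * C' * ∫ ω, S₁ ω ∂Pr) := by
    have iR : Integrable (fun ω => m⁻¹ * ∑ i ∈ s, |c i| * (S₂ ω + (1 + S₀ ω) / α i) +
        m⁻¹ * C' * S₁ ω) Pr := (iSum.const_mul _).add (i1.const_mul _)
    have iT : ∀ i, Integrable (fun ω => (1 + S₀ ω) / α i) Pr := fun i =>
      ((integrable_const 1).add i0).div_const (α i)
    simp only [hG]
    rw [integral_add iD iR,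
      integral_add (iSum.const_mul _) (i1.const_mul _), integral_const_mul, integral_const_mul,
      integral_finsetSum]
    · congr 3
      refine Finset.sum_congr rfl fun i _ => ?_
      rw [integral_const_mul, integral_add i2 (iT i),
        integral_div]
      congr 3
      rw [integral_add (integrable_const 1) i0]
      simp
    · exact fun i _ => (i2.add (((integrable_const 1).add i0).div_const (α i))).const_mul _
  rw [eG]
  set R := (1 + (t : ℝ)) ^ ρ with hR
  have hR1 : 1 ≤ R := Real.one_le_rpow (by simp) hρ0.le
  have b2 : ∫ ω, S₂ ω ∂Pr ≤ B₂ * R := hL.integral_visitSum_powWeight_le hφ hρ0 hρ1 hl2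
    (by fun_prop) (fun l => by positivity) t n
  have b1 : ∫ ω, S₁ ω ∂Pr ≤ B₁ * R := hL.integral_visitSum_powWeight_le hφ hρ0 hρ1 hl1
    (by fun_prop) (fun l => by positivity) t n
  have b0 : ∫ ω, S₀ ω ∂Pr ≤ B₀ := hL.integral_visitSum_straddle_le hφ hl3 t n
  have bD : ∫ ω, |visitSum L t n D ω| ∂Pr ≤ K₁ * R := (hK₁ t n).trans (by
    refine mul_le_mul_of_nonneg_left (Real.rpow_le_rpow_of_exponent_le (by simp) hρδ) hK₁0)
  have bsum : ∑ i ∈ s, |c i| * (∫ ω, S₂ ω ∂Pr + (1 + ∫ ω, S₀ ω ∂Pr) / α i) ≤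
      (∑ i ∈ s, |c i| * (B₂ + (1 + B₀) / α i)) * R := by
    rw [Finset.sum_mul]
    refine Finset.sum_le_sum fun i hi' => ?_
    rw [mul_assoc]
    gcongr
    have hα := hα0 i hi'
    have : (1 + ∫ ω, S₀ ω ∂Pr) / α i ≤ (1 + B₀) / α i * R := by
      calc _ ≤ (1 + B₀) / α i := by gcongr
        _ ≤ _ := le_mul_of_one_le_right (by positivity) hR1
    linarith
  have c1 := mul_le_mul_of_nonneg_left bsum (inv_pos.2 hm1).le
  have c2 := mul_le_mul_of_nonneg_left b1 (mul_nonneg (inv_pos.2 hm1).le hC')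
  calc _ ≤ K₁ * R + (m⁻¹ * ((∑ i ∈ s, |c i| * (B₂ + (1 + B₀) / α i)) * R) +
      m⁻¹ * C' * (B₁ * R)) := by linarith
    _ = _ := by ring

end

/-! ### The memory kernel -/

/-- The primitive `exp (γ x ^ δ) - 1` of the memory kernel. -/
def memoryMass (γ δ x : ℝ) : ℝ := Real.exp (γ * x ^ δ) - 1

lemma memoryKernel_nonneg {γ δ : ℝ} (hγ : 0 < γ) (hδ0 : 0 < δ) {x : ℝ} (hx : 0 ≤ x) :
    0 ≤ memoryKernel γ δ x := by
  unfold memoryKernel; positivity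

lemma measurable_memoryKernel (γ δ : ℝ) : Measurable (memoryKernel γ δ) := by
  unfold memoryKernel; fun_prop

lemma hasDerivAt_memoryMass (γ : ℝ) {δ x : ℝ} (hx : 0 < x) :
    HasDerivAt (memoryMass γ δ) (memoryKernel γ δ x) x := by
  have h := (((Real.hasDerivAt_rpow_const (p := δ) (Or.inl hx.ne')).const_mul γ).exp).sub_const 1
  refine h.congr_deriv ?_
  unfold memoryKernel
  ring

lemma continuous_memoryMass (γ : ℝ) {δ : ℝ} (hδ0 : 0 < δ) : Continuous (memoryMass γ δ) := by
  unfold memoryMass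
  have : Continuous fun x : ℝ => x ^ δ := Real.continuous_rpow_const hδ0.le
  fun_prop

/-- The kernel may blow up at `0` when `δ < 1`; it is integrable as the nonnegative derivative of a
primitive that is continuous up to `0`. -/
lemma integrableOn_memoryKernel {γ δ : ℝ} (hγ : 0 < γ) (hδ0 : 0 < δ) {x y : ℝ} (hx : 0 ≤ x) :
    IntegrableOn (memoryKernel γ δ) (Set.Ioc x y) :=
  intervalIntegral.integrableOn_deriv_of_nonneg (continuous_memoryMass γ hδ0).continuousOn
    (fun _ hr => hasDerivAt_memoryMass γ (hx.trans_lt hr.1))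
    (fun _ hr => memoryKernel_nonneg hγ hδ0 (hx.trans hr.1.le))

lemma integral_memoryKernel {γ δ : ℝ} (hγ : 0 < γ) (hδ0 : 0 < δ) {x y : ℝ} (hx : 0 ≤ x)
    (hxy : x ≤ y) : ∫ r in x..y, memoryKernel γ δ r = memoryMass γ δ y - memoryMass γ δ x :=
  intervalIntegral.integral_eq_sub_of_hasDerivAt_of_le hxy (continuous_memoryMass γ hδ0).continuousOn
    (fun _ hr => hasDerivAt_memoryMass γ (hx.trans_lt hr.1))
    ((intervalIntegrable_iff_integrableOn_Ioc_of_le hxy).2 (integrableOn_memoryKernel hγ hδ0 hx))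

/-- The measure of density `memoryKernel γ δ`. -/
def memoryMeasure (γ δ : ℝ) : Measure ℝ :=
  volume.withDensity fun x => ENNReal.ofReal (memoryKernel γ δ x)

instance (γ δ : ℝ) : SFinite (memoryMeasure γ δ) := by
  unfold memoryMeasure; infer_instance

@[simp]
lemma memoryMass_zero {γ δ : ℝ} (hδ0 : 0 < δ) : memoryMass γ δ 0 = 0 := by
  simp [memoryMass, Real.zero_rpow hδ0.ne']

lemma memoryMass_pos {γ δ : ℝ} (hγ : 0 < γ) {x : ℝ} (hx : 0 < x) :
    0 < memoryMass γ δ x := by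
  unfold memoryMass
  have : 0 < γ * x ^ δ := by positivity
  linarith [Real.add_one_lt_exp this.ne']

lemma memoryMeasure_Ico {γ δ : ℝ} (hγ : 0 < γ) (hδ0 : 0 < δ) {x y : ℝ} (hx : 0 ≤ x) (hxy : x ≤ y) :
    memoryMeasure γ δ (Set.Ico x y) = ENNReal.ofReal (memoryMass γ δ y - memoryMass γ δ x) := by
  unfold memoryMeasure
  rw [withDensity_apply _ measurableSet_Ico, ← integral_memoryKernel hγ hδ0 hx hxy,
    intervalIntegral.integral_of_le hxy, restrict_Ico_eq_restrict_Ioc,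
    ofReal_integral_eq_lintegral_ofReal (integrableOn_memoryKernel hγ hδ0 hx)]
  exact (ae_restrict_iff' measurableSet_Ioc).2 (Eventually.of_forall fun r hr =>
    memoryKernel_nonneg hγ hδ0 (hx.trans hr.1.le))

lemma memoryMeasure_Ico_zero {γ δ : ℝ} (hγ : 0 < γ) (hδ0 : 0 < δ) {y : ℝ} (hy : 0 ≤ y) :
    memoryMeasure γ δ (Set.Ico 0 y) = ENNReal.ofReal (memoryMass γ δ y) := by
  rw [memoryMeasure_Ico hγ hδ0 le_rfl hy, memoryMass_zero hδ0, sub_zero]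

lemma memoryLaw_eq (γ δ t : ℝ) :
    memoryLaw (memoryKernel γ δ) t =
      (memoryMeasure γ δ (Set.Ico 0 t))⁻¹ • (memoryMeasure γ δ).restrict (Set.Ico 0 t) := rfl

lemma isProbabilityMeasure_memoryLaw {γ δ : ℝ} (hγ : 0 < γ) (hδ0 : 0 < δ) {t : ℝ} (ht : 0 < t) :
    IsProbabilityMeasure (memoryLaw (memoryKernel γ δ) t) := by
  have h := memoryMeasure_Ico_zero hγ hδ0 ht.le
  refine cond_isProbabilityMeasure_of_finite ?_ ?_
  · change memoryMeasure γ δ (Set.Ico 0 t) ≠ 0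
    rw [h]; simpa using memoryMass_pos hγ ht
  · change memoryMeasure γ δ (Set.Ico 0 t) ≠ ⊤
    rw [h]; exact ENNReal.ofReal_ne_top

/-! ### The law of one age increment -/

/-- The law of the age increment produced by a relocation at the end of a run of length `l` that
starts at time `x`: a memory time `r` contributes `r - x` if it falls in that run, and `0`
otherwise. -/
def stepLaw (γ δ : ℝ) (x l : ℝ≥0) : Measure ℝ≥0 :=
  if x + l = 0 then Measure.dirac 0 else
    (memoryLaw (memoryKernel γ δ) (x + l : ℝ≥0)).map fun r : ℝ => (r - x).toNNReal

lemma isProbabilityMeasure_stepLaw {γ δ : ℝ} (hγ : 0 < γ) (hδ0 : 0 < δ) (x l : ℝ≥0) :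
    IsProbabilityMeasure (stepLaw γ δ x l) := by
  unfold stepLaw
  split_ifs with h
  · infer_instance
  · have := isProbabilityMeasure_memoryLaw hγ hδ0 (t := ((x + l : ℝ≥0) : ℝ))
      (by exact_mod_cast pos_iff_ne_zero.2 h)
    exact Measure.isProbabilityMeasure_map (by fun_prop)

lemma measurable_stepLaw (γ δ : ℝ) : Measurable fun p : ℝ≥0 × ℝ≥0 => stepLaw γ δ p.1 p.2 := by
  unfold stepLaw
  refine Measurable.ite (measurableSet_eq_fun (by fun_prop) measurable_const) measurable_const ?_
  refine Measure.measurable_of_measurable_coe _ fun B hB => ?_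
  -- Numerator and denominator are measures of sections of jointly measurable sets, hence measurable
  -- in the parameters.
  have e : ∀ p : ℝ≥0 × ℝ≥0, ((memoryLaw (memoryKernel γ δ) (p.1 + p.2 : ℝ≥0)).map
      fun r : ℝ => (r - p.1).toNNReal) B =
      (memoryMeasure γ δ (Prod.mk p ⁻¹' {a : (ℝ≥0 × ℝ≥0) × ℝ | 0 ≤ a.2 ∧ a.2 < (a.1.1 + a.1.2 : ℝ≥0)}))⁻¹ *
      memoryMeasure γ δ (Prod.mk p ⁻¹' {a : (ℝ≥0 × ℝ≥0) × ℝ |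
        (a.2 - a.1.1).toNNReal ∈ B ∧ 0 ≤ a.2 ∧ a.2 < (a.1.1 + a.1.2 : ℝ≥0)}) := by
    intro p
    rw [Measure.map_apply (by fun_prop) hB, memoryLaw_eq, Measure.smul_apply, Measure.restrict_apply
      ((by fun_prop : Measurable fun r : ℝ => (r - p.1).toNNReal) hB), smul_eq_mul]
    rfl
  simp_rw [e]
  have m1 : MeasurableSet {a : (ℝ≥0 × ℝ≥0) × ℝ | 0 ≤ a.2 ∧ a.2 < (a.1.1 + a.1.2 : ℝ≥0)} :=
    MeasurableSet.inter
      (measurableSet_le (f := fun _ => (0 : ℝ)) (g := fun a : (ℝ≥0 × ℝ≥0) × ℝ => a.2)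
        measurable_const (by fun_prop))
      (measurableSet_lt (f := fun a : (ℝ≥0 × ℝ≥0) × ℝ => a.2)
        (g := fun a => ((a.1.1 + a.1.2 : ℝ≥0) : ℝ)) (by fun_prop) (by fun_prop))
  refine (measurable_measure_prodMk_left m1).inv.mul (measurable_measure_prodMk_left ?_)
  exact MeasurableSet.inter ((by fun_prop : Measurable fun a : (ℝ≥0 × ℝ≥0) × ℝ =>
    (a.2 - a.1.1).toNNReal) hB) m1

lemma ae_stepLaw_le {γ δ : ℝ} (x l : ℝ≥0) : ∀ᵐ y ∂(stepLaw γ δ x l), y ≤ l := by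
  unfold stepLaw
  split_ifs with h
  · rw [ae_dirac_iff measurableSet_Iic]; simp
  · rw [ae_map_iff (by fun_prop) measurableSet_Iic]
    have : ∀ᵐ r ∂(memoryLaw (memoryKernel γ δ) (x + l : ℝ≥0)), r ∈ Set.Ico (0 : ℝ) (x + l : ℝ≥0) := by
      rw [memoryLaw_eq]
      exact Measure.ae_smul_measure (ae_restrict_mem measurableSet_Ico) _
    filter_upwards [this] with r hr
    rw [Real.toNNReal_le_iff_le_coe]
    have := hr.2
    push_cast at this
    linarith

/-- Moments of the step law. -/
lemma integral_stepLaw_pow {γ δ : ℝ} (hγ : 0 < γ) (hδ0 : 0 < δ) {x l : ℝ≥0} (hx : 0 < x) {k : ℕ}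
    (hk : k ≠ 0) :
    ∫ y, (y : ℝ) ^ k ∂(stepLaw γ δ x l) =
      ∫ y in (0 : ℝ)..l, y ^ k * (memoryKernel γ δ (x + y) / memoryMass γ δ (x + l)) := by
  have hxl : x + l ≠ 0 := (add_pos_of_pos_of_nonneg hx zero_le).ne'
  have hx0 : (0 : ℝ) ≤ x := x.2
  have hl0 : (0 : ℝ) ≤ l := l.2
  have hxp : (0 : ℝ) < x + l := by have : (0 : ℝ) < x := hx
                                   linarith
  have hM := memoryMass_pos (δ := δ) hγ hxp
  unfold stepLaw
  rw [if_neg hxl, integral_map (by fun_prop) (by fun_prop : Measurable _).aestronglyMeasurable,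
    memoryLaw_eq, integral_smul_measure, memoryMeasure_Ico_zero hγ hδ0 (by positivity)]
  have e1 : ∫ r in Set.Ico (0 : ℝ) (x + l : ℝ≥0), (((r - x).toNNReal : ℝ≥0) : ℝ) ^ k ∂(memoryMeasure γ δ) =
      ∫ r in (x : ℝ)..(x + l), (r - x) ^ k * memoryKernel γ δ r := by
    unfold memoryMeasure
    rw [intervalIntegral.integral_of_le (by linarith), ← restrict_Ico_eq_restrict_Ioc,
      setIntegral_withDensity_eq_setIntegral_toReal_smul₀ (by
        have := measurable_memoryKernel γ δ; fun_prop)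
        (Eventually.of_forall fun r => ENNReal.ofReal_lt_top) _ measurableSet_Ico]
    have hsub : Set.Ico (x : ℝ) (x + l) ⊆ Set.Ico (0 : ℝ) (x + l : ℝ≥0) := by
      push_cast; exact Set.Ico_subset_Ico_left hx0
    -- Memory times before `x` give increment `0`, and `0 ^ k = 0` because `k ≠ 0`; only the last
    -- run contributes.
    rw [setIntegral_eq_of_subset_of_forall_sdiff_eq_zero measurableSet_Ico hsub]
    · refine setIntegral_congr_fun measurableSet_Ico fun r hr => ?_
      simp only [smul_eq_mul]
      rw [ENNReal.toReal_ofReal (memoryKernel_nonneg hγ hδ0 (hx0.trans hr.1)),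
        Real.coe_toNNReal _ (by linarith [hr.1]), mul_comm]
    · intro r hr
      have : r - x ≤ 0 := by
        by_contra hcon
        exact hr.2 ⟨by linarith, by have := hr.1.2; push_cast at this; exact this⟩
      simp [Real.toNNReal_of_nonpos this, hk]
  rw [e1]
  have e2 : ∫ r in (x : ℝ)..(x + l), (r - x) ^ k * memoryKernel γ δ r =
      ∫ y in (0 : ℝ)..l, y ^ k * memoryKernel γ δ (x + y) := by
    have := intervalIntegral.integral_comp_add_left (a := 0) (b := (l : ℝ))
      (fun r => (r - x) ^ k * memoryKernel γ δ r) (x : ℝ)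
    simp only [add_sub_cancel_left, add_zero] at this
    rw [this]
  rw [e2, smul_eq_mul, ENNReal.toReal_inv, ENNReal.toReal_ofReal (by push_cast; exact hM.le),
    ← intervalIntegral.integral_const_mul]
  refine intervalIntegral.integral_congr fun y _ => ?_
  push_cast
  field_simp

/-- For `z ≥ 1` the subtracted `1` costs only a constant factor. -/
lemma memoryMass_ge {γ δ z : ℝ} (hγ : 0 < γ) (hδ0 : 0 < δ) (hz : 1 ≤ z) :
    (1 - Real.exp (-γ)) * Real.exp (γ * z ^ δ) ≤ memoryMass γ δ z := by
  have h1 : 1 ≤ z ^ δ := Real.one_le_rpow hz hδ0.le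
  have h2 : 1 ≤ Real.exp (-γ) * Real.exp (γ * z ^ δ) := by
    rw [← Real.exp_add]; exact Real.one_le_exp (by nlinarith)
  unfold memoryMass
  linarith

lemma one_sub_exp_neg_pos {γ : ℝ} (hγ : 0 < γ) : 0 < 1 - Real.exp (-γ) := by
  have : Real.exp (-γ) < 1 := by rw [Real.exp_lt_one_iff]; linarith
  linarith

/-! ### Exponential approximation of the step density -/

/-- The rate `κ = γ δ (1 + x) ^ (δ - 1)` of relocation at time `x`. -/
def rate (γ δ : ℝ) (x : ℝ≥0) : ℝ := γ * δ * powWeight δ x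

lemma rate_pos {γ δ : ℝ} (hγ : 0 < γ) (hδ0 : 0 < δ) (x : ℝ≥0) : 0 < rate γ δ x := by
  have := powWeight_pos δ x
  unfold rate; positivity

lemma rate_le {γ δ : ℝ} (hγ : 0 < γ) (hδ0 : 0 < δ) (hδ1 : δ < 1) (x : ℝ≥0) : rate γ δ x ≤ γ * δ :=
  mul_le_of_le_one_right (by positivity) (powWeight_le_one hδ1.le x)

lemma rpow_le_powWeight {x : ℝ≥0} (hx : 1 ≤ x) {β : ℝ} (hβ : -1 ≤ β) (hβ1 : β ≤ 1) :
    (x : ℝ) ^ (β - 1) ≤ 4 * powWeight β x := by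
  have hx' : (1 : ℝ) ≤ x := by exact_mod_cast hx
  have h1 : (2 * (x : ℝ)) ^ (β - 1) ≤ powWeight β x :=
    Real.rpow_le_rpow_of_nonpos (by positivity) (by linarith) (by linarith)
  rw [Real.mul_rpow (by norm_num) (by positivity)] at h1
  have h2 : (1 / 4 : ℝ) ≤ 2 ^ (β - 1) := by
    rw [show (1 / 4 : ℝ) = 2 ^ (-2 : ℝ) by rw [Real.rpow_neg (by norm_num)]; norm_num]
    exact Real.rpow_le_rpow_of_exponent_le (by norm_num) (by linarith)
  have h3 : 0 < (x : ℝ) ^ (β - 1) := by positivity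
  nlinarith

/-- The exponential in the kernel is at most the one in the normalisation because `y ≤ l`; what
remains is the power `(x + y)^(δ-1)`, comparable to its value at `1 + x`. -/
lemma density_le {γ δ : ℝ} (hγ : 0 < γ) (hδ0 : 0 < δ) (hδ1 : δ < 1) {x l : ℝ≥0} (hx : 1 ≤ x) {y : ℝ}
    (hy : y ∈ Set.Icc (0 : ℝ) l) :
    memoryKernel γ δ (x + y) / memoryMass γ δ (x + l) ≤
      4 * γ * δ / (1 - Real.exp (-γ)) * powWeight δ x := by
  have hx' : (1 : ℝ) ≤ x := by exact_mod_cast hx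
  have hl : (0 : ℝ) ≤ l := l.2
  have hc := one_sub_exp_neg_pos hγ
  have h1 := memoryMass_ge hγ hδ0 (show (1 : ℝ) ≤ x + l by linarith)
  have h2 : (x + y) ^ (δ - 1) ≤ 4 * powWeight δ x :=
    (Real.rpow_le_rpow_of_nonpos (by linarith) (by linarith [hy.1]) (by linarith)).trans
      (rpow_le_powWeight hx (by linarith) hδ1.le)
  have h3 : Real.exp (γ * (x + y) ^ δ) ≤ Real.exp (γ * (x + l) ^ δ) := by
    have : (x + y) ^ δ ≤ (x + l : ℝ) ^ δ :=
      Real.rpow_le_rpow (by linarith [hy.1]) (by linarith [hy.2]) hδ0.le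
    exact Real.exp_le_exp.2 (by gcongr)
  have hM : 0 < memoryMass γ δ (x + l) := memoryMass_pos hγ (by linarith)
  rw [div_le_iff₀ hM]
  have hp := powWeight_pos δ x
  have hxy : (0 : ℝ) < x + y := by linarith [hy.1]
  calc memoryKernel γ δ (x + y)
      ≤ γ * δ * (4 * powWeight δ x) * Real.exp (γ * (x + l) ^ δ) := by
        unfold memoryKernel; gcongr
    _ = 4 * γ * δ / (1 - Real.exp (-γ)) * powWeight δ x *
        ((1 - Real.exp (-γ)) * Real.exp (γ * (x + l) ^ δ)) := by field_simp
    _ ≤ _ := by gcongr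

lemma abs_exp_neg_sub_le {u v : ℝ} (hu : 0 ≤ u) (hv : 0 ≤ v) :
    |Real.exp (-u) - Real.exp (-v)| ≤ |u - v| := by
  wlog h : u ≤ v generalizing u v
  · rw [abs_sub_comm, abs_sub_comm u]; exact this hv hu (le_of_not_ge h)
  have h1 : Real.exp (-v) ≤ Real.exp (-u) := Real.exp_le_exp.2 (by linarith)
  rw [abs_of_nonneg (by linarith), abs_of_nonpos (by linarith)]
  have h2 : Real.exp (-v) = Real.exp (-u) * Real.exp (-(v - u)) := by
    rw [← Real.exp_add]; congr 1; ring
  have h3 := Real.add_one_le_exp (-(v - u))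
  have h4 : Real.exp (-u) ≤ 1 := Real.exp_le_one_iff.2 (by linarith)
  have h5 := Real.exp_pos (-u)
  nlinarith

set_option maxHeartbeats 800000 in
/-- Exponential approximation of the density of the step law. -/
lemma exists_abs_density_sub_le {γ δ : ℝ} (hγ : 0 < γ) (hδ0 : 0 < δ) (hδ1 : δ < 1) :
    ∃ C : ℝ, 0 ≤ C ∧ ∀ (x l : ℝ≥0), 1 ≤ x → ∀ y ∈ Set.Icc (0 : ℝ) l,
      |memoryKernel γ δ (x + y) / memoryMass γ δ (x + l) -
        rate γ δ x * Real.exp (-(rate γ δ x * (l - y)))| ≤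
        C * (1 + (l : ℝ)) ^ 2 * powWeight (δ - 1) x := by
  have hc := one_sub_exp_neg_pos hγ
  set c₀ := 1 - Real.exp (-γ) with hc₀
  -- Chosen so that `(x^δ)^k ≥ x`: the `k`-th term of the exponential series then bounds the
  -- normalisation below by a multiple of `x`, which gains one power of `x` in the error.
  set k := ⌈1 / δ⌉₊ with hk
  have hkδ : 1 ≤ k * δ := by
    have := Nat.le_ceil (1 / δ)
    rw [div_le_iff₀ hδ0] at this
    exact this
  set C₁ := (k.factorial : ℝ) / (c₀ * γ ^ k) with hC₁
  have hC₁0 : 0 ≤ C₁ := by positivity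
  refine ⟨γ * δ * (C₁ * 4 + 4 + γ * 4), by positivity, fun x l hx y hy => ?_⟩
  have hx' : (1 : ℝ) ≤ x := by exact_mod_cast hx
  have hl : (0 : ℝ) ≤ l := l.2
  obtain ⟨hy0, hyl⟩ := hy
  set P := (x + y : ℝ) ^ (δ - 1) with hP
  set P₀ := powWeight δ x with hP₀
  set a := γ * (x + y : ℝ) ^ δ with ha
  set b := γ * (x + l : ℝ) ^ δ with hb
  have hab : a ≤ b := by
    have : (x + y) ^ δ ≤ (x + l : ℝ) ^ δ :=
      Real.rpow_le_rpow (by linarith) (by linarith) hδ0.le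
    exact mul_le_mul_of_nonneg_left this hγ.le
  have hMge := memoryMass_ge hγ hδ0 (show (1 : ℝ) ≤ x + l by linarith)
  rw [← hb, ← hc₀] at hMge
  set M := memoryMass γ δ (x + l) with hM
  have hMpos : 0 < M := memoryMass_pos hγ (by linarith)
  have hMb : M = Real.exp b - 1 := rfl
  set q := (x : ℝ) ^ (δ - 2) with hq
  have hq0 : 0 < q := by positivity
  have hq4 : q ≤ 4 * powWeight (δ - 1) x := by
    have := rpow_le_powWeight (β := δ - 1) hx (by linarith) (by linarith)
    rwa [show δ - 1 - 1 = δ - 2 by ring] at this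
  -- the interval containing all the powers
  set lo := (x + (1 + l) : ℝ) ^ (δ - 1) with hlo
  set hi := (x : ℝ) ^ (δ - 1) with hhi
  have hgap : hi - lo ≤ (1 + l) * q := rpow_sub_rpow_neg_le (by linarith) (by linarith) hδ0.le
  have hmem : ∀ z : ℝ, x ≤ z → z ≤ x + (1 + l) → lo ≤ z ^ (δ - 1) ∧ z ^ (δ - 1) ≤ hi := fun z h1 h2 =>
    ⟨Real.rpow_le_rpow_of_nonpos (by linarith) h2 (by linarith),
     Real.rpow_le_rpow_of_nonpos (by linarith) h1 (by linarith)⟩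
  have hhi1 : hi ≤ 1 := Real.rpow_le_one_of_one_le_of_nonpos hx' (by linarith)
  have mP := hmem (x + y) (by linarith) (by linarith)
  have mP₀ : lo ≤ P₀ ∧ P₀ ≤ hi := hmem (1 + x) (by linarith) (by linarith)
  have mL := hmem (x + l) (by linarith) (by linarith)
  have hP0 : 0 < P := by have : (0 : ℝ) < x + y := by linarith
                         positivity
  have hP₀0 : 0 < P₀ := powWeight_pos δ x
  have t1 : |P - P₀| ≤ (1 + l) * q := by
    rw [abs_le]; constructor <;> linarith [mP.1, mP.2, mP₀.1, mP₀.2]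
  -- exponents
  have hly : 0 ≤ l - y := by linarith
  have g1 := rpow_sub_rpow_ge (a := x + y) (h := l - y) (by linarith) hly hδ0.le hδ1.le
  have g2 := rpow_add_le (a := x + y) (h := l - y) (by linarith) hly hδ0.le hδ1.le
  rw [show (x + y + (l - y) : ℝ) = x + l by ring] at g1 g2
  have t2 : |(b - a) - rate γ δ x * (l - y)| ≤ γ * ((1 + l) ^ 2 * q) := by
    have e : (b - a) - rate γ δ x * (l - y) =
        γ * (((x + l : ℝ) ^ δ - (x + y : ℝ) ^ δ) - δ * (l - y) * P₀) := by
      rw [hb, ha, rate]; ring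
    rw [e, abs_mul, abs_of_pos hγ]
    refine mul_le_mul_of_nonneg_left ?_ hγ.le
    have hd : 0 ≤ δ * (l - y) := by positivity
    have b1 : δ * (l - y) * ((1 + l) * q) ≤ (1 + l) ^ 2 * q := by
      have : δ * (l - y) ≤ 1 + l := by nlinarith
      calc δ * (l - y) * ((1 + l) * q) ≤ (1 + l) * ((1 + l) * q) := by gcongr
        _ = _ := by ring
    have b2 : δ * (l - y) * (P₀ - (x + l : ℝ) ^ (δ - 1)) ≤ δ * (l - y) * ((1 + l) * q) :=
      mul_le_mul_of_nonneg_left (by linarith [mL.1, mP₀.2]) hd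
    have b3 : δ * (l - y) * (P - P₀) ≤ δ * (l - y) * ((1 + l) * q) :=
      mul_le_mul_of_nonneg_left (by linarith [mP.2, mP₀.1]) hd
    rw [mul_sub] at b2 b3
    rw [abs_le]
    constructor <;> linarith
  have t2' : |Real.exp (-(b - a)) - Real.exp (-(rate γ δ x * (l - y)))| ≤ γ * ((1 + l) ^ 2 * q) :=
    (abs_exp_neg_sub_le (by linarith) (mul_nonneg (rate_pos hγ hδ0 x).le hly)).trans t2
  -- the normalisation
  have t3 : M⁻¹ ≤ C₁ * (x : ℝ)⁻¹ := by
    have hb0 : 0 ≤ b := by positivity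
    have h1 : b ^ k / k.factorial ≤ Real.exp b := Real.pow_div_factorial_le_exp b hb0 k
    have h2 : γ ^ k * x ≤ b ^ k := by
      rw [hb, mul_pow]
      gcongr
      calc (x : ℝ) = (x : ℝ) ^ (1 : ℝ) := (Real.rpow_one _).symm
        _ ≤ (x : ℝ) ^ (k * δ) := Real.rpow_le_rpow_of_exponent_le hx' hkδ
        _ = ((x : ℝ) ^ δ) ^ k := by rw [mul_comm, Real.rpow_mul_natCast (by positivity)]
        _ ≤ ((x + l : ℝ) ^ δ) ^ k := by gcongr; linarith
    have h3 : c₀ * (γ ^ k * x / k.factorial) ≤ M := by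
      refine le_trans ?_ hMge
      gcongr
      exact (by gcongr : γ ^ k * x / k.factorial ≤ b ^ k / k.factorial).trans h1
    calc M⁻¹ ≤ (c₀ * (γ ^ k * x / k.factorial))⁻¹ := inv_anti₀ (by positivity) h3
      _ = _ := by rw [hC₁]; field_simp
  -- Writing the normalisation as `exp b - 1`, the ratio `exp a / M` equals `exp (-(b - a))` times
  -- `1 + 1 / M`.
  have e1 : memoryKernel γ δ (x + y) / M = γ * δ * (P * Real.exp (-(b - a)) * (1 + M⁻¹)) := by
    have : Real.exp a = Real.exp (-(b - a)) * Real.exp b := by rw [← Real.exp_add]; congr 1; ring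
    have h2 : Real.exp b = M * (1 + M⁻¹) := by rw [hMb]; have : Real.exp b - 1 ≠ 0 := hMpos.ne'
                                               field_simp; ring
    unfold memoryKernel
    rw [← ha, this, h2, ← hP]
    field_simp
  set E := Real.exp (-(b - a)) with hE
  set E₀ := Real.exp (-(rate γ δ x * (l - y))) with hE₀
  have hE1 : E ≤ 1 := Real.exp_le_one_iff.2 (by linarith)
  have hE0 : 0 < E := Real.exp_pos _
  have hE₀1 : E₀ ≤ 1 := Real.exp_le_one_iff.2 (by
    have := mul_nonneg (rate_pos hγ hδ0 x).le hly; linarith)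
  -- Three errors, each of order `x^(δ-2)`: the subtracted `1` in the normalisation, the
  -- displacement of the power `(x + y)^(δ-1)`, and the linearisation of the exponent.
  have e2 : memoryKernel γ δ (x + y) / M - rate γ δ x * E₀ =
      γ * δ * (P * E * M⁻¹ + (P - P₀) * E + P₀ * (E - E₀)) := by
    rw [e1, rate]; ring
  have hl1 : (1 : ℝ) ≤ (1 + l) ^ 2 := one_le_pow₀ (le_add_of_nonneg_right hl)
  have hl2 : (1 + l : ℝ) ≤ (1 + l) ^ 2 :=
    le_self_pow₀ (le_add_of_nonneg_right hl) two_ne_zero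
  have u1 : |P * E * M⁻¹| ≤ C₁ * ((1 + l) ^ 2 * q) := by
    rw [abs_of_nonneg (by positivity)]
    calc P * E * M⁻¹ ≤ hi * 1 * (C₁ * (x : ℝ)⁻¹) := by
          gcongr
          exact mP.2
      _ = C₁ * q := by
          have : q = hi * (x : ℝ)⁻¹ := by
            rw [hq, hhi, ← Real.rpow_neg_one, ← Real.rpow_add (by linarith)]; congr 1; ring
          rw [this]; ring
      _ ≤ _ := by gcongr; exact le_mul_of_one_le_left hq0.le hl1
  have u2 : |(P - P₀) * E| ≤ (1 + l) ^ 2 * q := by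
    rw [abs_mul, abs_of_pos hE0]
    calc |P - P₀| * E ≤ (1 + l) * q * 1 := by gcongr
      _ ≤ _ := by rw [mul_one]; gcongr
  have u3 : |P₀ * (E - E₀)| ≤ γ * ((1 + l) ^ 2 * q) := by
    rw [abs_mul, abs_of_pos hP₀0]
    calc P₀ * |E - E₀| ≤ 1 * (γ * ((1 + l) ^ 2 * q)) := by
          gcongr
          exact mP₀.2.trans hhi1
      _ = _ := one_mul _
  rw [e2, abs_mul, abs_of_pos (by positivity : 0 < γ * δ)]
  have u4 : |P * E * M⁻¹ + (P - P₀) * E + P₀ * (E - E₀)| ≤ (C₁ + 1 + γ) * ((1 + l) ^ 2 * q) :=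
    (abs_add_three _ _ _).trans (by linarith)
  calc _ ≤ γ * δ * ((C₁ + 1 + γ) * ((1 + l) ^ 2 * q)) := by gcongr
    _ ≤ γ * δ * ((C₁ + 1 + γ) * ((1 + l) ^ 2 * (4 * powWeight (δ - 1) x))) := by gcongr
    _ = _ := by ring

/-- Taylor's theorem for `z ≤ 1`; for `z > 1` every term is at most a multiple of `z ^ J`. A bound
valid for all `z ≥ 0` lets arbitrarily long runs enter without truncation. -/
lemma abs_exp_neg_sub_sum_le {z : ℝ} (hz : 0 ≤ z) (J : ℕ) :
    |Real.exp (-z) - ∑ j ∈ Finset.range J, (-z) ^ j / j.factorial| ≤ 4 * z ^ J := by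
  rcases le_or_gt z 1 with h | h
  · have h1 := Complex.norm_exp_sub_sum_le_norm_mul_exp ((-z : ℝ) : ℂ) J
    have e : Complex.exp ((-z : ℝ) : ℂ) - ∑ m ∈ Finset.range J, ((-z : ℝ) : ℂ) ^ m / m.factorial =
        ((Real.exp (-z) - ∑ j ∈ Finset.range J, (-z) ^ j / j.factorial : ℝ) : ℂ) := by push_cast; rfl
    rw [e, Complex.norm_real, Complex.norm_real, Real.norm_eq_abs, Real.norm_eq_abs, abs_neg,
      abs_of_nonneg hz] at h1
    refine h1.trans ?_
    rw [mul_comm]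
    gcongr
    calc Real.exp z ≤ Real.exp 1 := Real.exp_le_exp.2 h
      _ ≤ 4 := by linarith [Real.exp_one_lt_d9]
  · have h1 : |Real.exp (-z)| ≤ z ^ J := by
      rw [abs_of_pos (Real.exp_pos _)]
      exact (Real.exp_le_one_iff.2 (by linarith)).trans (one_le_pow₀ h.le)
    have h2 : |∑ j ∈ Finset.range J, (-z) ^ j / j.factorial| ≤ 3 * z ^ J := by
      calc |∑ j ∈ Finset.range J, (-z) ^ j / j.factorial|
          ≤ ∑ j ∈ Finset.range J, |(-z) ^ j / j.factorial| := Finset.abs_sum_le_sum_abs _ _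
        _ ≤ ∑ j ∈ Finset.range J, (1 : ℝ) ^ j / j.factorial * z ^ J := by
            refine Finset.sum_le_sum fun j hj => ?_
            rw [abs_div, abs_pow, abs_neg, abs_of_nonneg hz, one_pow, div_mul_eq_mul_div, one_mul,
              Nat.abs_cast]
            gcongr
            · exact h.le
            · exact (Finset.mem_range.1 hj).le
        _ = (∑ j ∈ Finset.range J, (1 : ℝ) ^ j / j.factorial) * z ^ J := by rw [Finset.sum_mul]
        _ ≤ 3 * z ^ J := by
            gcongr
            refine (Real.sum_le_exp_of_nonneg zero_le_one J).trans ?_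
            linarith [Real.exp_one_lt_d9]
    linarith [abs_sub (Real.exp (-z)) (∑ j ∈ Finset.range J, (-z) ^ j / j.factorial)]

/-! ### Moments of the step law and their expansion -/

/-- The `k`-th moment of the step law. -/
def stepMoment (γ δ : ℝ) (k : ℕ) (x l : ℝ≥0) : ℝ := ∫ y, (y : ℝ) ^ k ∂(stepLaw γ δ x l)

lemma measurable_stepMoment (γ δ : ℝ) (hγ : 0 < γ) (hδ0 : 0 < δ) (k : ℕ) :
    Measurable (Function.uncurry (stepMoment γ δ k)) := by
  let κ : Kernel (ℝ≥0 × ℝ≥0) ℝ≥0 := ⟨fun p => stepLaw γ δ p.1 p.2, measurable_stepLaw γ δ⟩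
  have : IsMarkovKernel κ := ⟨fun p => isProbabilityMeasure_stepLaw hγ hδ0 p.1 p.2⟩
  have h : StronglyMeasurable fun p => ∫ y, (y : ℝ) ^ k ∂(κ p) :=
    StronglyMeasurable.integral_kernel
      (by fun_prop : Measurable fun y : ℝ≥0 => (y : ℝ) ^ k).stronglyMeasurable
  exact h.measurable

lemma stepMoment_nonneg (γ δ : ℝ) (k : ℕ) (x l : ℝ≥0) : 0 ≤ stepMoment γ δ k x l :=
  integral_nonneg fun y => by positivity

lemma integrable_stepLaw_pow {γ δ : ℝ} (hγ : 0 < γ) (hδ0 : 0 < δ) (k : ℕ) (x l : ℝ≥0) :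
    Integrable (fun y : ℝ≥0 => (y : ℝ) ^ k) (stepLaw γ δ x l) := by
  have := isProbabilityMeasure_stepLaw hγ hδ0 x l
  refine Integrable.of_bound (by fun_prop : Measurable _).aestronglyMeasurable ((l : ℝ) ^ k) ?_
  filter_upwards [ae_stepLaw_le (γ := γ) (δ := δ) x l] with y hy
  rw [Real.norm_eq_abs, abs_of_nonneg (by positivity)]
  gcongr

/-- The increment never exceeds the run length, so powers of it can be traded for powers of `l`
while a lower moment keeps the small factor `powWeight δ x`. -/
lemma stepMoment_add_le {γ δ : ℝ} (hγ : 0 < γ) (hδ0 : 0 < δ) (j k : ℕ) (x l : ℝ≥0) :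
    stepMoment γ δ (j + k) x l ≤ (l : ℝ) ^ j * stepMoment γ δ k x l := by
  unfold stepMoment
  rw [← integral_const_mul]
  refine integral_mono_ae (integrable_stepLaw_pow hγ hδ0 _ x l)
    ((integrable_stepLaw_pow hγ hδ0 _ x l).const_mul _) ?_
  filter_upwards [ae_stepLaw_le (γ := γ) (δ := δ) x l] with y hy
  rw [pow_add]
  gcongr

lemma stepMoment_le_pow {γ δ : ℝ} (hγ : 0 < γ) (hδ0 : 0 < δ) (k : ℕ) (x l : ℝ≥0) :
    stepMoment γ δ k x l ≤ (l : ℝ) ^ k := by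
  have := isProbabilityMeasure_stepLaw hγ hδ0 x l
  have h := stepMoment_add_le hγ hδ0 k 0 x l
  simpa [stepMoment] using h

/-- Near time `0`, where the kernel is singular and no expansion is available, the weights are
bounded below and crude estimates suffice. -/
lemma half_le_powWeight {ρ : ℝ} (hρ : 0 ≤ ρ) {x : ℝ≥0} (hx : x < 1) : 1 / 2 ≤ powWeight ρ x := by
  have hx' : (x : ℝ) < 1 := by exact_mod_cast hx
  unfold powWeight
  calc (1 / 2 : ℝ) = 2 ^ (-1 : ℝ) := by rw [Real.rpow_neg_one]; norm_num
    _ ≤ (1 + (x : ℝ)) ^ (-1 : ℝ) :=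
      Real.rpow_le_rpow_of_nonpos (by positivity) (by linarith) (by norm_num)
    _ ≤ _ := Real.rpow_le_rpow_of_exponent_le (by simp) (by linarith)

lemma intervalIntegrable_density {γ δ : ℝ} {x l : ℝ≥0} (hx : 1 ≤ x) (k : ℕ) :
    IntervalIntegrable (fun y => y ^ k * (memoryKernel γ δ (x + y) / memoryMass γ δ (x + l)))
      volume 0 l := by
  refine ContinuousOn.intervalIntegrable fun y hy => ContinuousAt.continuousWithinAt ?_
  rw [Set.uIcc_of_le (NNReal.coe_nonneg l)] at hy
  have hx' : (1 : ℝ) ≤ x := by exact_mod_cast hx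
  have hne : (x + y : ℝ) ≠ 0 := by linarith [hy.1]
  unfold memoryKernel
  have h1 : ContinuousAt (fun y : ℝ => (x + y : ℝ) ^ (δ - 1)) y :=
    ContinuousAt.rpow_const (by fun_prop) (Or.inl hne)
  have h2 : ContinuousAt (fun y : ℝ => (x + y : ℝ) ^ δ) y :=
    ContinuousAt.rpow_const (by fun_prop) (Or.inl hne)
  exact (continuousAt_id.pow k).mul (((continuousAt_const.mul h1).mul
    (Real.continuous_exp.continuousAt.comp (continuousAt_const.mul h2))).div_const _)

/-- A memory time falls in the last run with probability of order `l * powWeight δ x`, and the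
increment is then at most `l`. -/
lemma exists_stepMoment_one_le {γ δ : ℝ} (hγ : 0 < γ) (hδ0 : 0 < δ) (hδ1 : δ < 1) :
    ∃ C : ℝ, 0 ≤ C ∧ ∀ x l : ℝ≥0,
      stepMoment γ δ 1 x l ≤ C * (1 + (l : ℝ)) ^ 2 * powWeight δ x := by
  have hc := one_sub_exp_neg_pos hγ
  set C := 4 * γ * δ / (1 - Real.exp (-γ)) with hC
  have hC0 : 0 ≤ C := by positivity
  refine ⟨C + 2, by positivity, fun x l => ?_⟩
  have hl : (0 : ℝ) ≤ l := l.2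
  have hp := powWeight_pos δ x
  rcases lt_or_ge x 1 with h | h
  · have h1 := stepMoment_le_pow hγ hδ0 1 x l
    have h2 := half_le_powWeight hδ0.le h
    calc stepMoment γ δ 1 x l ≤ 2 * (1 + (l : ℝ)) ^ 2 * (1 / 2) := by nlinarith
      _ ≤ (C + 2) * (1 + (l : ℝ)) ^ 2 * powWeight δ x := by gcongr; linarith
  · have hx : 0 < x := lt_of_lt_of_le one_pos h
    unfold stepMoment
    rw [integral_stepLaw_pow hγ hδ0 hx one_ne_zero]
    have h1 : ∫ y in (0 : ℝ)..l, y ^ 1 * (memoryKernel γ δ (x + y) / memoryMass γ δ (x + l)) ≤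
        ∫ y in (0 : ℝ)..l, l * (C * powWeight δ x) := by
      refine intervalIntegral.integral_mono_on hl (intervalIntegrable_density h 1)
        intervalIntegrable_const fun y hy => ?_
      rw [pow_one]
      have h3 := density_le hγ hδ0 hδ1 h hy
      have : 0 ≤ C * powWeight δ x := by positivity
      calc _ ≤ y * (C * powWeight δ x) := mul_le_mul_of_nonneg_left h3 hy.1
        _ ≤ _ := by gcongr; exact hy.2
    rw [intervalIntegral.integral_const, smul_eq_mul, sub_zero] at h1
    refine h1.trans ?_
    calc (l : ℝ) * (l * (C * powWeight δ x)) = C * (l : ℝ) ^ 2 * powWeight δ x := by ring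
      _ ≤ _ := by gcongr <;> linarith

/-- Expansion of the moments of the step law in powers of the rate. -/
lemma exists_abs_stepMoment_sub_le {γ δ : ℝ} (hγ : 0 < γ) (hδ0 : 0 < δ) (hδ1 : δ < 1) {k : ℕ}
    (hk : k ≠ 0) {J p : ℕ} (hp : k + J + 1 ≤ p) (hp' : k + 3 ≤ p) {ρ : ℝ} (hρ0 : 0 ≤ ρ)
    (hρ : ((J : ℝ) + 1) * (δ - 1) ≤ ρ - 1) :
    ∃ C : ℝ, 0 ≤ C ∧ ∀ x l : ℝ≥0,
      |stepMoment γ δ k x l - ∑ j ∈ Finset.range J,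
        rate γ δ x * (-rate γ δ x) ^ j / j.factorial * ∫ y in (0 : ℝ)..l, y ^ k * (l - y) ^ j| ≤
        C * (1 + (l : ℝ)) ^ p * powWeight ρ x := by
  obtain ⟨C₀, hC₀, hdens⟩ := exists_abs_density_sub_le hγ hδ0 hδ1
  set G := γ * δ with hG
  have hG0 : 0 < G := by positivity
  refine ⟨2 * (1 + J * (1 + G) ^ (J + 1)) + (C₀ + 4 * G ^ (J + 1)), by positivity, fun x l => ?_⟩
  have hl : (0 : ℝ) ≤ l := l.2
  have hl1 : (1 : ℝ) ≤ 1 + l := by linarith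
  set κ := rate γ δ x with hκ
  have hκ0 : 0 < κ := rate_pos hγ hδ0 x
  have hκG : κ ≤ G := rate_le hγ hδ0 hδ1 x
  have hpw := powWeight_pos ρ x
  have hI : ∀ j : ℕ, 0 ≤ ∫ y in (0 : ℝ)..l, y ^ k * (l - y) ^ j := fun j =>
    intervalIntegral.integral_nonneg hl fun y hy => by
      have := hy.1
      have : 0 ≤ (l : ℝ) - y := by linarith [hy.2]
      positivity
  have hI' : ∀ j : ℕ, ∫ y in (0 : ℝ)..l, y ^ k * (l - y) ^ j ≤ (l : ℝ) ^ (k + j + 1) := fun j => by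
    have h1 : ∫ y in (0 : ℝ)..l, y ^ k * (l - y) ^ j ≤ ∫ y in (0 : ℝ)..l, (l : ℝ) ^ k * (l : ℝ) ^ j := by
      refine intervalIntegral.integral_mono_on hl ((by fun_prop : Continuous _).intervalIntegrable _ _)
        intervalIntegrable_const fun y hy => ?_
      have h1 := hy.1
      have h2 : 0 ≤ (l : ℝ) - y := by linarith [hy.2]
      have h3 := hy.2
      gcongr
      linarith
    rw [intervalIntegral.integral_const, smul_eq_mul, sub_zero] at h1
    exact h1.trans (le_of_eq (by ring))
  -- For `x < 1` the moment and the expansion are bounded separately; the weight there is at least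
  -- `1 / 2`.
  rcases lt_or_ge x 1 with h | h
  · have h1 := stepMoment_le_pow hγ hδ0 k x l
    have h0 := stepMoment_nonneg γ δ k x l
    have h2 := half_le_powWeight hρ0 h
    have h3 : |∑ j ∈ Finset.range J, κ * (-κ) ^ j / j.factorial *
        ∫ y in (0 : ℝ)..l, y ^ k * (l - y) ^ j| ≤ J * (1 + G) ^ (J + 1) * (1 + (l : ℝ)) ^ p := by
      refine (Finset.abs_sum_le_sum_abs _ _).trans ?_
      have : ∀ j ∈ Finset.range J, |κ * (-κ) ^ j / j.factorial *
          ∫ y in (0 : ℝ)..l, y ^ k * (l - y) ^ j| ≤ (1 + G) ^ (J + 1) * (1 + (l : ℝ)) ^ p := by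
        intro j hj
        have hj := Finset.mem_range.1 hj
        rw [abs_mul, abs_of_nonneg (hI j), abs_div, abs_mul, abs_pow, abs_neg, abs_of_pos hκ0,
          Nat.abs_cast]
        have a1 : κ * κ ^ j / j.factorial ≤ (1 + G) ^ (J + 1) := by
          calc κ * κ ^ j / j.factorial ≤ κ * κ ^ j :=
                div_le_self (by positivity) (by exact_mod_cast Nat.one_le_iff_ne_zero.2 (Nat.factorial_ne_zero j))
            _ = κ ^ (j + 1) := by ring
            _ ≤ (1 + G) ^ (j + 1) := by gcongr; linarith
            _ ≤ (1 + G) ^ (J + 1) := pow_le_pow_right₀ (by linarith) (by omega)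
        have a2 : ∫ y in (0 : ℝ)..l, y ^ k * (l - y) ^ j ≤ (1 + (l : ℝ)) ^ p := by
          calc _ ≤ _ := hI' j
            _ ≤ (1 + (l : ℝ)) ^ (k + j + 1) := by gcongr; linarith
            _ ≤ _ := pow_le_pow_right₀ hl1 (by omega)
        exact mul_le_mul a1 a2 (hI j) (by positivity)
      refine (Finset.sum_le_card_nsmul _ _ _ this).trans (le_of_eq ?_)
      simp; ring
    have h4 : (l : ℝ) ^ k ≤ (1 + (l : ℝ)) ^ p :=
      (by gcongr; linarith : (l : ℝ) ^ k ≤ (1 + (l : ℝ)) ^ k).trans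
        (pow_le_pow_right₀ hl1 (by omega))
    have h5 : |stepMoment γ δ k x l| ≤ (1 + (l : ℝ)) ^ p := by
      rw [abs_of_nonneg h0]; exact h1.trans h4
    refine (abs_sub _ _).trans ?_
    calc _ ≤ (1 + (l : ℝ)) ^ p + J * (1 + G) ^ (J + 1) * (1 + (l : ℝ)) ^ p := add_le_add h5 h3
      _ = 2 * (1 + J * (1 + G) ^ (J + 1)) * (1 + (l : ℝ)) ^ p * (1 / 2) := by ring
      _ ≤ _ := by
        gcongr
        have : 0 ≤ C₀ + 4 * G ^ (J + 1) := by positivity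
        linarith
  · have hx : 0 < x := lt_of_lt_of_le one_pos h
    set d := fun y : ℝ => memoryKernel γ δ (x + y) / memoryMass γ δ (x + l) with hd
    have e1 : stepMoment γ δ k x l = ∫ y in (0 : ℝ)..l, y ^ k * d y :=
      integral_stepLaw_pow hγ hδ0 hx hk
    have e2 : ∑ j ∈ Finset.range J, κ * (-κ) ^ j / j.factorial *
        ∫ y in (0 : ℝ)..l, y ^ k * (l - y) ^ j = ∫ y in (0 : ℝ)..l, y ^ k *
          (κ * ∑ j ∈ Finset.range J, (-(κ * (l - y))) ^ j / j.factorial) := by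
      simp_rw [← intervalIntegral.integral_const_mul]
      rw [← intervalIntegral.integral_finsetSum]
      · refine intervalIntegral.integral_congr fun y _ => ?_
        simp only [Finset.mul_sum]
        refine Finset.sum_congr rfl fun j _ => ?_
        rw [show -(κ * (l - y)) = -κ * (l - y) by ring, mul_pow]
        ring
      · intro j _
        exact (by fun_prop : Continuous _).intervalIntegrable _ _
    rw [e1, e2, ← intervalIntegral.integral_sub (intervalIntegrable_density h k)
      ((by fun_prop : Continuous _).intervalIntegrable _ _)]
    have hbound : ∀ y ∈ Set.uIoc (0 : ℝ) l, ‖y ^ k * d y - y ^ k *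
        (κ * ∑ j ∈ Finset.range J, (-(κ * (l - y))) ^ j / j.factorial)‖ ≤
        (l : ℝ) ^ k * ((C₀ * (1 + (l : ℝ)) ^ 2 + 4 * G ^ (J + 1) * (l : ℝ) ^ J) * powWeight ρ x) := by
      intro y hy
      rw [Set.uIoc_of_le hl] at hy
      have hy' : y ∈ Set.Icc (0 : ℝ) l := ⟨hy.1.le, hy.2⟩
      have hly : 0 ≤ (l : ℝ) - y := by linarith [hy.2]
      rw [← mul_sub, Real.norm_eq_abs, abs_mul, abs_of_nonneg (pow_nonneg hy'.1 k)]
      have b1 := hdens x l h y hy'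
      have b2 := abs_exp_neg_sub_sum_le (mul_nonneg hκ0.le hly) J
      have b3 : powWeight (δ - 1) x ≤ powWeight ρ x := powWeight_mono (by linarith) x
      -- The first omitted power of the rate; this is the only use of the condition relating `J` and
      -- `ρ`.
      have b4 : κ ^ (J + 1) ≤ G ^ (J + 1) * powWeight ρ x := by
        rw [hκ, rate, mul_pow, ← hG]
        gcongr
        unfold powWeight
        rw [← Real.rpow_mul_natCast (by positivity)]
        refine Real.rpow_le_rpow_of_exponent_le (by simp) ?_
        push_cast; linarith
      have b5 : |d y - κ * ∑ j ∈ Finset.range J, (-(κ * (l - y))) ^ j / j.factorial| ≤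
          (C₀ * (1 + (l : ℝ)) ^ 2 + 4 * G ^ (J + 1) * (l : ℝ) ^ J) * powWeight ρ x := by
        calc |d y - κ * ∑ j ∈ Finset.range J, (-(κ * (l - y))) ^ j / j.factorial|
            = |(d y - κ * Real.exp (-(κ * (l - y)))) + κ * (Real.exp (-(κ * (l - y))) -
              ∑ j ∈ Finset.range J, (-(κ * (l - y))) ^ j / j.factorial)| := by congr 1; ring
          _ ≤ C₀ * (1 + (l : ℝ)) ^ 2 * powWeight (δ - 1) x + κ * (4 * (κ * (l - y)) ^ J) := by
              refine (abs_add_le _ _).trans (add_le_add b1 ?_)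
              rw [abs_mul, abs_of_pos hκ0]
              gcongr
          _ ≤ C₀ * (1 + (l : ℝ)) ^ 2 * powWeight ρ x + κ * (4 * (κ * l) ^ J) := by
              gcongr
              linarith [hy'.1]
          _ = C₀ * (1 + (l : ℝ)) ^ 2 * powWeight ρ x + 4 * κ ^ (J + 1) * (l : ℝ) ^ J := by
              rw [mul_pow]; ring
          _ ≤ C₀ * (1 + (l : ℝ)) ^ 2 * powWeight ρ x + 4 * (G ^ (J + 1) * powWeight ρ x) * (l : ℝ) ^ J := by
              gcongr
          _ = _ := by ring
      gcongr
      · exact hy'.1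
      · exact hy'.2
    have := intervalIntegral.norm_integral_le_of_norm_le_const hbound
    rw [Real.norm_eq_abs, sub_zero, abs_of_nonneg hl] at this
    refine this.trans ?_
    have hq1 : (l : ℝ) ^ k * (1 + (l : ℝ)) ^ 2 * l ≤ (1 + (l : ℝ)) ^ p := by
      calc (l : ℝ) ^ k * (1 + (l : ℝ)) ^ 2 * l ≤ (1 + (l : ℝ)) ^ k * (1 + (l : ℝ)) ^ 2 * (1 + l) := by
            gcongr <;> linarith
        _ = (1 + (l : ℝ)) ^ (k + 3) := by ring
        _ ≤ _ := pow_le_pow_right₀ hl1 hp'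
    have hq2 : (l : ℝ) ^ k * (l : ℝ) ^ J * l ≤ (1 + (l : ℝ)) ^ p := by
      calc (l : ℝ) ^ k * (l : ℝ) ^ J * l = (l : ℝ) ^ (k + J + 1) := by ring
        _ ≤ (1 + (l : ℝ)) ^ (k + J + 1) := by gcongr; linarith
        _ ≤ _ := pow_le_pow_right₀ hl1 hp
    calc _ = (C₀ * ((l : ℝ) ^ k * (1 + (l : ℝ)) ^ 2 * l) +
          4 * G ^ (J + 1) * ((l : ℝ) ^ k * (l : ℝ) ^ J * l)) * powWeight ρ x := by ring
      _ ≤ (C₀ * (1 + (l : ℝ)) ^ p + 4 * G ^ (J + 1) * (1 + (l : ℝ)) ^ p) * powWeight ρ x := by gcongr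
      _ = (C₀ + 4 * G ^ (J + 1)) * (1 + (l : ℝ)) ^ p * powWeight ρ x := by ring
      _ ≤ _ := by
        refine mul_le_mul_of_nonneg_right (mul_le_mul_of_nonneg_right ?_ (by positivity)) hpw.le
        exact le_add_of_nonneg_left (by positivity)

/-- A Beta integral. Together with `1 / j!` from the exponential series it produces the `1 / (j +
2)!` of the centring. -/
lemma integral_mul_sub_pow (l : ℝ) (j : ℕ) :
    ∫ y in (0 : ℝ)..l, y ^ 1 * (l - y) ^ j = l ^ (j + 2) / ((j + 1) * (j + 2)) := by
  have h := intervalIntegral.integral_comp_sub_left (a := 0) (b := l) (fun y => (l - y) * y ^ j) l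
  simp only [sub_sub_cancel, sub_zero, sub_self] at h
  simp only [pow_one]
  rw [h]
  have e : ∀ y : ℝ, (l - y) * y ^ j = l * y ^ j - y ^ (j + 1) := fun y => by ring
  simp_rw [e]
  rw [intervalIntegral.integral_sub ((by fun_prop : Continuous _).intervalIntegrable _ _)
    ((by fun_prop : Continuous _).intervalIntegrable _ _), intervalIntegral.integral_const_mul,
    integral_pow, integral_pow]
  push_cast
  have h1 : (j : ℝ) + 1 ≠ 0 := by positivity
  have h2 : (j : ℝ) + 2 ≠ 0 := by positivity
  have h3 : (j : ℝ) + 1 + 1 ≠ 0 := by positivity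
  simp only [ne_eq, Nat.add_eq_zero_iff, one_ne_zero, and_false, not_false_eq_true, zero_pow, sub_zero]
  field_simp
  ring

/-! ### Characteristic functions of the steps -/

/-- Lindeberg's replacement: exchange one factor at a time, the others staying in the unit disc. -/
lemma norm_prod_sub_prod_le_sum {ι : Type*} (s : Finset ι) {z w : ι → ℂ} (hz : ∀ i ∈ s, ‖z i‖ ≤ 1)
    (hw : ∀ i ∈ s, ‖w i‖ ≤ 1) :
    ‖∏ i ∈ s, z i - ∏ i ∈ s, w i‖ ≤ ∑ i ∈ s, ‖z i - w i‖ := by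
  classical
  induction s using Finset.induction_on with
  | empty => simp
  | insert a s ha ih =>
    rw [Finset.prod_insert ha, Finset.prod_insert ha, Finset.sum_insert ha]
    have h1 : ‖∏ i ∈ s, z i‖ ≤ 1 := by
      rw [norm_prod]
      exact Finset.prod_le_one (fun i _ => norm_nonneg _)
        fun i hi => hz i (Finset.mem_insert_of_mem hi)
    have h2 := ih (fun i hi => hz i (Finset.mem_insert_of_mem hi))
      (fun i hi => hw i (Finset.mem_insert_of_mem hi))
    have h3 := hw a (Finset.mem_insert_self a s)
    calc ‖z a * ∏ i ∈ s, z i - w a * ∏ i ∈ s, w i‖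
        = ‖(z a - w a) * ∏ i ∈ s, z i + w a * (∏ i ∈ s, z i - ∏ i ∈ s, w i)‖ := by congr 1; ring
      _ ≤ ‖z a - w a‖ * 1 + 1 * ‖∏ i ∈ s, z i - ∏ i ∈ s, w i‖ := by
        refine (norm_add_le _ _).trans ?_
        rw [norm_mul, norm_mul]
        gcongr
      _ ≤ _ := by linarith

lemma norm_exp_sub_exp_le {z w : ℂ} (hz : z.re ≤ 0) (hw : w.re ≤ 0) :
    ‖Complex.exp z - Complex.exp w‖ ≤ ‖z - w‖ := by
  have hconv : Convex ℝ {z : ℂ | z.re ≤ 0} := convex_halfSpace_re_le 0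
  have := hconv.norm_image_sub_le_of_norm_hasDerivWithin_le (f := Complex.exp) (f' := Complex.exp)
    (C := 1) (fun x _ => (Complex.hasDerivAt_exp x).hasDerivWithinAt)
    (fun x hx => by rw [Complex.norm_exp]; exact Real.exp_le_one_iff.2 hx) hw hz
  simpa using this

lemma norm_exp_sub_one_sub_le {z : ℂ} (hz : z.re ≤ 0) : ‖Complex.exp z - 1 - z‖ ≤ 3 * ‖z‖ ^ 2 := by
  rcases le_or_gt ‖z‖ 1 with h | h
  · exact (Complex.norm_exp_sub_one_sub_id_le h).trans (by nlinarith [norm_nonneg z])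
  · have h1 : ‖Complex.exp z‖ ≤ 1 := by rw [Complex.norm_exp]; exact Real.exp_le_one_iff.2 hz
    calc ‖Complex.exp z - 1 - z‖ ≤ ‖Complex.exp z‖ + ‖(1 : ℂ)‖ + ‖z‖ :=
          (norm_sub_le _ _).trans (by gcongr; exact norm_sub_le _ _)
      _ ≤ 3 * ‖z‖ ^ 2 := by rw [norm_one]; nlinarith

lemma norm_exp_I_sub_taylor_le (a : ℝ) :
    ‖Complex.exp (Complex.I * a) - (1 + Complex.I * a - (a : ℂ) ^ 2 / 2)‖ ≤ 4 * |a| ^ 3 := by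
  have hI : ‖Complex.I * (a : ℂ)‖ = |a| := by simp
  rcases le_or_gt |a| 1 with h | h
  · have h1 := Complex.norm_exp_sub_sum_le_norm_mul_exp (Complex.I * a) 3
    have e : ∑ m ∈ Finset.range 3, (Complex.I * (a : ℂ)) ^ m / m.factorial =
        1 + Complex.I * a - (a : ℂ) ^ 2 / 2 := by
      simp [Finset.sum_range_succ, mul_pow, Nat.factorial]; ring
    rw [e, hI] at h1
    refine h1.trans ?_
    rw [mul_comm]
    gcongr
    calc Real.exp |a| ≤ Real.exp 1 := Real.exp_le_exp.2 h
      _ ≤ 4 := by linarith [Real.exp_one_lt_d9]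
  · have h1 : ‖Complex.exp (Complex.I * a)‖ = 1 := by
      rw [mul_comm]; exact Complex.norm_exp_ofReal_mul_I a
    have h2 : ‖(a : ℂ) ^ 2 / 2‖ = |a| ^ 2 / 2 := by simp
    have h3 : |a| ^ 2 ≤ |a| ^ 3 := pow_le_pow_right₀ h.le (by norm_num)
    have h4 : |a| ≤ |a| ^ 3 := le_self_pow₀ h.le (by norm_num)
    calc _ ≤ ‖Complex.exp (Complex.I * a)‖ + (‖(1 : ℂ)‖ + ‖Complex.I * (a : ℂ)‖ + ‖(a : ℂ) ^ 2 / 2‖) := by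
          refine (norm_sub_le _ _).trans ?_
          gcongr
          refine (norm_sub_le _ _).trans ?_
          gcongr
          exact norm_add_le _ _
      _ ≤ _ := by rw [h1, hI, h2, norm_one]; linarith

/-- The characteristic function of the step law. -/
def stepChar (γ δ θ : ℝ) (x l : ℝ≥0) : ℂ :=
  ∫ y : ℝ≥0, Complex.exp (Complex.I * ((θ * y : ℝ) : ℂ)) ∂(stepLaw γ δ x l)

lemma norm_exp_I_mul (a : ℝ) : ‖Complex.exp (Complex.I * (a : ℂ))‖ = 1 := by
  rw [mul_comm]; exact Complex.norm_exp_ofReal_mul_I a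

lemma norm_stepChar_le_one {γ δ : ℝ} (hγ : 0 < γ) (hδ0 : 0 < δ) (θ : ℝ) (x l : ℝ≥0) :
    ‖stepChar γ δ θ x l‖ ≤ 1 := by
  have := isProbabilityMeasure_stepLaw hγ hδ0 x l
  refine (norm_integral_le_integral_norm _).trans ?_
  simp_rw [norm_exp_I_mul]
  simp

lemma integrable_stepChar {γ δ : ℝ} (hγ : 0 < γ) (hδ0 : 0 < δ) (θ : ℝ) (x l : ℝ≥0) :
    Integrable (fun y : ℝ≥0 => Complex.exp (Complex.I * ((θ * y : ℝ) : ℂ))) (stepLaw γ δ x l) := by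
  have := isProbabilityMeasure_stepLaw hγ hδ0 x l
  exact Integrable.of_bound (by fun_prop : Measurable _).aestronglyMeasurable 1
    (Eventually.of_forall fun y => (norm_exp_I_mul _).le)

/-- The increment is at most `l`. This allows the factor of the straddling run to be added to a
product at a cost controlled by its length. -/
lemma norm_one_sub_stepChar_le {γ δ : ℝ} (hγ : 0 < γ) (hδ0 : 0 < δ) (θ : ℝ) (x l : ℝ≥0) :
    ‖1 - stepChar γ δ θ x l‖ ≤ |θ| * l := by
  have := isProbabilityMeasure_stepLaw hγ hδ0 x l
  have e : 1 - stepChar γ δ θ x l =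
      ∫ y : ℝ≥0, (1 - Complex.exp (Complex.I * ((θ * y : ℝ) : ℂ))) ∂(stepLaw γ δ x l) := by
    rw [integral_sub (integrable_const _) (integrable_stepChar hγ hδ0 θ x l)]
    simp [stepChar]
  rw [e]
  refine (norm_integral_le_of_norm_le_const (C := |θ| * l) ?_).trans (by simp)
  filter_upwards [ae_stepLaw_le (γ := γ) (δ := δ) x l] with y hy
  rw [norm_sub_rev]
  refine (Real.norm_exp_I_mul_ofReal_sub_one_le).trans ?_
  rw [Real.norm_eq_abs, abs_mul, abs_of_nonneg (NNReal.coe_nonneg y)]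
  gcongr

/-- The error of the second-order approximation of the characteristic function of the step law. -/
def stepError (γ δ θ : ℝ) (x l : ℝ≥0) : ℝ :=
  4 * |θ| ^ 3 * ((l : ℝ) ^ 2 * stepMoment γ δ 1 x l) + 6 * θ ^ 2 * stepMoment γ δ 1 x l ^ 2 +
    2 * θ ^ 4 * ((l : ℝ) * stepMoment γ δ 1 x l) ^ 2

lemma stepError_nonneg (γ δ θ : ℝ) (x l : ℝ≥0) : 0 ≤ stepError γ δ θ x l := by
  have := stepMoment_nonneg γ δ 1 x l
  unfold stepError; positivity

lemma measurable_stepError {γ δ : ℝ} (hγ : 0 < γ) (hδ0 : 0 < δ) (θ : ℝ) :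
    Measurable (Function.uncurry (stepError γ δ θ)) := by
  have : Measurable fun p : ℝ≥0 × ℝ≥0 => stepMoment γ δ 1 p.1 p.2 :=
    measurable_stepMoment γ δ hγ hδ0 1
  unfold stepError Function.uncurry
  fun_prop

/-- The exponent of the Gaussian approximation of the step law. -/
def stepExponent (γ δ θ : ℝ) (x l : ℝ≥0) : ℂ :=
  Complex.I * ((θ * stepMoment γ δ 1 x l : ℝ) : ℂ) - ((θ ^ 2 * stepMoment γ δ 2 x l / 2 : ℝ) : ℂ)

lemma re_stepExponent_nonpos (γ δ θ : ℝ) (x l : ℝ≥0) : (stepExponent γ δ θ x l).re ≤ 0 := by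
  have := stepMoment_nonneg γ δ 2 x l
  have h : 0 ≤ θ ^ 2 * stepMoment γ δ 2 x l / 2 := by positivity
  rw [stepExponent, Complex.sub_re, Complex.ofReal_re, Complex.re_mul_ofReal]
  simpa using h

/-- Both sides are compared with `1 + v`, `v` being the exponent. The exponent contains the raw
second moment and not the variance: `A²` carries the square of the rate, and its contribution is
part of the error. -/
lemma norm_stepChar_sub_le {γ δ : ℝ} (hγ : 0 < γ) (hδ0 : 0 < δ) (θ : ℝ) (x l : ℝ≥0) :
    ‖stepChar γ δ θ x l - Complex.exp (stepExponent γ δ θ x l)‖ ≤ stepError γ δ θ x l := by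
  have := isProbabilityMeasure_stepLaw hγ hδ0 x l
  set A := stepMoment γ δ 1 x l with hA
  set B := stepMoment γ δ 2 x l with hB
  have hA0 : 0 ≤ A := stepMoment_nonneg γ δ 1 x l
  have hB0 : 0 ≤ B := stepMoment_nonneg γ δ 2 x l
  have hl : (0 : ℝ) ≤ l := l.2
  have hBA : B ≤ l * A := by
    have := stepMoment_add_le hγ hδ0 1 1 x l
    simpa using this
  have hCA : stepMoment γ δ 3 x l ≤ (l : ℝ) ^ 2 * A := stepMoment_add_le hγ hδ0 2 1 x l
  set v := stepExponent γ δ θ x l with hv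
  have i1 : Integrable (fun y : ℝ≥0 => Complex.I * ((θ * y : ℝ) : ℂ)) (stepLaw γ δ x l) := by
    have := ((integrable_stepLaw_pow hγ hδ0 1 x l).const_mul θ).ofReal (𝕜 := ℂ)
    simpa using this.const_mul Complex.I
  have i2 : Integrable (fun y : ℝ≥0 => ((θ * y : ℝ) : ℂ) ^ 2 / 2) (stepLaw γ δ x l) := by
    have := (((integrable_stepLaw_pow hγ hδ0 2 x l).const_mul (θ ^ 2)).div_const 2).ofReal (𝕜 := ℂ)
    refine this.congr (Eventually.of_forall fun y => ?_)
    push_cast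
    simp [mul_pow]
  have e1 : ∫ y : ℝ≥0, (1 + Complex.I * ((θ * y : ℝ) : ℂ) - ((θ * y : ℝ) : ℂ) ^ 2 / 2)
      ∂(stepLaw γ δ x l) = 1 + v := by
    have i3 : Integrable (fun y : ℝ≥0 => 1 + Complex.I * ((θ * y : ℝ) : ℂ)) (stepLaw γ δ x l) :=
      (integrable_const 1).add i1
    rw [integral_sub i3 i2, integral_add (integrable_const 1) i1, integral_const_mul]
    have e2 : ∫ y : ℝ≥0, ((θ * y : ℝ) : ℂ) ∂(stepLaw γ δ x l) = ((θ * A : ℝ) : ℂ) := by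
      rw [integral_complex_ofReal, integral_const_mul]
      simp [hA, stepMoment]
    have e3 : ∫ y : ℝ≥0, ((θ * y : ℝ) : ℂ) ^ 2 / 2 ∂(stepLaw γ δ x l) = ((θ ^ 2 * B / 2 : ℝ) : ℂ) := by
      have : ∀ y : ℝ≥0, ((θ * y : ℝ) : ℂ) ^ 2 / 2 = ((θ ^ 2 * (y : ℝ) ^ 2 / 2 : ℝ) : ℂ) := fun y => by
        push_cast; ring
      simp_rw [this]
      rw [integral_complex_ofReal, integral_div, integral_const_mul]
      rfl
    rw [e2, e3, hv, stepExponent]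
    simp
    ring
  have b1 : ‖stepChar γ δ θ x l - (1 + v)‖ ≤ 4 * |θ| ^ 3 * ((l : ℝ) ^ 2 * A) := by
    have i4 : Integrable (fun y : ℝ≥0 => 1 + Complex.I * ((θ * y : ℝ) : ℂ) -
        ((θ * y : ℝ) : ℂ) ^ 2 / 2) (stepLaw γ δ x l) := ((integrable_const 1).add i1).sub i2
    rw [← e1, stepChar, ← integral_sub (integrable_stepChar hγ hδ0 θ x l) i4]
    refine (norm_integral_le_integral_norm _).trans ?_
    calc _ ≤ ∫ y : ℝ≥0, 4 * |θ| ^ 3 * (y : ℝ) ^ 3 ∂(stepLaw γ δ x l) := by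
          refine integral_mono_of_nonneg (Eventually.of_forall fun y => norm_nonneg _)
            ((integrable_stepLaw_pow hγ hδ0 3 x l).const_mul _) (Eventually.of_forall fun y => ?_)
          refine (norm_exp_I_sub_taylor_le (θ * y)).trans (le_of_eq ?_)
          rw [abs_mul, abs_of_nonneg (NNReal.coe_nonneg y)]; ring
      _ = 4 * |θ| ^ 3 * stepMoment γ δ 3 x l := by rw [integral_const_mul]; rfl
      _ ≤ _ := by gcongr
  have b2 := norm_exp_sub_one_sub_le (re_stepExponent_nonpos γ δ θ x l)
  rw [← hv] at b2
  have b3 : ‖v‖ ≤ |θ| * A + θ ^ 2 * (l * A) / 2 := by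
    rw [hv, stepExponent]
    refine (norm_sub_le _ _).trans ?_
    rw [norm_mul, Complex.norm_I, one_mul, Complex.norm_real, Complex.norm_real, Real.norm_eq_abs,
      Real.norm_eq_abs, abs_mul, abs_of_nonneg hA0,
      abs_of_nonneg (by positivity : 0 ≤ θ ^ 2 * stepMoment γ δ 2 x l / 2)]
    gcongr
  have b4 : 3 * ‖v‖ ^ 2 ≤ 6 * θ ^ 2 * A ^ 2 + 2 * θ ^ 4 * ((l : ℝ) * A) ^ 2 := by
    have h1 : ‖v‖ ^ 2 ≤ (|θ| * A + θ ^ 2 * (l * A) / 2) ^ 2 := by gcongr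
    have h2 : (|θ| * A + θ ^ 2 * (l * A) / 2) ^ 2 ≤
        2 * (|θ| * A) ^ 2 + 2 * (θ ^ 2 * (l * A) / 2) ^ 2 := by
      nlinarith [sq_nonneg (|θ| * A - θ ^ 2 * (l * A) / 2)]
    have h3 : (|θ| * A) ^ 2 = θ ^ 2 * A ^ 2 := by rw [mul_pow, sq_abs]
    have h4 : (θ ^ 2 * (l * A) / 2) ^ 2 = θ ^ 4 * (l * A) ^ 2 / 4 := by ring
    have h5 : 0 ≤ θ ^ 4 * (l * A) ^ 2 := by positivity
    rw [h3, h4] at h2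
    linarith
  calc ‖stepChar γ δ θ x l - Complex.exp v‖
      = ‖(stepChar γ δ θ x l - (1 + v)) - (Complex.exp v - 1 - v)‖ := by congr 1; ring
    _ ≤ _ := (norm_sub_le _ _).trans (add_le_add b1 (b2.trans b4))
    _ = _ := by unfold stepError; ring

/-! ### Conditional characteristic function of the age along one realisation of the runs -/

section

variable {Ω : Type*} {L : ℕ → Ω → ℝ≥0}

/-- Once `T_n` exceeds `t` the truncation at `n` is invisible. The sum includes run `N`, which is
still under way at `t`, hence `N + 1` terms. -/
lemma visitSum_eq_sum {t : ℝ≥0} {n N : ℕ} {ω : Ω} (h1 : relocTime L N ω ≤ t)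
    (h2 : t < relocTime L (N + 1) ω) (hn : t < relocTime L n ω) (F : ℝ≥0 → ℝ≥0 → ℝ) :
    visitSum L t n F ω = ∑ k ∈ Finset.range (N + 1), F (relocTime L k ω) (L k ω) := by
  have hNn : N < n := by
    by_contra h
    exact absurd (hn.trans_le (relocTime_mono ω (not_lt.1 h))) (not_lt.2 h1)
  unfold visitSum
  rw [← Finset.sum_filter]
  refine Finset.sum_congr ?_ fun _ _ => rfl
  ext k
  simp only [Finset.mem_filter, Finset.mem_range]
  constructor
  · rintro ⟨_, h⟩
    by_contra hk
    exact absurd (h2.trans_le (relocTime_mono ω (not_lt.1 hk))) (not_lt.2 h)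
  · intro hk
    exact ⟨by omega, (relocTime_mono ω (Nat.lt_succ_iff.1 hk)).trans h1⟩

/-- Gaussian approximation of the conditional characteristic function of the age of the run. -/
lemma norm_ageChar_sub_le {γ δ : ℝ} (hγ : 0 < γ) (hδ0 : 0 < δ) (θ s : ℝ) {b : ℝ} (hb : 0 ≤ b)
    {t : ℝ≥0} {n N : ℕ} {ω : Ω} (h1 : relocTime L N ω ≤ t) (h2 : t < relocTime L (N + 1) ω)
    (hn : t < relocTime L n ω) :
    ‖Complex.exp (Complex.I * ((θ * ((t - relocTime L N ω : ℝ≥0) : ℝ) : ℝ) : ℂ)) *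
        ∏ k ∈ Finset.range N, stepChar γ δ θ (relocTime L k ω) (L k ω) -
      Complex.exp (Complex.I * ((θ * s : ℝ) : ℂ) - ((θ ^ 2 * b / 2 : ℝ) : ℂ))‖ ≤
      2 * |θ| * visitSum L t n (straddle t) ω + visitSum L t n (stepError γ δ θ) ω +
        |θ| * |visitSum L t n (stepMoment γ δ 1) ω - s| +
        θ ^ 2 * |visitSum L t n (stepMoment γ δ 2) ω - b| := by
  set T := fun k => relocTime L k ω with hT
  set l := fun k => L k ω with hl
  set P := ∏ k ∈ Finset.range N, stepChar γ δ θ (T k) (l k) with hP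
  have hP1 : ‖P‖ ≤ 1 := by
    rw [hP, norm_prod]
    exact Finset.prod_le_one (fun i _ => norm_nonneg _) fun i _ => norm_stepChar_le_one hγ hδ0 θ _ _
  have hstr : visitSum L t n (straddle t) ω = l N := by
    rw [visitSum_eq_sum h1 h2 hn, Finset.sum_range_succ, Finset.sum_eq_zero, zero_add]
    · have : t < relocTime L N ω + L N ω := by rw [← relocTime_succ]; exact h2
      simp [straddle, this, hl]
    · intro k hk
      have : relocTime L k ω + L k ω ≤ t := by
        rw [← relocTime_succ]
        exact (relocTime_mono ω (Finset.mem_range.1 hk)).trans h1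
      simp [straddle, not_lt.2 this]
  have a1 : ‖Complex.exp (Complex.I * ((θ * ((t - T N : ℝ≥0) : ℝ) : ℝ) : ℂ)) * P - P‖ ≤ |θ| * l N := by
    rw [← sub_one_mul, norm_mul]
    refine (mul_le_of_le_one_right (norm_nonneg _) hP1).trans
      ((Real.norm_exp_I_mul_ofReal_sub_one_le).trans ?_)
    rw [Real.norm_eq_abs, abs_mul, abs_of_nonneg (NNReal.coe_nonneg _)]
    gcongr
    rw [tsub_le_iff_left]
    have := h2.le
    rwa [relocTime_succ] at this
  -- The time elapsed since the last relocation was discarded at cost `|θ| * l N`. The factor of run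
  -- `N` is now added at the same cost, so that the product ranges over the same runs as the visit
  -- sums.
  have a2 : ‖P - ∏ k ∈ Finset.range (N + 1), stepChar γ δ θ (T k) (l k)‖ ≤ |θ| * l N := by
    rw [Finset.prod_range_succ, ← hP, ← mul_one_sub, norm_mul]
    exact (mul_le_of_le_one_left (norm_nonneg _) hP1).trans (norm_one_sub_stepChar_le hγ hδ0 θ _ _)
  have a3 : ‖∏ k ∈ Finset.range (N + 1), stepChar γ δ θ (T k) (l k) -
      ∏ k ∈ Finset.range (N + 1), Complex.exp (stepExponent γ δ θ (T k) (l k))‖ ≤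
      visitSum L t n (stepError γ δ θ) ω := by
    rw [visitSum_eq_sum h1 h2 hn]
    refine (norm_prod_sub_prod_le_sum _ (fun i _ => norm_stepChar_le_one hγ hδ0 θ _ _)
      fun i _ => ?_).trans (Finset.sum_le_sum fun i _ => norm_stepChar_sub_le hγ hδ0 θ _ _)
    rw [Complex.norm_exp]
    exact Real.exp_le_one_iff.2 (re_stepExponent_nonpos _ _ _ _ _)
  set SA := visitSum L t n (stepMoment γ δ 1) ω with hSA
  set SB := visitSum L t n (stepMoment γ δ 2) ω with hSB
  have hSB0 : 0 ≤ SB := visitSum_nonneg t n (stepMoment_nonneg γ δ 2) ω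
  have a4 : ∏ k ∈ Finset.range (N + 1), Complex.exp (stepExponent γ δ θ (T k) (l k)) =
      Complex.exp (Complex.I * ((θ * SA : ℝ) : ℂ) - ((θ ^ 2 * SB / 2 : ℝ) : ℂ)) := by
    rw [← Complex.exp_sum, hSA, hSB, visitSum_eq_sum h1 h2 hn, visitSum_eq_sum h1 h2 hn]
    congr 1
    simp only [stepExponent, Finset.sum_sub_distrib]
    push_cast
    simp only [Finset.mul_sum, Finset.sum_div]
    rfl
  have re_le : ∀ u c : ℝ, 0 ≤ c → (Complex.I * (u : ℂ) - (c : ℂ)).re ≤ 0 := fun u c hc => by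
    rw [Complex.sub_re, Complex.ofReal_re, Complex.re_mul_ofReal]; simpa using hc
  have a5 : ‖Complex.exp (Complex.I * ((θ * SA : ℝ) : ℂ) - ((θ ^ 2 * SB / 2 : ℝ) : ℂ)) -
      Complex.exp (Complex.I * ((θ * s : ℝ) : ℂ) - ((θ ^ 2 * b / 2 : ℝ) : ℂ))‖ ≤
      |θ| * |SA - s| + θ ^ 2 * |SB - b| := by
    refine (norm_exp_sub_exp_le (re_le _ _ (by positivity)) (re_le _ _ (by positivity))).trans ?_
    have e : Complex.I * ((θ * SA : ℝ) : ℂ) - ((θ ^ 2 * SB / 2 : ℝ) : ℂ) -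
        (Complex.I * ((θ * s : ℝ) : ℂ) - ((θ ^ 2 * b / 2 : ℝ) : ℂ)) =
        Complex.I * ((θ * (SA - s) : ℝ) : ℂ) - ((θ ^ 2 * (SB - b) / 2 : ℝ) : ℂ) := by
      push_cast; ring
    rw [e]
    refine (norm_sub_le _ _).trans ?_
    rw [norm_mul, Complex.norm_I, one_mul, Complex.norm_real, Complex.norm_real, Real.norm_eq_abs,
      Real.norm_eq_abs, abs_mul, abs_div, abs_mul, abs_of_nonneg (sq_nonneg θ), abs_two]
    have : 0 ≤ θ ^ 2 * |SB - b| := by positivity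
    linarith
  rw [hstr]
  rw [a4] at a3
  calc _ ≤ _ := norm_sub_le_norm_sub_add_norm_sub _ P _
    _ ≤ |θ| * l N + (|θ| * l N + (visitSum L t n (stepError γ δ θ) ω +
        (|θ| * |SA - s| + θ ^ 2 * |SB - b|))) := by
      refine add_le_add a1 ?_
      refine (norm_sub_le_norm_sub_add_norm_sub _
        (∏ k ∈ Finset.range (N + 1), stepChar γ δ θ (T k) (l k)) _).trans (add_le_add a2 ?_)
      exact (norm_sub_le_norm_sub_add_norm_sub _ _ _).trans (add_le_add a3 a5)
    _ = _ := by ring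

end

/-! ### Asymptotics of the centring -/

/-- The number of terms in the expansion of the centring. -/
def expansionOrder (δ : ℝ) : ℕ := ⌊δ / (2 - 2 * δ)⌋₊ + 1

/-- The moment exponent required of the run lengths. -/
def momentOrder (δ : ℝ) : ℕ := max 8 (⌊1 / (1 - δ)⌋₊ + 1)

/-- The remainder of the first step moment, after `J` terms, involves `E[L^(J+2)]`. The bound holds
because `δ / (2 - 2δ)` is half of `1 / (1 - δ) - 1`. -/
lemma expansionOrder_add_two_le {δ : ℝ} (hδ0 : 0 < δ) (hδ1 : δ < 1) :
    expansionOrder δ + 2 ≤ momentOrder δ := by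
  unfold expansionOrder momentOrder
  set m := ⌊1 / (1 - δ)⌋₊ with hm
  set j := ⌊δ / (2 - 2 * δ)⌋₊ with hj
  have h1 : 0 < 1 - δ := by linarith
  have hx : 0 ≤ δ / (2 - 2 * δ) := div_nonneg hδ0.le (by linarith)
  have h2 : (j : ℝ) ≤ δ / (2 - 2 * δ) := Nat.floor_le hx
  have h3 : 1 / (1 - δ) < m + 1 := Nat.lt_floor_add_one _
  have h4 : δ / (2 - 2 * δ) = (1 / (1 - δ) - 1) / 2 := by
    have : 2 - 2 * δ ≠ 0 := by linarith
    field_simp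
    ring
  have h5 : 2 * (j : ℝ) < m := by rw [h4] at h2; linarith
  have h6 : 2 * j < m := by exact_mod_cast h5
  omega

/-- The exponents in the expansion of the centring. -/
def expansionExp (δ : ℝ) (j : ℕ) : ℝ := δ - (1 - δ) * j

/-- All retained exponents are positive, so the corresponding sums over runs grow like `t ^
expansionExp δ j`, and they lie at or above the fluctuation exponent `δ / 2`. -/
lemma expansionExp_ge {δ : ℝ} (hδ0 : 0 < δ) (hδ1 : δ < 1) {j : ℕ}
    (hj : j ∈ Finset.range (expansionOrder δ)) : δ / 2 ≤ expansionExp δ j := by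
  have h1 : j ≤ ⌊δ / (2 - 2 * δ)⌋₊ := Nat.lt_succ_iff.1 (Finset.mem_range.1 hj)
  have h2 : (j : ℝ) ≤ δ / (2 - 2 * δ) :=
    (Nat.le_floor_iff (div_nonneg hδ0.le (by linarith))).1 h1
  rw [le_div_iff₀ (by linarith)] at h2
  unfold expansionExp
  linarith

lemma expansionExp_le {δ : ℝ} (hδ1 : δ < 1) (j : ℕ) : expansionExp δ j ≤ 1 := by
  unfold expansionExp
  have : 0 ≤ (1 - δ) * j := mul_nonneg (by linarith) (by positivity)
  linarith

/-- The first omitted term is negligible against `√s(t) ≍ t^(δ/2)`; this is why the expansion stops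
at this order. -/
lemma expansionExp_order_lt {δ : ℝ} (hδ1 : δ < 1) :
    expansionExp δ (expansionOrder δ) < δ / 2 := by
  have h := Nat.lt_floor_add_one (δ / (2 - 2 * δ))
  rw [div_lt_iff₀ (by linarith)] at h
  unfold expansionExp expansionOrder
  push_cast
  linarith

lemma powWeight_pow {δ : ℝ} (j : ℕ) (x : ℝ≥0) :
    powWeight δ x ^ (j + 1) = powWeight (expansionExp δ j) x := by
  unfold powWeight expansionExp
  rw [← Real.rpow_mul_natCast (by positivity)]
  congr 1
  push_cast
  ring

/-- The coefficients in the expansion of the mean step. -/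
def expansionCoef (γ δ : ℝ) (φ : Measure ℝ≥0) (j : ℕ) : ℝ :=
  γ * δ * (-(γ * δ)) ^ j * moment φ (j + 2) / (j + 2).factorial

lemma centring_eq {γ δ : ℝ} {φ : Measure ℝ≥0} {t : ℝ} (ht : 0 < t) :
    centring γ δ φ t = (moment φ 1)⁻¹ * ∑ j ∈ Finset.range (expansionOrder δ),
      expansionCoef γ δ φ j * (t ^ expansionExp δ j / expansionExp δ j) := by
  unfold centring
  rw [Finset.mul_sum, Finset.mul_sum]
  refine Finset.sum_congr rfl fun j _ => ?_
  have : t ^ expansionExp δ j = t ^ δ * t ^ ((j : ℝ) * (δ - 1)) := by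
    rw [← Real.rpow_add ht]; congr 1; unfold expansionExp; ring
  rw [this]
  unfold expansionCoef expansionExp
  simp only [div_eq_mul_inv, mul_inv]
  ring

/-- Only the term `k = 0` survives, the others carrying negative powers of `t`. -/
lemma tendsto_centring_div {γ δ : ℝ} (hδ0 : 0 < δ) (hδ1 : δ < 1) {φ : Measure ℝ≥0} :
    Tendsto (fun t : ℝ => centring γ δ φ t / t ^ δ) atTop
      (𝓝 (γ * moment φ 2 / (2 * moment φ 1))) := by
  have hterm : ∀ k ∈ Finset.range (⌊δ / (2 - 2 * δ)⌋₊ + 1), Tendsto (fun t : ℝ =>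
      (-(γ * δ)) ^ k * moment φ (k + 2) / ((k + 2).factorial * (δ - (1 - δ) * k)) *
        t ^ ((k : ℝ) * (δ - 1))) atTop (𝓝 (if k = 0 then moment φ 2 / (2 * δ) else 0)) := by
    intro k _
    split_ifs with h
    · subst h
      simp
    · have hk : (0 : ℝ) < k := by exact_mod_cast Nat.pos_of_ne_zero h
      have := tendsto_rpow_neg_atTop (y := (k : ℝ) * (1 - δ)) (mul_pos hk (by linarith))
      have e : -((k : ℝ) * (1 - δ)) = (k : ℝ) * (δ - 1) := by ring
      rw [e] at this
      simpa using this.const_mul ((-(γ * δ)) ^ k * moment φ (k + 2) /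
        ((k + 2).factorial * (δ - (1 - δ) * k)))
  have hsum := (tendsto_finsetSum _ hterm).const_mul (γ * δ / moment φ 1)
  have e0 : γ * δ / moment φ 1 * ∑ k ∈ Finset.range (⌊δ / (2 - 2 * δ)⌋₊ + 1),
      (if k = 0 then moment φ 2 / (2 * δ) else 0) = γ * moment φ 2 / (2 * moment φ 1) := by
    rw [Finset.sum_ite_eq' (Finset.range (⌊δ / (2 - 2 * δ)⌋₊ + 1)) 0
      (fun _ => moment φ 2 / (2 * δ)), if_pos (by simp)]
    rw [div_mul_div_comm]
    by_cases hm : moment φ 1 = 0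
    · simp [hm]
    · field_simp
  rw [e0] at hsum
  refine hsum.congr' ?_
  filter_upwards [eventually_gt_atTop 0] with t ht
  unfold centring
  have : t ^ δ ≠ 0 := (Real.rpow_pos_of_pos ht δ).ne'
  rw [eq_div_iff this]
  ring

/-- With `s t ~ c t^δ`, the factor `|u / √(s t)|^k` has order `t^(-kδ/2)`. This is the bookkeeping
for all error terms at the frequency `θ = u / √s`. -/
lemma tendsto_inv_sqrt_pow_mul {δ c a ρ : ℝ} (hc : 0 < c) {s : ℝ → ℝ}
    (hs : Tendsto (fun t => s t / t ^ δ) atTop (𝓝 c)) (u : ℝ) (k : ℕ) (hk : ρ < k * (δ / 2)) :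
    Tendsto (fun t : ℝ => |u / √(s t)| ^ k * (a + t) ^ ρ) atTop (𝓝 0) := by
  have h1 : Tendsto (fun t => (|u| / √(s t / t ^ δ)) ^ k) atTop (𝓝 ((|u| / √c) ^ k)) :=
    (tendsto_const_nhds.div ((Real.continuous_sqrt.tendsto c).comp hs)
      (Real.sqrt_pos.2 hc).ne').pow k
  have h2 : Tendsto (fun t : ℝ => ((a + t) / t) ^ ρ) atTop (𝓝 (1 ^ ρ)) := by
    have : Tendsto (fun t : ℝ => (a + t) / t) atTop (𝓝 1) := by
      have h : Tendsto (fun t : ℝ => a / t) atTop (𝓝 0) := tendsto_const_nhds.div_atTop tendsto_id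
      have h' := h.add_const 1
      rw [zero_add] at h'
      refine h'.congr' ?_
      filter_upwards [eventually_gt_atTop 0] with t ht
      field_simp
    exact this.rpow_const (Or.inl one_ne_zero)
  have h3 : Tendsto (fun t : ℝ => t ^ (-(k * (δ / 2) - ρ))) atTop (𝓝 0) :=
    tendsto_rpow_neg_atTop (by linarith)
  have h := (h1.mul h2).mul h3
  rw [mul_zero] at h
  refine h.congr' ?_
  filter_upwards [eventually_gt_atTop 0, eventually_gt_atTop (-a),
    hs.eventually (lt_mem_nhds hc)] with t ht hta hst
  have ha : 0 < a + t := by linarith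
  have hst' : 0 < s t := by
    by_contra hcon
    exact absurd hst (not_lt.2 (div_nonpos_of_nonpos_of_nonneg (not_lt.1 hcon) (by positivity)))
  have e1 : √(s t) = √(s t / t ^ δ) * t ^ (δ / 2) := by
    have : s t = s t / t ^ δ * t ^ δ := by field_simp
    conv_lhs => rw [this]
    rw [Real.sqrt_mul hst.le, Real.sqrt_eq_rpow (t ^ δ), ← Real.rpow_mul ht.le]
    congr 2; ring
  have e2 : (a + t) ^ ρ = ((a + t) / t) ^ ρ * t ^ ρ := by
    rw [← Real.mul_rpow (by positivity) ht.le]; congr 1; field_simp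
  rw [abs_div, abs_of_nonneg (Real.sqrt_nonneg _), e1, e2, Real.rpow_neg ht.le,
    Real.rpow_sub ht, ← div_div, div_pow (|u| / √(s t / t ^ δ)), ← Real.rpow_mul_natCast ht.le,
    mul_comm (δ / 2)]
  field_simp

/-! ### Mean and variance of the age, with errors averaged over the run lengths -/

section

variable {Ω : Type*} [MeasurableSpace Ω] {Pr : Measure Ω} {φ : Measure ℝ≥0} {L : ℕ → Ω → ℝ≥0}
  [IsProbabilityMeasure Pr] [IsProbabilityMeasure φ]

lemma moment_two_pos (hφ : φ {0} = 0) (h2 : Integrable (fun l : ℝ≥0 => (l : ℝ) ^ 2) φ) :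
    0 < moment φ 2 := by
  rw [moment, integral_pos_iff_support_of_nonneg (fun l => by positivity) h2]
  have : Function.support (fun l : ℝ≥0 => (l : ℝ) ^ 2) = {0}ᶜ := by
    ext l; simp
  rw [this, prob_compl_eq_one_iff (measurableSet_singleton _) |>.2 hφ]
  exact one_pos

/-- Expansion of the mean of a step moment. -/
lemma exists_abs_integral_stepMoment_sub_le {γ δ : ℝ} (hγ : 0 < γ) (hδ0 : 0 < δ) (hδ1 : δ < 1) {k : ℕ}
    (hk : k ≠ 0) {J p : ℕ} (hmom : Integrable (fun l : ℝ≥0 => (l : ℝ) ^ p) φ)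
    (hp : k + J + 1 ≤ p) (hp' : k + 3 ≤ p) {ρ : ℝ} (hρ0 : 0 ≤ ρ)
    (hρ : ((J : ℝ) + 1) * (δ - 1) ≤ ρ - 1) {c : ℕ → ℝ}
    (hc : ∀ j ∈ Finset.range J, ∀ l : ℝ≥0, ∫ y in (0 : ℝ)..l, y ^ k * ((l : ℝ) - y) ^ j =
      (l : ℝ) ^ (k + j + 1) * c j) :
    ∃ C : ℝ, ∀ x : ℝ≥0,
      |∫ l, stepMoment γ δ k x l ∂φ - ∑ j ∈ Finset.range J,
        (γ * δ * (-(γ * δ)) ^ j / j.factorial * c j * moment φ (k + j + 1)) *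
          powWeight (expansionExp δ j) x| ≤ C * powWeight ρ x := by
  obtain ⟨C, hC0, hC⟩ := exists_abs_stepMoment_sub_le hγ hδ0 hδ1 hk hp hp' hρ0 hρ
  have hi := fun {m : ℕ} (hm : m ≤ p) => integrable_one_add_pow (φ := φ) hmom hm
  have hmi : ∀ {m : ℕ}, m ≤ p → Integrable (fun l : ℝ≥0 => (l : ℝ) ^ m) φ := fun {m} hm =>
    (hi hm).mono' (by fun_prop : Measurable _).aestronglyMeasurable
      (Eventually.of_forall fun l => by
        rw [Real.norm_eq_abs, abs_of_nonneg (by positivity)]; gcongr; simp)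
  refine ⟨C * ∫ l : ℝ≥0, (1 + (l : ℝ)) ^ p ∂φ, fun x => ?_⟩
  have hmeas : Measurable fun l => stepMoment γ δ k x l :=
    (measurable_stepMoment γ δ hγ hδ0 k).comp measurable_prodMk_left
  have iS : Integrable (fun l => stepMoment γ δ k x l) φ :=
    (hmi (m := k) (by omega)).mono' hmeas.aestronglyMeasurable (Eventually.of_forall fun l => by
      rw [Real.norm_eq_abs, abs_of_nonneg (stepMoment_nonneg _ _ _ _ _)]
      exact stepMoment_le_pow hγ hδ0 k x l)
  set d := fun (j : ℕ) => γ * δ * (-(γ * δ)) ^ j / j.factorial * c j with hd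
  have e1 : ∀ l : ℝ≥0, ∑ j ∈ Finset.range J, rate γ δ x * (-rate γ δ x) ^ j / j.factorial *
      ∫ y in (0 : ℝ)..l, y ^ k * ((l : ℝ) - y) ^ j =
      ∑ j ∈ Finset.range J, d j * powWeight (expansionExp δ j) x * (l : ℝ) ^ (k + j + 1) := by
    intro l
    refine Finset.sum_congr rfl fun j hj => ?_
    rw [hc j hj, ← powWeight_pow, hd, rate]
    simp only
    rw [← neg_mul, mul_pow]
    ring
  have iJ : ∀ j ∈ Finset.range J, Integrable (fun l : ℝ≥0 =>
      d j * powWeight (expansionExp δ j) x * (l : ℝ) ^ (k + j + 1)) φ := fun j hj =>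
    (hmi (by have := Finset.mem_range.1 hj; omega)).const_mul _
  have e2 : ∑ j ∈ Finset.range J, (γ * δ * (-(γ * δ)) ^ j / j.factorial * c j * moment φ (k + j + 1)) *
      powWeight (expansionExp δ j) x =
      ∫ l : ℝ≥0, ∑ j ∈ Finset.range J, d j * powWeight (expansionExp δ j) x * (l : ℝ) ^ (k + j + 1) ∂φ := by
    rw [integral_finsetSum _ iJ]
    refine Finset.sum_congr rfl fun j _ => ?_
    rw [integral_const_mul, moment]
    ring
  rw [e2, ← integral_sub iS (integrable_finsetSum _ iJ)]
  refine (abs_integral_le_integral_abs).trans ?_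
  calc _ ≤ ∫ l : ℝ≥0, C * (1 + (l : ℝ)) ^ p * powWeight ρ x ∂φ := by
        refine integral_mono_of_nonneg (Eventually.of_forall fun _ => abs_nonneg _)
          (((hi le_rfl).const_mul C).mul_const _) (Eventually.of_forall fun l => ?_)
        have := hC x l
        rw [e1] at this
        exact this
    _ = _ := by rw [integral_mul_const, integral_const_mul]

/-- The asymptotic conditional variance of the age. -/
def varianceRate (γ : ℝ) (φ : Measure ℝ≥0) : ℝ := γ * moment φ 3 / (3 * moment φ 1)

/-- The cubic Taylor error is linear in `A` and keeps the weight of exponent `δ`; the quadratic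
errors contain `A²` and have the smaller exponent `δ²`. -/
lemma stepError_le {γ δ C : ℝ} (hC : ∀ x l : ℝ≥0,
    stepMoment γ δ 1 x l ≤ C * (1 + (l : ℝ)) ^ 2 * powWeight δ x) (θ : ℝ) (x l : ℝ≥0) :
    stepError γ δ θ x l ≤ 4 * C * |θ| ^ 3 * ((1 + (l : ℝ)) ^ 4 * powWeight δ x) +
      (6 * |θ| ^ 2 + 2 * |θ| ^ 4) * C ^ 2 * ((1 + (l : ℝ)) ^ 6 * powWeight (δ ^ 2) x) := by
  have hl := NNReal.coe_nonneg l
  have hw := powWeight_pos δ x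
  have hA0 := stepMoment_nonneg γ δ 1 x l
  set A := stepMoment γ δ 1 x l
  have hA2 : A ^ 2 ≤ C ^ 2 * ((1 + (l : ℝ)) ^ 4 * powWeight (δ ^ 2) x) := by
    calc A ^ 2 ≤ (C * (1 + (l : ℝ)) ^ 2 * powWeight δ x) ^ 2 := by gcongr; exact hC x l
      _ = C ^ 2 * ((1 + (l : ℝ)) ^ 4 * powWeight δ x ^ 2) := by ring
      _ ≤ _ := by gcongr; exact powWeight_sq_le δ x
  have h1 : (l : ℝ) ^ 2 * A ≤ C * ((1 + (l : ℝ)) ^ 4 * powWeight δ x) := by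
    calc (l : ℝ) ^ 2 * A ≤ (1 + (l : ℝ)) ^ 2 * (C * (1 + (l : ℝ)) ^ 2 * powWeight δ x) := by
          gcongr
          · linarith
          · exact hC x l
      _ = _ := by ring
  have h2 : A ^ 2 ≤ C ^ 2 * ((1 + (l : ℝ)) ^ 6 * powWeight (δ ^ 2) x) := by
    refine hA2.trans ?_
    have := powWeight_pos (δ ^ 2) x
    gcongr
    · linarith
    · norm_num
  have h3 : ((l : ℝ) * A) ^ 2 ≤ C ^ 2 * ((1 + (l : ℝ)) ^ 6 * powWeight (δ ^ 2) x) := by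
    calc ((l : ℝ) * A) ^ 2 = (l : ℝ) ^ 2 * A ^ 2 := by ring
      _ ≤ (1 + (l : ℝ)) ^ 2 * (C ^ 2 * ((1 + (l : ℝ)) ^ 4 * powWeight (δ ^ 2) x)) := by
          gcongr
          linarith
      _ = _ := by ring
  have e4 : θ ^ 4 = |θ| ^ 4 := by rw [← abs_pow, abs_of_nonneg (by positivity)]
  unfold stepError
  rw [← sq_abs θ, e4]
  calc _ ≤ 4 * |θ| ^ 3 * (C * ((1 + (l : ℝ)) ^ 4 * powWeight δ x)) +
        6 * |θ| ^ 2 * (C ^ 2 * ((1 + (l : ℝ)) ^ 6 * powWeight (δ ^ 2) x)) +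
        2 * |θ| ^ 4 * (C ^ 2 * ((1 + (l : ℝ)) ^ 6 * powWeight (δ ^ 2) x)) := by gcongr
    _ = _ := by ring

/-- The error in the Gaussian approximation of the age at time `t`, given the run lengths. -/
def ageError (γ δ : ℝ) (φ : Measure ℝ≥0) (L : ℕ → Ω → ℝ≥0) (θ : ℝ) (t : ℝ≥0) (n : ℕ) (ω : Ω) : ℝ :=
  if t < relocTime L n ω then
    2 * |θ| * visitSum L t n (straddle t) ω + visitSum L t n (stepError γ δ θ) ω +
    |θ| * |visitSum L t n (stepMoment γ δ 1) ω - centring γ δ φ t| +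
    θ ^ 2 * |visitSum L t n (stepMoment γ δ 2) ω - varianceRate γ φ * (t : ℝ) ^ δ| else 0

set_option maxHeartbeats 1000000 in
/-- Quantitative Gaussian approximation, in mean. -/
lemma exists_integral_ageError_le (hL : IsRunSequence Pr φ L) (hφ : φ {0} = 0)
    {γ δ : ℝ} (hγ : 0 < γ) (hδ0 : 0 < δ) (hδ1 : δ < 1)
    (hmom : Integrable (fun l : ℝ≥0 => (l : ℝ) ^ momentOrder δ) φ) :
    ∃ K ρ : ℝ, ρ < δ / 2 ∧ ∀ (t : ℝ≥0), 0 < t → ∀ (θ : ℝ) (n : ℕ),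
      Integrable (ageError γ δ φ L θ t n) Pr ∧
      ∫ ω, ageError γ δ φ L θ t n ω ∂Pr ≤
      K * (|θ| ^ 1 * (1 + (t : ℝ)) ^ (0 : ℝ) + |θ| ^ 3 * (1 + (t : ℝ)) ^ δ +
        |θ| ^ 2 * (1 + (t : ℝ)) ^ δ ^ 2 +
        |θ| ^ 4 * (1 + (t : ℝ)) ^ δ ^ 2 + |θ| ^ 1 * (1 + (t : ℝ)) ^ ρ) := by
  have hp8 : 8 ≤ momentOrder δ := le_max_left _ _
  have hJp := expansionOrder_add_two_le hδ0 hδ1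
  set p := momentOrder δ with hp
  set J := expansionOrder δ with hJ
  have hi := fun {m : ℕ} (hm : m ≤ p) => integrable_one_add_pow (φ := φ) hmom hm
  have hi8 : Integrable (fun l : ℝ≥0 => (1 + (l : ℝ)) ^ 8) φ := hi hp8
  obtain ⟨C, hC0, hC⟩ := exists_stepMoment_one_le hγ hδ0 hδ1
  have hδ2 : 0 < δ ^ 2 := by positivity
  have hδ21 : δ ^ 2 ≤ 1 := by nlinarith
  have hA : ∀ x l, |stepMoment γ δ 1 x l| ≤ C * (1 + (l : ℝ)) ^ 4 * powWeight δ x := fun x l => by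
    have hl : (0 : ℝ) ≤ l := l.2
    have hw := powWeight_pos δ x
    rw [abs_of_nonneg (stepMoment_nonneg _ _ _ _ _)]
    refine (hC x l).trans ?_
    gcongr
    · linarith
    · norm_num
  have hB : ∀ x l, |stepMoment γ δ 2 x l| ≤ C * (1 + (l : ℝ)) ^ 4 * powWeight δ x := fun x l => by
    have hl : (0 : ℝ) ≤ l := l.2
    have hw := powWeight_pos δ x
    rw [abs_of_nonneg (stepMoment_nonneg _ _ _ _ _)]
    have h1 : stepMoment γ δ 2 x l ≤ (l : ℝ) ^ 1 * stepMoment γ δ 1 x l :=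
      stepMoment_add_le hγ hδ0 1 1 x l
    calc _ ≤ _ := h1
      _ ≤ (1 + (l : ℝ)) ^ 1 * (C * (1 + (l : ℝ)) ^ 2 * powWeight δ x) := by
        gcongr
        · exact stepMoment_nonneg _ _ _ _ _
        · linarith
        · exact hC x l
      _ = C * (1 + (l : ℝ)) ^ 3 * powWeight δ x := by ring
      _ ≤ _ := by
        gcongr
        · linarith
        · norm_num
  -- the mean
  set ρ := max (δ ^ 2 / 2) (max (δ / 4) (expansionExp δ J)) with hρ
  have hρ0 : 0 < ρ := lt_max_of_lt_left (by positivity)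
  have hρδ : ρ < δ / 2 := by
    refine max_lt (by nlinarith) (max_lt (by linarith) (expansionExp_order_lt hδ1))
  have hρ1 : ρ ≤ 1 := by linarith
  obtain ⟨C₁, hC₁⟩ := exists_abs_integral_stepMoment_sub_le (φ := φ) hγ hδ0 hδ1 one_ne_zero (J := J)
    (p := p) hmom (by omega) (by omega) (ρ := ρ) hρ0.le (by
      have h := (le_max_right (δ / 4) (expansionExp δ J)).trans (le_max_right (δ ^ 2 / 2) _)
      rw [← hρ] at h
      unfold expansionExp at h
      linarith) (c := fun j => 1 / (((j : ℝ) + 1) * (j + 2))) (fun j _ l => by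
      rw [integral_mul_sub_pow, mul_one_div]; congr 2; ring)
  obtain ⟨K₁, hK₁0, hK₁⟩ := hL.integral_abs_visitSum_sub_le hφ hi8 hδ0 hδ1
    (measurable_stepMoment γ δ hγ hδ0 1) hA (Finset.range J) (α := expansionExp δ)
    (fun j hj => by linarith [expansionExp_ge hδ0 hδ1 hj]) (fun j _ => expansionExp_le hδ1 j)
    hρ0 hρ1 (le_max_left _ _) hC₁
  -- the variance
  obtain ⟨C₂, hC₂⟩ := exists_abs_integral_stepMoment_sub_le (φ := φ) hγ hδ0 hδ1 two_ne_zero (J := 1)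
    (p := p) hmom (by omega) (by omega) (ρ := δ ^ 2) hδ2.le
    (by push_cast; nlinarith [sq_nonneg (δ - 1)])
    (c := fun _ => 1 / 3)
    (fun j hj l => by
      obtain rfl : j = 0 := by simpa using hj
      simp only [pow_zero, mul_one, integral_pow]
      norm_num
      ring)
  -- One term of the expansion suffices: the variance is needed only up to `o(t^δ)`, and the
  -- remainder has exponent `δ² < δ`.
  obtain ⟨K₂, hK₂0, hK₂⟩ := hL.integral_abs_visitSum_sub_le hφ hi8 hδ0 hδ1
    (measurable_stepMoment γ δ hγ hδ0 2) hB (Finset.range 1) (α := expansionExp δ)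
    (fun j hj => by
      have : j = 0 := by simpa using hj
      subst this; simpa [expansionExp] using hδ0) (fun j _ => expansionExp_le hδ1 j)
    hδ2 hδ21 (by linarith) hC₂
  have hq3 : Integrable (fun l : ℝ≥0 => (l : ℝ) * (2 + l) ^ 2) φ :=
    ((hi (m := 3) (by omega)).const_mul 4).mono' (by fun_prop : Measurable _).aestronglyMeasurable
      (Eventually.of_forall fun l => by
        have := NNReal.coe_nonneg l
        rw [Real.norm_eq_abs, abs_of_nonneg (by positivity)]
        nlinarith [pow_nonneg this 2, pow_nonneg this 3])
  have hi1 : Integrable (fun l : ℝ≥0 => (l : ℝ)) φ :=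
    (hi (m := 1) (by omega)).mono' (by fun_prop : Measurable _).aestronglyMeasurable
      (Eventually.of_forall fun l => by simp)
  set D₀ := (∫ l : ℝ≥0, (l : ℝ) * (2 + l) ^ 2 ∂φ) / truncMean φ with hD₀
  set D₁ := (∫ l : ℝ≥0, (1 + (l : ℝ)) ^ 4 ∂φ) / truncMean φ * (4 / δ) with hD₁
  set D₂ := (∫ l : ℝ≥0, (1 + (l : ℝ)) ^ 6 ∂φ) / truncMean φ * (4 / δ ^ 2) with hD₂
  have htm := truncMean_pos hφ
  have hD₀0 : 0 ≤ D₀ := div_nonneg (integral_nonneg fun l => by positivity) htm.le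
  have hD₁0 : 0 ≤ D₁ := mul_nonneg (div_nonneg (integral_nonneg fun l => by positivity) htm.le)
    (by positivity)
  have hD₂0 : 0 ≤ D₂ := mul_nonneg (div_nonneg (integral_nonneg fun l => by positivity) htm.le)
    (by positivity)
  refine ⟨2 * D₀ + 4 * C * D₁ + (6 * C ^ 2 * D₂ + K₂) + 2 * C ^ 2 * D₂ + K₁, ρ, hρδ,
    fun t ht θ n => ?_⟩
  have ht0 : (0 : ℝ) < t := by exact_mod_cast ht
  have ind : ∀ {F : Ω → ℝ}, Integrable F Pr →
      Integrable (fun ω => if t < relocTime L n ω then F ω else 0) Pr := fun {F} hF => by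
    have := hF.indicator (measurableSet_lt measurable_const (hL.measurable_relocTime n) :
      MeasurableSet {ω | t < relocTime L n ω})
    refine this.congr (Eventually.of_forall fun ω => ?_)
    simp [Set.indicator_apply]
  have iSt : Integrable (visitSum L t n (straddle t)) Pr :=
    hL.integrable_visitSum t n (measurable_straddle t) hi1 (fun x l => by
      rw [abs_of_nonneg (straddle_nonneg t x l)]; unfold straddle; split_ifs <;> simp)
  have w1 : ∀ {β : ℝ}, β ≤ 1 → ∀ (m : ℕ) (x l : ℝ≥0), |(1 + (l : ℝ)) ^ m * powWeight β x| ≤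
      (1 + (l : ℝ)) ^ m := fun {β} hβ m x l => by
    have := (powWeight_pos β x).le
    rw [abs_of_nonneg (by positivity)]
    exact mul_le_of_le_one_right (by positivity) (powWeight_le_one hβ x)
  have iW : ∀ {β : ℝ}, β ≤ 1 → ∀ m ≤ p, Integrable (visitSum L t n
      (fun x l => (1 + (l : ℝ)) ^ m * powWeight β x)) Pr := fun {β} hβ m hm =>
    hL.integrable_visitSum t n (by
      have := measurable_powWeight β
      unfold Function.uncurry; fun_prop) (hi hm) (w1 hβ m)
  have hE := stepError_le hC θ
  have hEv : ∀ ω, visitSum L t n (stepError γ δ θ) ω ≤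
      4 * C * |θ| ^ 3 * visitSum L t n (fun x l => (1 + (l : ℝ)) ^ 4 * powWeight δ x) ω +
      (6 * |θ| ^ 2 + 2 * |θ| ^ 4) * C ^ 2 *
        visitSum L t n (fun x l => (1 + (l : ℝ)) ^ 6 * powWeight (δ ^ 2) x) ω := fun ω => by
    refine (visitSum_mono t n hE ω).trans_eq ?_
    rw [visitSum_add, visitSum_const_mul, visitSum_const_mul]
  have iE' : Integrable (fun ω =>
      4 * C * |θ| ^ 3 * visitSum L t n (fun x l => (1 + (l : ℝ)) ^ 4 * powWeight δ x) ω +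
      (6 * |θ| ^ 2 + 2 * |θ| ^ 4) * C ^ 2 *
        visitSum L t n (fun x l => (1 + (l : ℝ)) ^ 6 * powWeight (δ ^ 2) x) ω) Pr :=
    ((iW hδ1.le 4 (by omega)).const_mul _).add ((iW hδ21 6 (by omega)).const_mul _)
  have iE : Integrable (visitSum L t n (stepError γ δ θ)) Pr :=
    iE'.mono' (hL.measurable_visitSum t n (measurable_stepError hγ hδ0 θ)).aestronglyMeasurable
      (Eventually.of_forall fun ω => by
        rw [Real.norm_eq_abs, abs_of_nonneg (visitSum_nonneg t n (stepError_nonneg γ δ θ) ω)]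
        exact hEv ω)
  have i4 : ∀ {F : ℝ≥0 → ℝ≥0 → ℝ}, Measurable (Function.uncurry F) →
      (∀ x l, |F x l| ≤ C * (1 + (l : ℝ)) ^ 4 * powWeight δ x) →
      Integrable (visitSum L t n F) Pr := fun {F} hF hFC =>
    hL.integrable_visitSum t n hF ((hi (m := 4) (by omega)).const_mul C) fun x l =>
      (hFC x l).trans (mul_le_of_le_one_right (by positivity) (powWeight_le_one hδ1.le x))
  have i1 := i4 (measurable_stepMoment γ δ hγ hδ0 1) hA
  have i2 := i4 (measurable_stepMoment γ δ hγ hδ0 2) hB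
  -- The coefficients agree because `j! (j + 1)(j + 2) = (j + 2)!`.
  have eS : centring γ δ φ t = (moment φ 1)⁻¹ * ∑ j ∈ Finset.range J,
      γ * δ * (-(γ * δ)) ^ j / j.factorial * (1 / (((j : ℝ) + 1) * (j + 2))) *
        moment φ (1 + j + 1) * ((t : ℝ) ^ expansionExp δ j / expansionExp δ j) := by
    rw [centring_eq ht0]
    congr 1
    refine Finset.sum_congr rfl fun j _ => ?_
    congr 1
    have : 1 + j + 1 = j + 2 := by ring
    rw [this, expansionCoef, Nat.factorial_succ, Nat.factorial_succ]
    push_cast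
    field_simp
    ring
  have eV : varianceRate γ φ * (t : ℝ) ^ δ = (moment φ 1)⁻¹ * ∑ j ∈ Finset.range 1,
      γ * δ * (-(γ * δ)) ^ j / j.factorial * (1 / 3) *
        moment φ (2 + j + 1) * ((t : ℝ) ^ expansionExp δ j / expansionExp δ j) := by
    simp only [Finset.sum_range_one, expansionExp, varianceRate]
    simp
    field_simp
  have k1 := hK₁ t n
  have k2 := hK₂ t n
  rw [← eS] at k1
  rw [← eV] at k2
  set F₀ := fun ω => 2 * |θ| * visitSum L t n (straddle t) ω
  set F₁ := fun ω => visitSum L t n (stepError γ δ θ) ω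
  set F₂ := fun ω => if t < relocTime L n ω then
    |visitSum L t n (stepMoment γ δ 1) ω - centring γ δ φ t| else 0
  set F₃ := fun ω => if t < relocTime L n ω then
    |visitSum L t n (stepMoment γ δ 2) ω - varianceRate γ φ * (t : ℝ) ^ δ| else 0
  have j0 : Integrable F₀ Pr := iSt.const_mul _
  have j1 : Integrable F₁ Pr := iE
  have j2 : Integrable (fun ω => |θ| * F₂ ω) Pr :=
    (ind (i1.sub (integrable_const _)).abs).const_mul _
  have j3 : Integrable (fun ω => θ ^ 2 * F₃ ω) Pr :=
    (ind (i2.sub (integrable_const _)).abs).const_mul _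
  have iAE : Integrable (ageError γ δ φ L θ t n) Pr :=
    ind (((j0.add j1).add ((i1.sub (integrable_const _)).abs.const_mul _)).add
      ((i2.sub (integrable_const _)).abs.const_mul _))
  have j01 : Integrable (fun ω => F₀ ω + F₁ ω) Pr := j0.add j1
  have j012 : Integrable (fun ω => F₀ ω + F₁ ω + |θ| * F₂ ω) Pr := j01.add j2
  have j0123 : Integrable (fun ω => F₀ ω + F₁ ω + |θ| * F₂ ω + θ ^ 2 * F₃ ω) Pr := j012.add j3
  refine ⟨iAE, ?_⟩
  have l0 : ∫ ω, F₀ ω ∂Pr ≤ 2 * |θ| * D₀ := by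
    rw [integral_const_mul]
    gcongr
    exact hL.integral_visitSum_straddle_le hφ hq3 t n
  have l1 : ∫ ω, F₁ ω ∂Pr ≤ 4 * C * |θ| ^ 3 * (D₁ * (1 + (t : ℝ)) ^ δ) +
      (6 * |θ| ^ 2 + 2 * |θ| ^ 4) * C ^ 2 * (D₂ * (1 + (t : ℝ)) ^ δ ^ 2) := by
    refine (integral_mono iE iE' hEv).trans ?_
    rw [integral_add ((iW hδ1.le 4 (by omega)).const_mul _) ((iW hδ21 6 (by omega)).const_mul _),
      integral_const_mul, integral_const_mul]
    gcongr
    · exact hL.integral_visitSum_powWeight_le hφ hδ0 hδ1.le (hi (by omega)) (by fun_prop)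
        (fun l => by positivity) t n
    · exact hL.integral_visitSum_powWeight_le hφ hδ2 hδ21 (hi (by omega)) (by fun_prop)
        (fun l => by positivity) t n
  have hle : ∫ ω, ageError γ δ φ L θ t n ω ∂Pr ≤
      ∫ ω, F₀ ω + F₁ ω + |θ| * F₂ ω + θ ^ 2 * F₃ ω ∂Pr := by
    refine integral_mono iAE j0123 fun ω => ?_
    have p0 : 0 ≤ F₀ ω := mul_nonneg (by positivity) (visitSum_nonneg t n (straddle_nonneg t) ω)
    have p1 : 0 ≤ F₁ ω := visitSum_nonneg t n (stepError_nonneg γ δ θ) ω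
    simp only [ageError, F₂, F₃]
    split_ifs
    · exact le_rfl
    · simp only [mul_zero, add_zero]
      exact add_nonneg p0 p1
  rw [integral_add j012 j3, integral_add j01 j2, integral_add j0 j1, integral_const_mul |θ| F₂,
    integral_const_mul (θ ^ 2) F₃] at hle
  have q1 : |θ| * ∫ ω, F₂ ω ∂Pr ≤ |θ| * (K₁ * (1 + (t : ℝ)) ^ ρ) := by gcongr
  have q2 : θ ^ 2 * ∫ ω, F₃ ω ∂Pr ≤ |θ| ^ 2 * (K₂ * (1 + (t : ℝ)) ^ δ ^ 2) := by
    rw [sq_abs]; gcongr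
  rw [Real.rpow_zero]
  set u₁ := (1 + (t : ℝ)) ^ δ
  set u₂ := (1 + (t : ℝ)) ^ δ ^ 2
  set u₃ := (1 + (t : ℝ)) ^ ρ
  have p₁ : 0 ≤ u₁ := by positivity
  have p₂ : 0 ≤ u₂ := by positivity
  have p₃ : 0 ≤ u₃ := by positivity
  calc _ ≤ 2 * D₀ * (|θ| ^ 1 * 1) + 4 * C * D₁ * (|θ| ^ 3 * u₁) +
        (6 * C ^ 2 * D₂ + K₂) * (|θ| ^ 2 * u₂) + 2 * C ^ 2 * D₂ * (|θ| ^ 4 * u₂) +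
        K₁ * (|θ| ^ 1 * u₃) := by
        refine (hle.trans (add_le_add (add_le_add (add_le_add l0 l1) q1) q2)).trans_eq ?_
        ring
    _ ≤ _ := by
        have y₀ : 0 ≤ |θ| ^ 1 * 1 := by positivity
        have y₁ : 0 ≤ |θ| ^ 3 * u₁ := by positivity
        have y₂ : 0 ≤ |θ| ^ 2 * u₂ := by positivity
        have y₃ : 0 ≤ |θ| ^ 4 * u₂ := by positivity
        have y₄ : 0 ≤ |θ| ^ 1 * u₃ := by positivity
        set Y := |θ| ^ 1 * 1 + |θ| ^ 3 * u₁ + |θ| ^ 2 * u₂ + |θ| ^ 4 * u₂ + |θ| ^ 1 * u₃ with hY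
        calc _ ≤ 2 * D₀ * Y + 4 * C * D₁ * Y + (6 * C ^ 2 * D₂ + K₂) * Y + 2 * C ^ 2 * D₂ * Y +
              K₁ * Y := by
              refine add_le_add (add_le_add (add_le_add (add_le_add ?_ ?_) ?_) ?_) ?_ <;>
                refine mul_le_mul_of_nonneg_left ?_ (by positivity) <;> linarith
          _ = _ := by ring

end

/-! ### The age of the walk given the run lengths -/

/-- The partial sums of a sequence of run lengths. -/
def partialTime (ℓ : ℕ → ℝ≥0) (n : ℕ) : ℝ≥0 := ∑ i ∈ Finset.range n, ℓ i

lemma partialTime_zero (ℓ : ℕ → ℝ≥0) : partialTime ℓ 0 = 0 := by simp [partialTime]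

lemma partialTime_succ (ℓ : ℕ → ℝ≥0) (n : ℕ) :
    partialTime ℓ (n + 1) = partialTime ℓ n + ℓ n := by
  simp [partialTime, Finset.sum_range_succ]

lemma partialTime_mono (ℓ : ℕ → ℝ≥0) : Monotone (partialTime ℓ) :=
  monotone_nat_of_le_succ fun n => by rw [partialTime_succ]; exact le_self_add

@[fun_prop]
lemma measurable_partialTime (n : ℕ) : Measurable fun ℓ : ℕ → ℝ≥0 => partialTime ℓ n := by
  unfold partialTime; fun_prop

/-- The index of the run that is under way at time `t`. -/
def runIndex (ℓ : ℕ → ℝ≥0) (t : ℝ≥0) : ℕ := sInf {n | t < partialTime ℓ (n + 1)}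

lemma partialTime_runIndex {ℓ : ℕ → ℝ≥0} {t : ℝ≥0} {n : ℕ} (h : t < partialTime ℓ n) :
    partialTime ℓ (runIndex ℓ t) ≤ t ∧ t < partialTime ℓ (runIndex ℓ t + 1) := by
  have hne : {n | t < partialTime ℓ (n + 1)}.Nonempty := by
    obtain _ | m := n
    · simp [partialTime_zero] at h
    · exact ⟨m, h⟩
  refine ⟨?_, Nat.sInf_mem hne⟩
  by_contra hcon
  rw [not_le] at hcon
  obtain h0 | ⟨m, hm⟩ := (runIndex ℓ t).eq_zero_or_eq_succ_pred.imp_right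
    fun h => (⟨_, h⟩ : ∃ m, runIndex ℓ t = m + 1)
  · rw [h0, partialTime_zero] at hcon
    exact absurd hcon (not_lt.2 zero_le)
  · rw [hm] at hcon
    have : runIndex ℓ t ≤ m := Nat.sInf_le hcon
    omega

lemma runIndex_eq {ℓ : ℕ → ℝ≥0} {t : ℝ≥0} {n : ℕ} (h1 : partialTime ℓ n ≤ t)
    (h2 : t < partialTime ℓ (n + 1)) : runIndex ℓ t = n := by
  obtain ⟨h3, h4⟩ := partialTime_runIndex h2
  refine le_antisymm (Nat.sInf_le h2) ?_
  by_contra hcon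
  rw [not_le] at hcon
  exact absurd (h4.trans_le (partialTime_mono ℓ hcon)) (not_lt.2 h1)

lemma measurable_runIndex : Measurable fun p : (ℕ → ℝ≥0) × ℝ≥0 => runIndex p.1 p.2 := by
  have hm : ∀ n, MeasurableSet {p : (ℕ → ℝ≥0) × ℝ≥0 | p.2 < partialTime p.1 (n + 1)} := fun n =>
    measurableSet_lt measurable_snd ((measurable_partialTime _).comp measurable_fst)
  refine measurable_to_countable' fun k => ?_
  -- The second set of the union accounts for `sInf ∅ = 0`, when the total run length does not
  -- exceed the time.
  have e : (fun p : (ℕ → ℝ≥0) × ℝ≥0 => runIndex p.1 p.2) ⁻¹' {k} =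
      ({p | p.2 < partialTime p.1 (k + 1)} ∩ ⋂ m : Fin k, {p | p.2 < partialTime p.1 (m + 1)}ᶜ) ∪
      ({_p | k = 0} ∩ ⋂ m : ℕ, {p | p.2 < partialTime p.1 (m + 1)}ᶜ) := by
    ext p
    simp only [Set.mem_preimage, Set.mem_singleton_iff, Set.mem_union, Set.mem_inter_iff,
      Set.mem_ofPred_eq, Set.mem_iInter, Set.mem_compl_iff, runIndex]
    by_cases hne : {n | p.2 < partialTime p.1 (n + 1)}.Nonempty
    · constructor
      · rintro rfl
        refine Or.inl ⟨Nat.sInf_mem hne, fun m hm => ?_⟩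
        exact absurd (Nat.sInf_le hm) (not_le.2 m.2)
      · rintro (⟨h1, h2⟩ | ⟨-, h2⟩)
        · refine le_antisymm (Nat.sInf_le h1) ?_
          by_contra hcon
          exact h2 ⟨_, not_le.1 hcon⟩ (Nat.sInf_mem hne)
        · obtain ⟨m, hm⟩ := hne
          exact absurd hm (h2 m)
    · have hall : ∀ m, ¬ p.2 < partialTime p.1 (m + 1) := fun m hm => hne ⟨m, hm⟩
      rw [Set.not_nonempty_iff_eq_empty.1 hne, Nat.sInf_empty]
      constructor
      · exact fun h => Or.inr ⟨h.symm, hall⟩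
      · rintro (⟨h1, -⟩ | ⟨h1, -⟩)
        · exact absurd h1 (hall k)
        · exact h1.symm
  rw [e]
  exact ((hm k).inter (MeasurableSet.iInter fun m : Fin k => (hm m).compl)).union
    ((MeasurableSet.const _).inter (MeasurableSet.iInter fun m => (hm m).compl))

/-- The law of the age of the starting point of run `n`, given the run lengths. -/
def depthLaw (γ δ : ℝ) : ℕ → (ℕ → ℝ≥0) → Measure ℝ≥0
  | 0, _ => Measure.dirac 0
  | n + 1, ℓ => (depthLaw γ δ n ℓ).conv (stepLaw γ δ (partialTime ℓ n) (ℓ n))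

lemma isProbabilityMeasure_depthLaw {γ δ : ℝ} (hγ : 0 < γ) (hδ0 : 0 < δ) (n : ℕ) (ℓ : ℕ → ℝ≥0) :
    IsProbabilityMeasure (depthLaw γ δ n ℓ) := by
  induction n with
  | zero => rw [depthLaw]; infer_instance
  | succ n ih =>
    have := isProbabilityMeasure_stepLaw hγ hδ0 (partialTime ℓ n) (ℓ n)
    rw [depthLaw]
    infer_instance

lemma measurable_depthLaw {γ δ : ℝ} (hγ : 0 < γ) (hδ0 : 0 < δ) (n : ℕ) :
    Measurable (depthLaw γ δ n) := by
  induction n with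
  | zero => exact measurable_const
  | succ n ih =>
    let κ : Kernel (ℕ → ℝ≥0) ℝ≥0 := ⟨depthLaw γ δ n, ih⟩
    let η : Kernel (ℕ → ℝ≥0) ℝ≥0 := ⟨fun ℓ => stepLaw γ δ (partialTime ℓ n) (ℓ n),
      (measurable_stepLaw γ δ).comp ((measurable_partialTime n).prodMk (measurable_pi_apply n))⟩
    have : IsMarkovKernel κ := ⟨isProbabilityMeasure_depthLaw hγ hδ0 n⟩
    have : IsMarkovKernel η := ⟨fun ℓ => isProbabilityMeasure_stepLaw hγ hδ0 _ _⟩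
    have e : depthLaw γ δ (n + 1) = ((κ ×ₖ η).map fun p => p.1 + p.2) := by
      funext ℓ
      rw [Kernel.map_apply _ (by fun_prop), Kernel.prod_apply]
      rfl
    rw [e]
    exact Kernel.measurable _

lemma integrable_exp_I_mul {μ : Measure ℝ≥0} [IsFiniteMeasure μ] (θ : ℝ) :
    Integrable (fun y : ℝ≥0 => Complex.exp (Complex.I * ((θ * y : ℝ) : ℂ))) μ :=
  Integrable.of_bound (by fun_prop : Measurable _).aestronglyMeasurable 1
    (Eventually.of_forall fun y => (norm_exp_I_mul _).le)

lemma integral_exp_depthLaw {γ δ : ℝ} (hγ : 0 < γ) (hδ0 : 0 < δ) (θ : ℝ) (n : ℕ) (ℓ : ℕ → ℝ≥0) :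
    ∫ y : ℝ≥0, Complex.exp (Complex.I * ((θ * y : ℝ) : ℂ)) ∂(depthLaw γ δ n ℓ) =
      ∏ k ∈ Finset.range n, stepChar γ δ θ (partialTime ℓ k) (ℓ k) := by
  induction n with
  | zero => simp [depthLaw]
  | succ n ih =>
    have := isProbabilityMeasure_depthLaw hγ hδ0 n ℓ
    have := isProbabilityMeasure_stepLaw hγ hδ0 (partialTime ℓ n) (ℓ n)
    rw [depthLaw, Measure.conv, integral_map (by fun_prop)
      (by fun_prop : Measurable _).aestronglyMeasurable, Finset.prod_range_succ, ← ih, stepChar,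
      ← integral_prod_mul]
    refine integral_congr_ae (Eventually.of_forall fun p => ?_)
    simp only
    rw [← Complex.exp_add]
    congr 1
    push_cast
    ring

/-- The law of the age of the walk at time `t`, given the run lengths. -/
def ageLaw (γ δ : ℝ) (t : ℝ≥0) (ℓ : ℕ → ℝ≥0) : Measure ℝ≥0 :=
  (depthLaw γ δ (runIndex ℓ t) ℓ).map (· + (t - partialTime ℓ (runIndex ℓ t)))

lemma isProbabilityMeasure_ageLaw {γ δ : ℝ} (hγ : 0 < γ) (hδ0 : 0 < δ) (t : ℝ≥0) (ℓ : ℕ → ℝ≥0) :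
    IsProbabilityMeasure (ageLaw γ δ t ℓ) := by
  have := isProbabilityMeasure_depthLaw hγ hδ0 (runIndex ℓ t) ℓ
  exact Measure.isProbabilityMeasure_map (by fun_prop)

lemma measurable_map_depthLaw {γ δ : ℝ} (hγ : 0 < γ) (hδ0 : 0 < δ) (t : ℝ≥0) (n : ℕ) :
    Measurable fun ℓ => (depthLaw γ δ n ℓ).map (· + (t - partialTime ℓ n)) := by
  let κ : Kernel (ℕ → ℝ≥0) ℝ≥0 := ⟨depthLaw γ δ n, measurable_depthLaw hγ hδ0 n⟩
  have : IsMarkovKernel κ := ⟨isProbabilityMeasure_depthLaw hγ hδ0 n⟩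
  refine Measure.measurable_of_measurable_coe _ fun B hB => ?_
  have hm : Measurable fun p : (ℕ → ℝ≥0) × ℝ≥0 => p.2 + (t - partialTime p.1 n) := by fun_prop
  have h := Kernel.measurable_kernel_prodMk_left (κ := κ) (hm hB)
  have e : (fun ℓ => (depthLaw γ δ n ℓ).map (· + (t - partialTime ℓ n)) B) = fun ℓ =>
      κ ℓ (Prod.mk ℓ ⁻¹' ((fun p : (ℕ → ℝ≥0) × ℝ≥0 => p.2 + (t - partialTime p.1 n)) ⁻¹' B)) := by
    funext ℓ
    rw [Measure.map_apply (by fun_prop) hB]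
    rfl
  rw [e]
  exact h

lemma measurable_ageLaw {γ δ : ℝ} (hγ : 0 < γ) (hδ0 : 0 < δ) (t : ℝ≥0) :
    Measurable (ageLaw γ δ t) := by
  have h : Measurable (Function.uncurry fun (n : ℕ) (ℓ : ℕ → ℝ≥0) =>
      (depthLaw γ δ n ℓ).map (· + (t - partialTime ℓ n))) :=
    measurable_from_prod_countable_right (measurable_map_depthLaw hγ hδ0 t)
  have hr : Measurable fun ℓ : ℕ → ℝ≥0 => (runIndex ℓ t, ℓ) :=
    (measurable_runIndex.comp (measurable_id.prodMk measurable_const)).prodMk measurable_id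
  have := h.comp hr
  unfold ageLaw
  exact this

/-- The characteristic function of the age at time `t`, given the run lengths. -/
def ageChar (γ δ θ : ℝ) (t : ℝ≥0) (ℓ : ℕ → ℝ≥0) : ℂ :=
  ∫ y : ℝ≥0, Complex.exp (Complex.I * ((θ * y : ℝ) : ℂ)) ∂(ageLaw γ δ t ℓ)

lemma ageChar_eq {γ δ : ℝ} (hγ : 0 < γ) (hδ0 : 0 < δ) (θ : ℝ) (t : ℝ≥0) (ℓ : ℕ → ℝ≥0) :
    ageChar γ δ θ t ℓ =
      Complex.exp (Complex.I * ((θ * ((t - partialTime ℓ (runIndex ℓ t) : ℝ≥0) : ℝ) : ℝ) : ℂ)) *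
      ∏ k ∈ Finset.range (runIndex ℓ t), stepChar γ δ θ (partialTime ℓ k) (ℓ k) := by
  rw [ageChar, ageLaw, integral_map (by fun_prop) (by fun_prop : Measurable _).aestronglyMeasurable,
    ← integral_exp_depthLaw hγ hδ0, ← integral_const_mul]
  refine integral_congr_ae (Eventually.of_forall fun y => ?_)
  simp only
  rw [← Complex.exp_add]
  congr 1
  push_cast
  ring

lemma norm_ageChar_le_one {γ δ : ℝ} (hγ : 0 < γ) (hδ0 : 0 < δ) (θ : ℝ) (t : ℝ≥0) (ℓ : ℕ → ℝ≥0) :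
    ‖ageChar γ δ θ t ℓ‖ ≤ 1 := by
  have := isProbabilityMeasure_ageLaw hγ hδ0 t ℓ
  refine (norm_integral_le_integral_norm _).trans ?_
  simp_rw [norm_exp_I_mul]
  simp

lemma measurable_ageChar {γ δ : ℝ} (hγ : 0 < γ) (hδ0 : 0 < δ) (θ : ℝ) (t : ℝ≥0) :
    Measurable (ageChar γ δ θ t) := by
  let κ : Kernel (ℕ → ℝ≥0) ℝ≥0 := ⟨ageLaw γ δ t, measurable_ageLaw hγ hδ0 t⟩
  have : IsMarkovKernel κ := ⟨isProbabilityMeasure_ageLaw hγ hδ0 t⟩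
  have h : StronglyMeasurable fun ℓ => ∫ y : ℝ≥0, Complex.exp (Complex.I * ((θ * y : ℝ) : ℂ)) ∂(κ ℓ) :=
    StronglyMeasurable.integral_kernel
      (by fun_prop : Measurable fun y : ℝ≥0 => Complex.exp (Complex.I * ((θ * y : ℝ) : ℂ))).stronglyMeasurable
  exact h.measurable

/-! ### The age averaged over the run lengths -/

section

variable {Ω : Type*} [MeasurableSpace Ω] {Pr : Measure Ω} {φ : Measure ℝ≥0} {L : ℕ → Ω → ℝ≥0}

/-- The law of the age of the walk at time `t`. -/
def meanAgeLaw (γ δ : ℝ) (Pr : Measure Ω) (L : ℕ → Ω → ℝ≥0) (t : ℝ≥0) : Measure ℝ≥0 :=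
  Pr.bind fun ω => ageLaw γ δ t fun i => L i ω

lemma IsRunSequence.measurable_path (hL : IsRunSequence Pr φ L) :
    Measurable fun ω i => L i ω := measurable_pi_lambda _ hL.measurable

variable [IsProbabilityMeasure Pr]

lemma IsRunSequence.isProbabilityMeasure_meanAgeLaw (hL : IsRunSequence Pr φ L) {γ δ : ℝ}
    (hγ : 0 < γ) (hδ0 : 0 < δ) (t : ℝ≥0) : IsProbabilityMeasure (meanAgeLaw γ δ Pr L t) :=
  isProbabilityMeasure_bind ((measurable_ageLaw hγ hδ0 t).comp hL.measurable_path).aemeasurable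
    (Eventually.of_forall fun _ => isProbabilityMeasure_ageLaw hγ hδ0 t _)

lemma IsRunSequence.integral_meanAgeLaw (hL : IsRunSequence Pr φ L) {γ δ : ℝ}
    (hγ : 0 < γ) (hδ0 : 0 < δ) (t : ℝ≥0) (θ : ℝ) :
    ∫ y : ℝ≥0, Complex.exp (Complex.I * ((θ * y : ℝ) : ℂ)) ∂(meanAgeLaw γ δ Pr L t) =
      ∫ ω, ageChar γ δ θ t (fun i => L i ω) ∂Pr := by
  let κ : Kernel Ω ℝ≥0 := ⟨fun ω => ageLaw γ δ t fun i => L i ω,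
    (measurable_ageLaw hγ hδ0 t).comp hL.measurable_path⟩
  have := hL.isProbabilityMeasure_meanAgeLaw hγ hδ0 t
  have e : (κ ∘ₖ Kernel.const Unit Pr) () = meanAgeLaw γ δ Pr L t := by
    rw [Kernel.comp_apply, Kernel.const_apply]; rfl
  rw [← e] at this ⊢
  rw [Kernel.integral_comp (integrable_exp_I_mul θ), Kernel.const_apply]
  rfl

lemma varianceRate_nonneg {γ : ℝ} (hγ : 0 < γ) : 0 ≤ varianceRate γ φ := by
  have h : ∀ k, 0 ≤ moment φ k := fun k => integral_nonneg fun l => by positivity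
  have := h 1
  have := h 3
  unfold varianceRate
  positivity

variable [IsProbabilityMeasure φ]

/-- Quantitative Gaussian approximation of the characteristic function of the age. -/
lemma IsRunSequence.exists_norm_integral_exp_meanAgeLaw_sub_le (hL : IsRunSequence Pr φ L)
    (hφ : φ {0} = 0) {γ δ : ℝ} (hγ : 0 < γ) (hδ0 : 0 < δ) (hδ1 : δ < 1)
    (hmom : Integrable (fun l : ℝ≥0 => (l : ℝ) ^ momentOrder δ) φ) :
    ∃ K ρ : ℝ, ρ < δ / 2 ∧ ∀ (t : ℝ≥0), 0 < t → ∀ (θ : ℝ),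
      ‖∫ y : ℝ≥0, Complex.exp (Complex.I * ((θ * y : ℝ) : ℂ)) ∂(meanAgeLaw γ δ Pr L t) -
        Complex.exp (Complex.I * ((θ * centring γ δ φ t : ℝ) : ℂ) -
          ((θ ^ 2 * (varianceRate γ φ * (t : ℝ) ^ δ) / 2 : ℝ) : ℂ))‖ ≤
      K * (|θ| ^ 1 * (1 + (t : ℝ)) ^ (0 : ℝ) + |θ| ^ 3 * (1 + (t : ℝ)) ^ δ +
        |θ| ^ 2 * (1 + (t : ℝ)) ^ δ ^ 2 +
        |θ| ^ 4 * (1 + (t : ℝ)) ^ δ ^ 2 + |θ| ^ 1 * (1 + (t : ℝ)) ^ ρ) := by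
  obtain ⟨K, ρ, hρ, hK⟩ := exists_integral_ageError_le hL hφ hγ hδ0 hδ1 hmom
  refine ⟨K, ρ, hρ, fun t ht θ => ?_⟩
  set b := varianceRate γ φ * (t : ℝ) ^ δ with hb
  have hb0 : 0 ≤ b := mul_nonneg (varianceRate_nonneg hγ) (by positivity)
  set c := Complex.exp (Complex.I * ((θ * centring γ δ φ t : ℝ) : ℂ) -
    ((θ ^ 2 * b / 2 : ℝ) : ℂ)) with hc
  have hc1 : ‖c‖ ≤ 1 := by
    rw [hc, Complex.norm_exp]
    refine Real.exp_le_one_iff.2 ?_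
    rw [Complex.sub_re, Complex.ofReal_re, Complex.mul_re]
    simp only [Complex.I_re, Complex.I_im, Complex.ofReal_im]
    have : 0 ≤ θ ^ 2 * b / 2 := by positivity
    linarith
  have hm : Measurable fun ω => ageChar γ δ θ t fun i => L i ω :=
    (measurable_ageChar hγ hδ0 θ t).comp hL.measurable_path
  have hInt : Integrable (fun ω => ageChar γ δ θ t fun i => L i ω) Pr :=
    Integrable.of_bound hm.aestronglyMeasurable 1
      (Eventually.of_forall fun ω => norm_ageChar_le_one hγ hδ0 θ t _)
  -- Where `T_n` has passed `t` the pathwise estimate applies; elsewhere both quantities have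
  -- modulus at most one.
  have hbd : ∀ n, ‖∫ ω, ageChar γ δ θ t (fun i => L i ω) ∂Pr - c‖ ≤
      ∫ ω, ageError γ δ φ L θ t n ω ∂Pr + 2 * Pr.real {ω | relocTime L n ω ≤ t} := by
    intro n
    have hms : MeasurableSet {ω | relocTime L n ω ≤ t} :=
      measurableSet_le (hL.measurable_relocTime n) measurable_const
    have i2 : Integrable ({ω | relocTime L n ω ≤ t}.indicator fun _ => (2 : ℝ)) Pr :=
      (integrable_const _).indicator hms
    have e : ∫ ω, ageChar γ δ θ t (fun i => L i ω) ∂Pr - c =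
        ∫ ω, (ageChar γ δ θ t (fun i => L i ω) - c) ∂Pr := by
      rw [integral_sub hInt (integrable_const _)]; simp
    have e2 : ∫ ω, {ω | relocTime L n ω ≤ t}.indicator (fun _ => (2 : ℝ)) ω ∂Pr =
        2 * Pr.real {ω | relocTime L n ω ≤ t} := by
      rw [integral_indicator hms, setIntegral_const, smul_eq_mul, mul_comm]
    rw [e, ← e2, ← integral_add (hK t ht θ n).1 i2]
    refine (norm_integral_le_integral_norm _).trans ?_
    refine integral_mono (hInt.sub (integrable_const _)).norm ((hK t ht θ n).1.add i2) fun ω => ?_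
    simp only [ageError, Set.indicator_apply, Set.mem_ofPred_eq]
    by_cases h : t < relocTime L n ω
    · rw [if_pos h, if_neg (not_le.2 h), add_zero, ageChar_eq hγ hδ0]
      obtain ⟨h1, h2⟩ := partialTime_runIndex (ℓ := fun i => L i ω) h
      exact norm_ageChar_sub_le hγ hδ0 θ _ hb0 h1 h2 h
    · rw [if_neg h, if_pos (not_lt.1 h), zero_add]
      refine (norm_sub_le _ _).trans ?_
      have := norm_ageChar_le_one hγ hδ0 θ t fun i => L i ω
      linarith
  rw [hL.integral_meanAgeLaw hγ hδ0 t θ]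
  -- The left side does not involve `n` and the error bound is uniform in `n`, so the truncation is
  -- removed by letting `P(T_n ≤ t) → 0`.
  refine ge_of_tendsto' (x := atTop) (f := fun n : ℕ => K * (|θ| ^ 1 * (1 + (t : ℝ)) ^ (0 : ℝ) +
    |θ| ^ 3 * (1 + (t : ℝ)) ^ δ + |θ| ^ 2 * (1 + (t : ℝ)) ^ δ ^ 2 +
    |θ| ^ 4 * (1 + (t : ℝ)) ^ δ ^ 2 + |θ| ^ 1 * (1 + (t : ℝ)) ^ ρ) +
    2 * Pr.real {ω | relocTime L n ω ≤ t}) ?_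
    fun n => (hbd n).trans (by gcongr; exact (hK t ht θ n).2)
  have := ((hL.tendsto_measureReal_relocTime_le hφ t).const_mul 2).const_add
    (K * (|θ| ^ 1 * (1 + (t : ℝ)) ^ (0 : ℝ) +
    |θ| ^ 3 * (1 + (t : ℝ)) ^ δ + |θ| ^ 2 * (1 + (t : ℝ)) ^ δ ^ 2 +
    |θ| ^ 4 * (1 + (t : ℝ)) ^ δ ^ 2 + |θ| ^ 1 * (1 + (t : ℝ)) ^ ρ))
  simpa using this

lemma integrable_pow_of_momentOrder {δ : ℝ}
    (hmom : Integrable (fun l : ℝ≥0 => (l : ℝ) ^ momentOrder δ) φ) {k : ℕ} (hk : k ≤ 8) :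
    Integrable (fun l : ℝ≥0 => (l : ℝ) ^ k) φ :=
  (integrable_one_add_pow hmom (hk.trans (le_max_left _ _))).mono'
    (by fun_prop : Measurable _).aestronglyMeasurable (Eventually.of_forall fun l => by
      rw [Real.norm_eq_abs, abs_of_nonneg (by positivity)]; gcongr; simp)

lemma centring_rate_pos (hφ : φ {0} = 0) {γ δ : ℝ} (hγ : 0 < γ)
    (hmom : Integrable (fun l : ℝ≥0 => (l : ℝ) ^ momentOrder δ) φ) :
    0 < γ * moment φ 2 / (2 * moment φ 1) := by
  have h1 : 0 < moment φ 1 :=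
    moment_one_pos hφ (by simpa using integrable_pow_of_momentOrder hmom (k := 1) (by norm_num))
  have h2 : 0 < moment φ 2 := moment_two_pos hφ (integrable_pow_of_momentOrder hmom (by norm_num))
  positivity

lemma tendsto_centring_atTop (hφ : φ {0} = 0) {γ δ : ℝ} (hγ : 0 < γ) (hδ0 : 0 < δ) (hδ1 : δ < 1)
    (hmom : Integrable (fun l : ℝ≥0 => (l : ℝ) ^ momentOrder δ) φ) :
    Tendsto (centring γ δ φ) atTop atTop := by
  refine ((tendsto_centring_div hδ0 hδ1).pos_mul_atTop (centring_rate_pos hφ hγ hmom)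
    (tendsto_rpow_atTop hδ0)).congr' ?_
  filter_upwards [eventually_gt_atTop 0] with t ht
  have := Real.rpow_pos_of_pos ht δ
  field_simp

/-- The characteristic function of the normalised age converges to that of a Gaussian. -/
lemma IsRunSequence.tendsto_integral_exp_meanAgeLaw (hL : IsRunSequence Pr φ L)
    (hφ : φ {0} = 0) {γ δ : ℝ} (hγ : 0 < γ) (hδ0 : 0 < δ) (hδ1 : δ < 1)
    (hmom : Integrable (fun l : ℝ≥0 => (l : ℝ) ^ momentOrder δ) φ) (u : ℝ) :
    Tendsto (fun t : ℝ≥0 => ∫ y : ℝ≥0, Complex.exp (Complex.I *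
      ((u * ((y - centring γ δ φ t) / √(centring γ δ φ t)) : ℝ) : ℂ)) ∂(meanAgeLaw γ δ Pr L t)) atTop
      (𝓝 (Complex.exp (-((u ^ 2 * (2 * moment φ 3 / (3 * moment φ 2)) / 2 : ℝ) : ℂ)))) := by
  obtain ⟨K, ρ, hρ, hK⟩ :=
    hL.exists_norm_integral_exp_meanAgeLaw_sub_le (Pr := Pr) hφ hγ hδ0 hδ1 hmom
  have h1 : 0 < moment φ 1 :=
    moment_one_pos hφ (by simpa using integrable_pow_of_momentOrder hmom (k := 1) (by norm_num))
  have h2 : 0 < moment φ 2 := moment_two_pos hφ (integrable_pow_of_momentOrder hmom (by norm_num))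
  have hc := centring_rate_pos hφ hγ hmom
  have hdiv := tendsto_centring_div (γ := γ) (φ := φ) hδ0 hδ1
  have hcoe : Tendsto (fun t : ℝ≥0 => (t : ℝ)) atTop atTop := NNReal.tendsto_coe_atTop.2 tendsto_id
  set s := centring γ δ φ with hs
  set b := fun t : ℝ => varianceRate γ φ * t ^ δ with hb
  have hspos : ∀ᶠ t : ℝ≥0 in atTop, 0 < s t :=
    hcoe.eventually ((tendsto_centring_atTop hφ hγ hδ0 hδ1 hmom).eventually_gt_atTop 0)
  -- The limiting variance is the ratio of the leading coefficients of the conditional variance and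
  -- of the centring; `γ` and `E[L]` cancel.
  have hvar : Tendsto (fun t : ℝ => (u / √(s t)) ^ 2 * b t / 2) atTop
      (𝓝 (u ^ 2 * (2 * moment φ 3 / (3 * moment φ 2)) / 2)) := by
    have h := ((hdiv.inv₀ hc.ne').const_mul (u ^ 2 * varianceRate γ φ)).div_const 2
    have e : u ^ 2 * varianceRate γ φ * (γ * moment φ 2 / (2 * moment φ 1))⁻¹ / 2 =
        u ^ 2 * (2 * moment φ 3 / (3 * moment φ 2)) / 2 := by
      unfold varianceRate; field_simp
    rw [e] at h
    refine h.congr' ?_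
    filter_upwards [eventually_gt_atTop 0,
      (tendsto_centring_atTop hφ hγ hδ0 hδ1 hmom).eventually_gt_atTop 0] with t ht hst
    rw [div_pow, Real.sq_sqrt hst.le, inv_div]
    simp only [hb, hs] at hst ⊢
    field_simp
  have herr : Tendsto (fun t : ℝ => K * (|u / √(s t)| ^ 1 * (1 + t) ^ (0 : ℝ) +
      |u / √(s t)| ^ 3 * (1 + t) ^ δ + |u / √(s t)| ^ 2 * (1 + t) ^ δ ^ 2 +
      |u / √(s t)| ^ 4 * (1 + t) ^ δ ^ 2 + |u / √(s t)| ^ 1 * (1 + t) ^ ρ)) atTop (𝓝 0) := by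
    -- With `θ` of order `t^(-δ/2)`, the five errors vanish because `0 < δ / 2`, `δ < 3δ / 2`, `δ² <
    -- δ`, `δ² < 2δ` and `ρ < δ / 2`.
    have hd2 : δ ^ 2 < δ := by nlinarith
    have a1 := tendsto_inv_sqrt_pow_mul (a := 1) (ρ := 0) hc hdiv u 1 (by push_cast; linarith)
    have a2 := tendsto_inv_sqrt_pow_mul (a := 1) (ρ := δ) hc hdiv u 3 (by push_cast; linarith)
    have a3 := tendsto_inv_sqrt_pow_mul (a := 1) (ρ := δ ^ 2) hc hdiv u 2 (by push_cast; linarith)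
    have a4 := tendsto_inv_sqrt_pow_mul (a := 1) (ρ := δ ^ 2) hc hdiv u 4 (by push_cast; linarith)
    have a5 := tendsto_inv_sqrt_pow_mul (a := 1) (ρ := ρ) hc hdiv u 1 (by push_cast; linarith)
    simpa using ((((a1.add a2).add a3).add a4).add a5).const_mul K
  have hlim : Tendsto (fun t : ℝ≥0 => Complex.exp (-(((u / √(s t)) ^ 2 * b t / 2 : ℝ) : ℂ))) atTop
      (𝓝 (Complex.exp (-((u ^ 2 * (2 * moment φ 3 / (3 * moment φ 2)) / 2 : ℝ) : ℂ)))) := by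
    have hcont : Continuous fun x : ℝ => Complex.exp (-(x : ℂ)) := by fun_prop
    exact (hcont.tendsto _).comp (hvar.comp hcoe)
  refine tendsto_of_tendsto_of_dist hlim ?_
  refine squeeze_zero' (Eventually.of_forall fun _ => dist_nonneg) ?_ (herr.comp hcoe)
  filter_upwards [hspos, eventually_gt_atTop 0] with t hst ht
  have hKt := hK t ht (u / √(s t))
  rw [dist_comm, dist_eq_norm]
  refine le_trans (le_of_eq ?_) hKt
  have e1 : ∀ y : ℝ≥0, Complex.exp (Complex.I * ((u * ((y - s t) / √(s t)) : ℝ) : ℂ)) =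
      Complex.exp (Complex.I * ((-(u / √(s t) * s t) : ℝ) : ℂ)) *
        Complex.exp (Complex.I * ((u / √(s t) * y : ℝ) : ℂ)) := by
    intro y
    rw [← Complex.exp_add, ← mul_add, ← Complex.ofReal_add]
    congr 3
    ring
  simp_rw [e1]
  rw [integral_const_mul]
  have e2 : Complex.exp (-(((u / √(s t)) ^ 2 * b t / 2 : ℝ) : ℂ)) =
      Complex.exp (Complex.I * ((-(u / √(s t) * s t) : ℝ) : ℂ)) *
      Complex.exp (Complex.I * ((u / √(s t) * s t : ℝ) : ℂ) -
        (((u / √(s t)) ^ 2 * b t / 2 : ℝ) : ℂ)) := by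
    rw [← Complex.exp_add]
    congr 1
    push_cast
    ring
  rw [e2, ← mul_sub, norm_mul, norm_exp_I_mul, one_mul]

end

/-! ### Conditional laws -/

/-- Integration against a conditional law that is a kernel of a measurable observable. -/
lemma HasCondLaw.lintegral_comp {Ω S T : Type*} {m : MeasurableSpace Ω} [mΩ : MeasurableSpace Ω] [MeasurableSpace S]
    [MeasurableSpace T] {Pr : Measure Ω} [IsFiniteMeasure Pr] (hm : m ≤ mΩ)
    {Y : Ω → S} (hY : Measurable Y) {κ' : Ω → Measure S} (h : HasCondLaw Pr m Y κ') {V : Ω → T}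
    (hV : Measurable[m] V) (κ : Kernel T S) [IsFiniteKernel κ] (hκ : ∀ᵐ ω ∂Pr, κ' ω = κ (V ω))
    {G : T → S → ℝ≥0∞} (hG : Measurable (Function.uncurry G)) :
    ∫⁻ ω, G (V ω) (Y ω) ∂Pr = ∫⁻ ω, ∫⁻ y, G (V ω) y ∂(κ (V ω)) ∂Pr := by
  have hV' : Measurable V := hV.mono hm le_rfl
  -- The defining property of a conditional law, tested on rectangles, identifies the joint law of
  -- observable and value.
  have e : Pr.map (fun ω => (V ω, Y ω)) = (Pr.map V) ⊗ₘ κ := by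
    refine Measure.ext_prod fun {A B} hA hB => ?_
    rw [Measure.map_apply (hV'.prodMk hY) (hA.prod hB), Measure.compProd_apply_prod hA hB,
      setLIntegral_map hA (κ.measurable_coe hB) hV']
    have := h (V ⁻¹' A) (hV hA) B hB
    rw [show (fun ω => (V ω, Y ω)) ⁻¹' (A ×ˢ B) = V ⁻¹' A ∩ Y ⁻¹' B from rfl, this]
    refine lintegral_congr_ae (ae_restrict_of_ae ?_)
    filter_upwards [hκ] with ω hω
    rw [hω]
  have h1 : ∫⁻ ω, G (V ω) (Y ω) ∂Pr = ∫⁻ p, Function.uncurry G p ∂(Pr.map fun ω => (V ω, Y ω)) := by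
    rw [lintegral_map hG (hV'.prodMk hY)]; rfl
  rw [h1, e, Measure.lintegral_compProd hG, lintegral_map hG.lintegral_kernel_prod_right' hV']
  rfl

/-! ### Evolution of functions under the Markov process -/

section

variable {E W : Type*} [MeasurableSpace E] [MeasurableSpace W] {P : MarkovSemigroup E}

/-- The expectation of `H (Z s)` for the process started at `z`. -/
def evo (M : MarkovProcess P W) (H : E → ℝ≥0∞) (s : ℝ≥0) (z : E) : ℝ≥0∞ :=
  ∫⁻ w, H (M.Z s w) ∂(M.law z)

variable {M : MarkovProcess P W}

lemma MarkovProcess.measurable_Z_apply (M : MarkovProcess P W) (s : ℝ≥0) : Measurable (M.Z s) :=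
  M.measurable_Z.comp measurable_prodMk_left

lemma measurable_evo {A : Type*} [MeasurableSpace A] {H : A → E → ℝ≥0∞}
    (hH : Measurable (Function.uncurry H)) {s : A → ℝ≥0} (hs : Measurable s) {z : A → E}
    (hz : Measurable z) : Measurable fun a => evo M (H a) (s a) (z a) := by
  have h : Measurable fun p : A × W => H p.1 (M.Z (s p.1) p.2) :=
    hH.comp (measurable_fst.prodMk (M.measurable_Z.comp
      ((hs.comp measurable_fst).prodMk measurable_snd)))
  exact h.lintegral_kernel_prod_right' (κ := M.law.comap z hz)

lemma MarkovProcess.map_law (M : MarkovProcess P W) (s : ℝ≥0) (z : E) :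
    (M.law z).map (M.Z s) = P.kernel s z := by
  ext B hB
  rw [Measure.map_apply (M.measurable_Z_apply s) hB]
  -- The Markov property at time `0` on the sure event, together with the known starting point.
  have h := M.markov z 0 s Set.univ MeasurableSet.univ B hB
  rw [zero_add, Set.univ_inter, Measure.restrict_univ] at h
  rw [h, lintegral_congr_ae (g := fun _ => P.kernel s z B)
    ((M.start z).mono fun w hw => by simp only [hw])]
  simp

lemma evo_eq {H : E → ℝ≥0∞} (hH : Measurable H) (s : ℝ≥0) (z : E) :
    evo M H s z = ∫⁻ y, H y ∂(P.kernel s z) := by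
  rw [← M.map_law, lintegral_map hH (M.measurable_Z_apply s)]; rfl

lemma evo_zero {H : E → ℝ≥0∞} (hH : Measurable H) (z : E) : evo M H 0 z = H z := by
  rw [evo_eq hH, P.zero, Kernel.id_apply, lintegral_dirac' _ hH]

/-- Chapman–Kolmogorov: moving a starting point by `s` and then running for `t` adds the two times,
so only ages matter. -/
lemma evo_evo {H : E → ℝ≥0∞} (hH : Measurable H) (s t : ℝ≥0) (z : E) :
    evo M (evo M H t) s z = evo M H (s + t) z := by
  have h : Measurable (evo M H t) :=
    measurable_evo (H := fun _ : E => H) (hH.comp measurable_snd) measurable_const measurable_id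
  rw [evo_eq hH, P.add, Kernel.lintegral_comp _ _ _ hH, evo_eq h]
  simp_rw [evo_eq hH]

/-! ### Positions and starting points of the runs -/

/-- The position at time `r` along the trajectory of run `k`. -/
def runPosition (M : MarkovProcess P W) (ℓ : ℕ → ℝ≥0) (ξ : ℕ → W) (r : ℝ≥0) (k : ℕ) : E :=
  M.Z (r - partialTime ℓ k) (ξ k)

lemma measurable_runPosition {A : Type*} [MeasurableSpace A] {ℓ : A → ℕ → ℝ≥0} {ξ : A → ℕ → W}
    {r : A → ℝ≥0} {k : A → ℕ} (hℓ : Measurable ℓ) (hξ : Measurable ξ) (hr : Measurable r)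
    (hk : Measurable k) : Measurable fun a => runPosition M (ℓ a) (ξ a) (r a) (k a) := by
  have h : Measurable (Function.uncurry fun (k : ℕ) (a : A) => runPosition M (ℓ a) (ξ a) (r a) k) :=
    measurable_from_prod_countable_right fun k => M.measurable_Z.comp
      ((hr.sub ((measurable_partialTime k).comp hℓ)).prodMk ((measurable_pi_apply k).comp hξ))
  exact h.comp (hk.prodMk measurable_id)

/-- The position at time `r`, according to the first `n + 1` runs. -/
def position (M : MarkovProcess P W) (ℓ : ℕ → ℝ≥0) (ξ : ℕ → W) (n : ℕ) (r : ℝ≥0) : E :=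
  runPosition M ℓ ξ r (min (runIndex ℓ r) n)

lemma measurable_position {A : Type*} [MeasurableSpace A] {ℓ : A → ℕ → ℝ≥0} {ξ : A → ℕ → W}
    {r : A → ℝ≥0} (n : ℕ) (hℓ : Measurable ℓ) (hξ : Measurable ξ) (hr : Measurable r) :
    Measurable fun a => position M (ℓ a) (ξ a) n (r a) :=
  measurable_runPosition hℓ hξ hr
    ((measurable_runIndex.comp (hℓ.prodMk hr)).min measurable_const)

/-- Freezing the trajectories after index `n` changes nothing, and the frozen family is measurable
with respect to `past`. -/
lemma position_min (ℓ : ℕ → ℝ≥0) (ξ : ℕ → W) (n : ℕ) (r : ℝ≥0) :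
    position M ℓ (fun i => ξ (min i n)) n r = position M ℓ ξ n r := by
  simp [position, runPosition]

lemma position_eq_runPosition {ℓ : ℕ → ℝ≥0} (ξ : ℕ → W) {n k : ℕ} {r : ℝ≥0} (hk : k ≤ n)
    (h1 : partialTime ℓ k ≤ r) (h2 : r < partialTime ℓ (k + 1)) :
    position M ℓ ξ n r = runPosition M ℓ ξ r k := by
  rw [position, runIndex_eq h1 h2, min_eq_left hk]

lemma position_succ {ℓ : ℕ → ℝ≥0} (ξ : ℕ → W) {n : ℕ} {r : ℝ≥0}
    (h : r < partialTime ℓ (n + 1)) : position M ℓ ξ (n + 1) r = position M ℓ ξ n r := by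
  have hn : runIndex ℓ r ≤ n := Nat.sInf_le h
  rw [position, position, min_eq_left hn, min_eq_left (hn.trans (Nat.le_succ n))]

end

/-! ### The memory law as a kernel and measurability with respect to the past -/

lemma measurable_memoryLaw (γ δ : ℝ) :
    Measurable fun t : ℝ≥0 => memoryLaw (memoryKernel γ δ) t := by
  refine Measure.measurable_of_measurable_coe _ fun B hB => ?_
  have hm : MeasurableSet {p : ℝ≥0 × ℝ | p.2 ∈ Set.Ico (0 : ℝ) p.1} :=
    (measurableSet_le (f := fun _ => (0 : ℝ)) (g := fun p : ℝ≥0 × ℝ => p.2) measurable_const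
      measurable_snd).inter
    (measurableSet_lt (f := fun p : ℝ≥0 × ℝ => p.2) (g := fun p => (p.1 : ℝ)) measurable_snd
      (by fun_prop))
  have e : (fun t : ℝ≥0 => memoryLaw (memoryKernel γ δ) t B) = fun t : ℝ≥0 =>
      (memoryMeasure γ δ (Prod.mk t ⁻¹' {p : ℝ≥0 × ℝ | p.2 ∈ Set.Ico (0 : ℝ) p.1}))⁻¹ *
      memoryMeasure γ δ (Prod.mk t ⁻¹' (Prod.snd ⁻¹' B ∩ {p : ℝ≥0 × ℝ | p.2 ∈ Set.Ico (0 : ℝ) p.1})) := by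
    funext t
    rw [memoryLaw_eq, Measure.smul_apply, Measure.restrict_apply hB, smul_eq_mul]
    rfl
  rw [e]
  exact (measurable_measure_prodMk_left hm).inv.mul
    (measurable_measure_prodMk_left ((measurable_snd hB).inter hm))

instance (μ : ℝ → ℝ) (t : ℝ) : IsZeroOrProbabilityMeasure (memoryLaw μ t) := by
  unfold memoryLaw; infer_instance

/-- The memory law as a kernel. -/
def choiceKernel (γ δ : ℝ) : Kernel ℝ≥0 ℝ :=
  ⟨fun t => memoryLaw (memoryKernel γ δ) t, measurable_memoryLaw γ δ⟩

lemma choiceKernel_apply (γ δ : ℝ) (t : ℝ≥0) :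
    choiceKernel γ δ t = memoryLaw (memoryKernel γ δ) t := rfl

instance (γ δ : ℝ) : IsFiniteKernel (choiceKernel γ δ) :=
  ⟨1, ENNReal.one_lt_top, fun t => by rw [choiceKernel_apply]; exact prob_le_one⟩

section

variable {W Ω : Type*} [MeasurableSpace W] {L R : ℕ → Ω → ℝ≥0} {ξ : ℕ → Ω → W}

lemma measurable_path_iSup_comap :
    Measurable[⨆ i : ℕ, MeasurableSpace.comap (L i) inferInstance] fun ω i => L i ω := by
  refine @measurable_pi_lambda _ _ _ (_) _ _ fun i => ?_
  exact (comap_measurable (L i)).mono (le_iSup (fun i => MeasurableSpace.comap (L i) _) i) le_rfl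

lemma measurable_path_past (n : ℕ) : Measurable[past L R ξ n] fun ω i => L i ω :=
  measurable_path_iSup_comap.mono (le_sup_left.trans le_sup_left) le_rfl

lemma measurable_trajectories_past (n : ℕ) :
    Measurable[past L R ξ n] fun ω i => ξ (min i n) ω := by
  refine @measurable_pi_lambda _ _ _ (_) _ _ fun i => ?_
  refine (comap_measurable (ξ (min i n))).mono (le_trans ?_ le_sup_right) le_rfl
  exact le_iSup (fun i : {i : ℕ // i ≤ n} => MeasurableSpace.comap (ξ i) _) ⟨min i n, min_le_right i n⟩

end

/-! ### Starting points of the runs and the choice of memory times -/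

section

variable {E W Ω : Type*} [MeasurableSpace E] [Zero E] [MeasurableSpace W]
  [mΩ : MeasurableSpace Ω] {P : MarkovSemigroup E} {M : MarkovProcess P W} {φ : Measure ℝ≥0}
  {γ δ : ℝ} {Pr : Measure Ω} {X : ℝ≥0 → Ω → E} {L R : ℕ → Ω → ℝ≥0} {ξ : ℕ → Ω → W}

/-- The starting point of run `n`. -/
def startPoint (M : MarkovProcess P W) (L R : ℕ → Ω → ℝ≥0) (ξ : ℕ → Ω → W) : ℕ → Ω → E
  | 0, _ => 0
  | n + 1, ω => position M (fun i => L i ω) (fun i => ξ i ω) n (R n ω)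

lemma IsBuiltFrom.isRunSequence {μ : ℝ → ℝ} (h : IsBuiltFrom M φ μ Pr X L R ξ) :
    IsRunSequence Pr φ L := ⟨h.measurable_L, h.indep, h.law_L⟩

lemma IsBuiltFrom.past_le {μ : ℝ → ℝ} (h : IsBuiltFrom M φ μ Pr X L R ξ) (n : ℕ) :
    past L R ξ n ≤ mΩ := by
  refine sup_le (sup_le ?_ ?_) ?_
  · exact iSup_le fun i => (h.measurable_L i).comap_le
  · exact iSup_le fun i => (h.measurable_R i).comap_le
  · exact iSup_le fun i => (h.measurable_ξ i).comap_le

variable [IsProbabilityMeasure Pr]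

/-- The memory law depends on the past through `T_(n+1)` only, so the choice can be integrated out
given all run lengths and the trajectories already sampled. -/
lemma IsBuiltFrom.lintegral_choice (h : IsBuiltFrom M φ (memoryKernel γ δ) Pr X L R ξ) (n : ℕ)
    {G : ((ℕ → ℝ≥0) × (ℕ → W)) → ℝ → ℝ≥0∞} (hG : Measurable (Function.uncurry G)) :
    ∫⁻ ω, G (fun i => L i ω, fun i => ξ (min i n) ω) (R n ω) ∂Pr =
      ∫⁻ ω, ∫⁻ r, G (fun i => L i ω, fun i => ξ (min i n) ω) r
        ∂(memoryLaw (memoryKernel γ δ) (relocTime L (n + 1) ω)) ∂Pr :=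
  (h.choice n).lintegral_comp (h.past_le n) (h.measurable_R n).coe_nnreal_real
    (V := fun ω => (fun i => L i ω, fun i => ξ (min i n) ω))
    (@Measurable.prodMk _ _ _ _ _ (_) _ _ (measurable_path_past n) (measurable_trajectories_past n))
    ((choiceKernel γ δ).comap (fun p : (ℕ → ℝ≥0) × (ℕ → W) => partialTime p.1 (n + 1))
      ((measurable_partialTime _).comp measurable_fst))
    (Eventually.of_forall fun _ => rfl) hG

/-- The memory law gives no mass to times from `T_(n+1)` on. Hence the position at the memory time
can be read off runs `0, …, n`. -/
lemma IsBuiltFrom.ae_lt_relocTime (h : IsBuiltFrom M φ (memoryKernel γ δ) Pr X L R ξ) (n : ℕ) :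
    ∀ᵐ ω ∂Pr, R n ω < relocTime L (n + 1) ω := by
  have hm : MeasurableSet {p : ((ℕ → ℝ≥0) × (ℕ → W)) × ℝ | (partialTime p.1.1 (n + 1) : ℝ) ≤ p.2} :=
    measurableSet_le (f := fun p : ((ℕ → ℝ≥0) × (ℕ → W)) × ℝ => (partialTime p.1.1 (n + 1) : ℝ))
      ((measurable_partialTime _).comp (measurable_fst.comp measurable_fst)).coe_nnreal_real
      measurable_snd
  have hc := h.lintegral_choice n (G := fun p r =>
    {p : ((ℕ → ℝ≥0) × (ℕ → W)) × ℝ | (partialTime p.1.1 (n + 1) : ℝ) ≤ p.2}.indicator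
      (fun _ => (1 : ℝ≥0∞)) (p, r))
    (measurable_const.indicator hm)
  have h0 : ∀ ω, ∫⁻ r, {p : ((ℕ → ℝ≥0) × (ℕ → W)) × ℝ | (partialTime p.1.1 (n + 1) : ℝ) ≤ p.2}.indicator
      (fun _ => (1 : ℝ≥0∞)) ((fun i => L i ω, fun i => ξ (min i n) ω), r)
        ∂(memoryLaw (memoryKernel γ δ) (relocTime L (n + 1) ω)) = 0 := by
    intro ω
    rw [memoryLaw_eq, lintegral_smul_measure]
    refine smul_eq_zero_of_right _ ?_
    refine (setLIntegral_congr_fun (g := fun _ => 0) measurableSet_Ico fun r hr => ?_).trans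
      (by simp)
    rw [Set.indicator_of_notMem]
    exact not_le.2 hr.2
  simp_rw [h0] at hc
  rw [lintegral_zero] at hc
  have hz := (lintegral_eq_zero_iff ((measurable_const.indicator hm).comp
    (((measurable_pi_lambda _ h.measurable_L).prodMk (measurable_pi_lambda _ fun i =>
      h.measurable_ξ (min i n))).prodMk (h.measurable_R n).coe_nnreal_real))).1 hc
  filter_upwards [hz] with ω hω
  by_contra hcon
  rw [not_lt] at hcon
  have : ((fun i => L i ω, fun i => ξ (min i n) ω), (R n ω : ℝ)) ∈
      {p : ((ℕ → ℝ≥0) × (ℕ → W)) × ℝ | (partialTime p.1.1 (n + 1) : ℝ) ≤ p.2} := by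
    exact_mod_cast hcon
  rw [Function.comp_apply, Set.indicator_of_mem this] at hω
  simp at hω

end

lemma toNNReal_sub_eq {a : ℝ≥0} {r : ℝ} (h : (a : ℝ) ≤ r) :
    r.toNNReal - a = (r - a).toNNReal := by
  have hr0 : 0 ≤ r := (NNReal.coe_nonneg a).trans h
  rw [← NNReal.coe_inj, NNReal.coe_sub ((Real.le_toNNReal_iff_coe_le hr0).2 h),
    Real.coe_toNNReal r hr0, Real.coe_toNNReal _ (sub_nonneg.2 h)]

/-! ### Relocations with old and new memory times -/

section

variable {E W Ω : Type*} [MeasurableSpace E] [Zero E] [MeasurableSpace W]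
  [mΩ : MeasurableSpace Ω] {P : MarkovSemigroup E} {M : MarkovProcess P W} {φ : Measure ℝ≥0}
  {γ δ : ℝ} {Pr : Measure Ω} {X : ℝ≥0 → Ω → E} {L R : ℕ → Ω → ℝ≥0} {ξ : ℕ → Ω → W}

lemma IsBuiltFrom.measurable_startPoint {μ : ℝ → ℝ} (h : IsBuiltFrom M φ μ Pr X L R ξ) (n : ℕ) :
    Measurable (startPoint M L R ξ n) := by
  obtain _ | n := n
  · exact measurable_const
  · exact measurable_position n (measurable_pi_lambda _ h.measurable_L)
      (measurable_pi_lambda _ h.measurable_ξ) (h.measurable_R n)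

variable [IsProbabilityMeasure Pr]

lemma IsBuiltFrom.ae_eq_startPoint (h : IsBuiltFrom M φ (memoryKernel γ δ) Pr X L R ξ) (n : ℕ) :
    ∀ᵐ ω ∂Pr, X (R n ω) ω = startPoint M L R ξ (n + 1) ω := by
  filter_upwards [h.path, h.ae_lt_relocTime n] with ω hp hR
  obtain ⟨h1, h2⟩ := partialTime_runIndex (ℓ := fun i => L i ω) (t := R n ω) hR
  have hn : runIndex (fun i => L i ω) (R n ω) ≤ n := Nat.sInf_le hR
  rw [hp _ _ h1 h2, startPoint, position_eq_runPosition _ hn h1 h2]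
  rfl

/-- Run `n` depends on the past through its starting point only. The run lengths stay as a
parameter, because `past` contains all of them, including future ones. -/
lemma IsBuiltFrom.lintegral_run (h : IsBuiltFrom M φ (memoryKernel γ δ) Pr X L R ξ) (n : ℕ)
    {G : ((ℕ → ℝ≥0) × E) → W → ℝ≥0∞} (hG : Measurable (Function.uncurry G)) :
    ∫⁻ ω, G (fun i => L i ω, startPoint M L R ξ n ω) (ξ n ω) ∂Pr =
      ∫⁻ ω, ∫⁻ w, G (fun i => L i ω, startPoint M L R ξ n ω) w
        ∂(M.law (startPoint M L R ξ n ω)) ∂Pr := by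
  obtain _ | n := n
  · exact h.first_run.lintegral_comp (iSup_le fun i => (h.measurable_L i).comap_le)
      (h.measurable_ξ 0) (V := fun ω => (fun i => L i ω, startPoint M L R ξ 0 ω))
      (@Measurable.prodMk _ _ _ _ _ (_) _ _ measurable_path_iSup_comap (@measurable_const _ _ _ (_) _))
      (M.law.comap Prod.snd measurable_snd) (Eventually.of_forall fun _ => rfl) hG
  · have hle : past L R ξ n ≤ past L R ξ n ⊔ MeasurableSpace.comap (R n) inferInstance := le_sup_left
    have hs : Measurable[past L R ξ n ⊔ MeasurableSpace.comap (R n) inferInstance]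
        (startPoint M L R ξ (n + 1)) := by
      have e : startPoint M L R ξ (n + 1) = fun ω =>
          position M (fun i => L i ω) (fun i => ξ (min i n) ω) n (R n ω) := by
        funext ω
        exact (position_min _ (fun i => ξ i ω) n _).symm
      rw [e]
      exact @measurable_position _ _ _ _ _ _ _ (_) _ _ _ n ((measurable_path_past n).mono hle le_rfl)
        ((measurable_trajectories_past n).mono hle le_rfl)
        ((comap_measurable (R n)).mono le_sup_right le_rfl)
    exact (h.next_run n).lintegral_comp (sup_le (h.past_le n) (h.measurable_R n).comap_le)
      (h.measurable_ξ (n + 1)) (V := fun ω => (fun i => L i ω, startPoint M L R ξ (n + 1) ω))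
      (@Measurable.prodMk _ _ _ _ _ (_) _ _ ((measurable_path_past n).mono hle le_rfl) hs)
      (M.law.comap Prod.snd measurable_snd)
      ((h.ae_eq_startPoint n).mono fun ω hω => by simp [hω]) hG

/-- The law of the next starting point, from the choice of the memory time. -/
lemma IsBuiltFrom.lintegral_startPoint_succ (h : IsBuiltFrom M φ (memoryKernel γ δ) Pr X L R ξ)
    (n : ℕ) {H : (ℕ → ℝ≥0) → E → ℝ≥0∞} (hH : Measurable (Function.uncurry H)) :
    ∫⁻ ω, H (fun i => L i ω) (startPoint M L R ξ (n + 1) ω) ∂Pr =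
      ∫⁻ ω, (memoryMeasure γ δ (Set.Ico 0 (relocTime L (n + 1) ω)))⁻¹ *
        ∫⁻ r in Set.Ico (0 : ℝ) (relocTime L (n + 1) ω), H (fun i => L i ω)
          (position M (fun i => L i ω) (fun i => ξ i ω) n r.toNNReal) ∂(memoryMeasure γ δ) ∂Pr := by
  have hG : Measurable (Function.uncurry fun (p : (ℕ → ℝ≥0) × (ℕ → W)) (r : ℝ) =>
      H p.1 (position M p.1 p.2 n r.toNNReal)) :=
    hH.comp ((measurable_fst.comp measurable_fst).prodMk
      (measurable_position n (measurable_fst.comp measurable_fst)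
        (measurable_snd.comp measurable_fst) (measurable_real_toNNReal.comp measurable_snd)))
  have hc := h.lintegral_choice n hG
  simp only [Real.toNNReal_coe, memoryLaw_eq, lintegral_smul_measure, smul_eq_mul] at hc
  have e : ∀ ω r, position M (fun i => L i ω) (fun i => ξ (min i n) ω) n r =
      position M (fun i => L i ω) (fun i => ξ i ω) n r := fun ω r =>
    position_min _ (fun i => ξ i ω) n r
  simp only [e] at hc
  exact hc

lemma memoryMeasure_Ico_ne_top (hγ : 0 < γ) (hδ0 : 0 < δ) (t : ℝ≥0) :
    memoryMeasure γ δ (Set.Ico 0 t) ≠ ⊤ := by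
  rw [memoryMeasure_Ico_zero hγ hδ0 (NNReal.coe_nonneg t)]; exact ENNReal.ofReal_ne_top

lemma measurable_memoryMeasure_Ico : Measurable fun t : ℝ≥0 => memoryMeasure γ δ (Set.Ico 0 (t : ℝ)) := by
  have hm : MeasurableSet {p : ℝ≥0 × ℝ | p.2 ∈ Set.Ico (0 : ℝ) p.1} :=
    (measurableSet_le (f := fun _ => (0 : ℝ)) (g := fun p : ℝ≥0 × ℝ => p.2) measurable_const
      measurable_snd).inter
    (measurableSet_lt (f := fun p : ℝ≥0 × ℝ => p.2) (g := fun p => (p.1 : ℝ)) measurable_snd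
      (by fun_prop))
  exact measurable_measure_prodMk_left hm

/-- The contribution of the memory times before the last relocation. -/
lemma IsBuiltFrom.lintegral_choice_old (h : IsBuiltFrom M φ (memoryKernel γ δ) Pr X L R ξ)
    (hγ : 0 < γ) (hδ0 : 0 < δ) (n : ℕ) {H : (ℕ → ℝ≥0) → E → ℝ≥0∞}
    (hH : Measurable (Function.uncurry H)) :
    ∫⁻ ω, ∫⁻ r in Set.Ico (0 : ℝ) (relocTime L n ω), H (fun i => L i ω)
          (position M (fun i => L i ω) (fun i => ξ i ω) n r.toNNReal) ∂(memoryMeasure γ δ) ∂Pr =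
      ∫⁻ ω, memoryMeasure γ δ (Set.Ico 0 (relocTime L n ω)) *
        H (fun i => L i ω) (startPoint M L R ξ n ω) ∂Pr := by
  obtain _ | n := n
  · simp [relocTime_zero]
  · have hc := h.lintegral_startPoint_succ n (H := fun ℓ z =>
      memoryMeasure γ δ (Set.Ico 0 (partialTime ℓ (n + 1))) * H ℓ z)
      (((measurable_memoryMeasure_Ico.comp (measurable_partialTime _)).comp measurable_fst).mul hH)
    refine Eq.trans ?_ hc.symm
    refine lintegral_congr fun ω => ?_
    have e : partialTime (fun i => L i ω) (n + 1) = relocTime L (n + 1) ω := rfl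
    rw [e, lintegral_const_mul' _ _ (memoryMeasure_Ico_ne_top hγ hδ0 _), ← mul_assoc]
    have e2 : ∫⁻ r in Set.Ico (0 : ℝ) (relocTime L (n + 1) ω), H (fun i => L i ω)
          (position M (fun i => L i ω) (fun i => ξ i ω) (n + 1) r.toNNReal) ∂(memoryMeasure γ δ) =
        ∫⁻ r in Set.Ico (0 : ℝ) (relocTime L (n + 1) ω), H (fun i => L i ω)
          (position M (fun i => L i ω) (fun i => ξ i ω) n r.toNNReal) ∂(memoryMeasure γ δ) := by
      refine setLIntegral_congr_fun measurableSet_Ico fun r hr => ?_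
      rw [position_succ]
      exact (Real.toNNReal_lt_iff_lt_coe hr.1).2 hr.2
    rw [e2]
    -- If the mass is zero the cancellation fails, but both sides vanish.
    by_cases h0 : memoryMeasure γ δ (Set.Ico 0 (relocTime L (n + 1) ω)) = 0
    · rw [Measure.restrict_eq_zero.2 h0]; simp
    · rw [ENNReal.inv_mul_cancel h0 (memoryMeasure_Ico_ne_top hγ hδ0 _), one_mul]

/-- The contribution of the memory times in the last run. -/
lemma IsBuiltFrom.lintegral_choice_new (h : IsBuiltFrom M φ (memoryKernel γ δ) Pr X L R ξ)
    (n : ℕ) {H : (ℕ → ℝ≥0) → E → ℝ≥0∞} (hH : Measurable (Function.uncurry H)) :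
    ∫⁻ ω, ∫⁻ r in Set.Ico (relocTime L n ω : ℝ) (relocTime L (n + 1) ω), H (fun i => L i ω)
          (position M (fun i => L i ω) (fun i => ξ i ω) n r.toNNReal) ∂(memoryMeasure γ δ) ∂Pr =
      ∫⁻ ω, ∫⁻ r in Set.Ico (relocTime L n ω : ℝ) (relocTime L (n + 1) ω),
        evo M (H fun i => L i ω) (r - relocTime L n ω).toNNReal (startPoint M L R ξ n ω)
          ∂(memoryMeasure γ δ) ∂Pr := by
  set S : (ℕ → ℝ≥0) → Set ℝ := fun ℓ => Set.Ico (partialTime ℓ n : ℝ) (partialTime ℓ (n + 1)) with hS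
  have hSm : MeasurableSet {p : (((ℕ → ℝ≥0) × E) × W) × ℝ | p.2 ∈ S p.1.1.1} :=
    (measurableSet_le (f := fun p : (((ℕ → ℝ≥0) × E) × W) × ℝ => (partialTime p.1.1.1 n : ℝ))
      ((measurable_partialTime _).comp (by fun_prop)).coe_nnreal_real
      measurable_snd).inter
    (measurableSet_lt (f := fun p : (((ℕ → ℝ≥0) × E) × W) × ℝ => p.2) measurable_snd
      ((measurable_partialTime (n + 1)).comp (by fun_prop)).coe_nnreal_real)
  have hI : Measurable fun p : (((ℕ → ℝ≥0) × E) × W) × ℝ =>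
      {p : (((ℕ → ℝ≥0) × E) × W) × ℝ | p.2 ∈ S p.1.1.1}.indicator
        (fun p => H p.1.1.1 (M.Z (p.2 - partialTime p.1.1.1 n).toNNReal p.1.2)) p := by
    refine Measurable.indicator ?_ hSm
    refine hH.comp (Measurable.prodMk (by fun_prop) (M.measurable_Z.comp
      (Measurable.prodMk ?_ (by fun_prop))))
    exact (measurable_snd.sub ((measurable_partialTime n).comp (by fun_prop)).coe_nnreal_real).real_toNNReal
  have key : ∀ ℓ z w, ∫⁻ r, {p : (((ℕ → ℝ≥0) × E) × W) × ℝ | p.2 ∈ S p.1.1.1}.indicator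
      (fun p => H p.1.1.1 (M.Z (p.2 - partialTime p.1.1.1 n).toNNReal p.1.2)) (((ℓ, z), w), r)
        ∂(memoryMeasure γ δ) =
      ∫⁻ r in S ℓ, H ℓ (M.Z (r - partialTime ℓ n).toNNReal w) ∂(memoryMeasure γ δ) := by
    intro ℓ z w
    rw [← lintegral_indicator measurableSet_Ico]
    rfl
  have hG : Measurable (Function.uncurry fun (p : (ℕ → ℝ≥0) × E) (w : W) =>
      ∫⁻ r in S p.1, H p.1 (M.Z (r - partialTime p.1 n).toNNReal w) ∂(memoryMeasure γ δ)) := by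
    have e : (Function.uncurry fun (p : (ℕ → ℝ≥0) × E) (w : W) =>
        ∫⁻ r in S p.1, H p.1 (M.Z (r - partialTime p.1 n).toNNReal w) ∂(memoryMeasure γ δ)) =
        fun q => ∫⁻ r, {p : (((ℕ → ℝ≥0) × E) × W) × ℝ | p.2 ∈ S p.1.1.1}.indicator
          (fun p => H p.1.1.1 (M.Z (p.2 - partialTime p.1.1.1 n).toNNReal p.1.2)) (q, r)
            ∂(memoryMeasure γ δ) := by
      funext q
      exact (key q.1.1 q.1.2 q.2).symm
    rw [e]
    exact hI.lintegral_prod_right'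
  -- The time integral over the last run is a functional of that run and of the run lengths;
  -- integrating the trajectory out and exchanging the two integrals yields the semigroup at `r -
  -- T_n`.
  have hr := h.lintegral_run n hG
  refine Eq.trans (lintegral_congr fun ω => ?_) (hr.trans (lintegral_congr fun ω => ?_))
  · refine setLIntegral_congr_fun measurableSet_Ico fun r hr => ?_
    have hr0 : 0 ≤ r := (NNReal.coe_nonneg _).trans hr.1
    simp only
    rw [position_eq_runPosition (k := n) _ le_rfl ((Real.le_toNNReal_iff_coe_le hr0).2 hr.1)
      ((Real.toNNReal_lt_iff_lt_coe hr0).2 hr.2), runPosition]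
    rw [toNNReal_sub_eq (a := partialTime (fun i => L i ω) n) hr.1]
  · simp only
    rw [lintegral_lintegral_swap]
    · rfl
    · refine Measurable.aemeasurable ?_
      refine hH.comp (measurable_const.prodMk (M.measurable_Z.comp (Measurable.prodMk ?_ (by fun_prop))))
      fun_prop

end

/-! ### The law of the walk as that of the process at a random age -/

section

variable {E W Ω : Type*} [MeasurableSpace E] [Zero E] [MeasurableSpace W]
  [mΩ : MeasurableSpace Ω] {P : MarkovSemigroup E} {M : MarkovProcess P W} {φ : Measure ℝ≥0}
  {γ δ : ℝ} {Pr : Measure Ω} {X : ℝ≥0 → Ω → E} {L R : ℕ → Ω → ℝ≥0} {ξ : ℕ → Ω → W}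

/-- All memory times before `x` are clamped to increment `0`, which gives an atom there; the rest is
the memory measure on the last run, shifted to start at `0`. -/
lemma lintegral_stepLaw {x l : ℝ≥0} (hxl : x + l ≠ 0)
    {F : ℝ≥0 → ℝ≥0∞} (hF : Measurable F) :
    ∫⁻ y, F y ∂(stepLaw γ δ x l) = (memoryMeasure γ δ (Set.Ico 0 (x + l : ℝ≥0)))⁻¹ *
      (memoryMeasure γ δ (Set.Ico 0 x) * F 0 +
        ∫⁻ r in Set.Ico (x : ℝ) (x + l : ℝ≥0), F (r - x).toNNReal ∂(memoryMeasure γ δ)) := by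
  unfold stepLaw
  rw [if_neg hxl, lintegral_map hF (by fun_prop), memoryLaw_eq, lintegral_smul_measure, smul_eq_mul]
  congr 1
  have hx : (x : ℝ) ≤ (x + l : ℝ≥0) := by exact_mod_cast le_self_add
  rw [← Set.Ico_union_Ico_eq_Ico (NNReal.coe_nonneg x) hx,
    lintegral_union measurableSet_Ico (Set.Ico_disjoint_Ico_same)]
  congr 1
  rw [setLIntegral_congr_fun (g := fun _ => F 0) measurableSet_Ico fun r hr => by
    rw [Real.toNNReal_of_nonpos (sub_nonpos.2 hr.2.le)]]
  rw [setLIntegral_const, mul_comm]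

variable [IsProbabilityMeasure Pr]

set_option maxHeartbeats 600000 in
/-- One-step recursion for the law of the starting points. -/
lemma IsBuiltFrom.lintegral_startPoint_step (h : IsBuiltFrom M φ (memoryKernel γ δ) Pr X L R ξ)
    (hφ : φ {0} = 0) (hγ : 0 < γ) (hδ0 : 0 < δ) (n : ℕ) {H : (ℕ → ℝ≥0) → E → ℝ≥0∞}
    (hH : Measurable (Function.uncurry H)) :
    ∫⁻ ω, H (fun i => L i ω) (startPoint M L R ξ (n + 1) ω) ∂Pr =
      ∫⁻ ω, ∫⁻ y, evo M (H fun i => L i ω) y (startPoint M L R ξ n ω)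
        ∂(stepLaw γ δ (relocTime L n ω) (L n ω)) ∂Pr := by
  have hL := h.isRunSequence
  have hLm := hL.measurable_path
  have hHℓ : ∀ ℓ, Measurable (H ℓ) := fun ℓ => hH.comp measurable_prodMk_left
  set c : (ℕ → ℝ≥0) → ℝ≥0∞ := fun ℓ => (memoryMeasure γ δ (Set.Ico 0 (partialTime ℓ (n + 1))))⁻¹
    with hc
  have hcm : Measurable c := (measurable_memoryMeasure_Ico.comp (measurable_partialTime _)).inv
  have hK : Measurable (Function.uncurry fun ℓ z => c ℓ * H ℓ z) :=
    (hcm.comp measurable_fst).mul hH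
  have hpos : Measurable fun p : Ω × ℝ => H (fun i => L i p.1)
      (position M (fun i => L i p.1) (fun i => ξ i p.1) n p.2.toNNReal) :=
    hH.comp ((hLm.comp measurable_fst).prodMk (measurable_position n (hLm.comp measurable_fst)
      ((measurable_pi_lambda _ h.measurable_ξ).comp measurable_fst)
      (measurable_real_toNNReal.comp measurable_snd)))
  have hpω : ∀ ω, Measurable fun r : ℝ => H (fun i => L i ω)
      (position M (fun i => L i ω) (fun i => ξ i ω) n r.toNNReal) := fun ω =>
    hpos.comp measurable_prodMk_left
  have hT : ∀ ω, (relocTime L n ω : ℝ) ≤ relocTime L (n + 1) ω := fun ω => by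
    rw [relocTime_succ]; exact_mod_cast le_self_add
  -- The normalisation depends on run lengths only, so it is absorbed into the test function and the
  -- old and new memory times are treated separately.
  have hsplit : ∀ ω, (memoryMeasure γ δ (Set.Ico 0 (relocTime L (n + 1) ω)))⁻¹ *
        ∫⁻ r in Set.Ico (0 : ℝ) (relocTime L (n + 1) ω), H (fun i => L i ω)
          (position M (fun i => L i ω) (fun i => ξ i ω) n r.toNNReal) ∂(memoryMeasure γ δ) =
      ∫⁻ r in Set.Ico (0 : ℝ) (relocTime L n ω), c (fun i => L i ω) * H (fun i => L i ω)
          (position M (fun i => L i ω) (fun i => ξ i ω) n r.toNNReal) ∂(memoryMeasure γ δ) +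
      ∫⁻ r in Set.Ico (relocTime L n ω : ℝ) (relocTime L (n + 1) ω), c (fun i => L i ω) *
        H (fun i => L i ω)
          (position M (fun i => L i ω) (fun i => ξ i ω) n r.toNNReal) ∂(memoryMeasure γ δ) := by
    intro ω
    rw [← Set.Ico_union_Ico_eq_Ico (NNReal.coe_nonneg (relocTime L n ω)) (hT ω),
      lintegral_union measurableSet_Ico Set.Ico_disjoint_Ico_same, mul_add,
      lintegral_const_mul _ (hpω ω), lintegral_const_mul _ (hpω ω),
      Set.Ico_union_Ico_eq_Ico (NNReal.coe_nonneg (relocTime L n ω)) (hT ω)]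
    rfl
  have hm1 : Measurable fun ω => ∫⁻ r in Set.Ico (0 : ℝ) (relocTime L n ω), c (fun i => L i ω) *
      H (fun i => L i ω)
        (position M (fun i => L i ω) (fun i => ξ i ω) n r.toNNReal) ∂(memoryMeasure γ δ) := by
    have hS : MeasurableSet {p : Ω × ℝ | p.2 ∈ Set.Ico (0 : ℝ) (relocTime L n p.1)} :=
      (measurableSet_le (f := fun _ => (0 : ℝ)) (g := fun p : Ω × ℝ => p.2) measurable_const
        measurable_snd).inter
      (measurableSet_lt (f := fun p : Ω × ℝ => p.2) measurable_snd
        ((hL.measurable_relocTime n).comp measurable_fst).coe_nnreal_real)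
    have := (((hcm.comp (hLm.comp measurable_fst)).mul hpos).indicator hS).lintegral_prod_right'
      (ν := memoryMeasure γ δ)
    refine (congrArg Measurable (funext fun ω => ?_)).mp this
    rw [← lintegral_indicator measurableSet_Ico]
    rfl
  rw [h.lintegral_startPoint_succ n hH, lintegral_congr hsplit, lintegral_add_left hm1,
    h.lintegral_choice_old hγ hδ0 n hK, h.lintegral_choice_new n hK, ← lintegral_add_left]
  · refine lintegral_congr_ae ?_
    -- Run lengths are almost surely positive, so `T_(n+1) ≠ 0` and the degenerate branch of
    -- `stepLaw` does not occur.
    have hpos : ∀ᵐ ω ∂Pr, 0 < L n ω := by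
      have := ae_pos_of_singleton_zero hφ
      rw [← (h.law_L n).map_eq] at this
      exact ae_of_ae_map (h.measurable_L n).aemeasurable this
    filter_upwards [hpos] with ω hω
    have hev : Measurable fun y => evo M (H fun i => L i ω) y (startPoint M L R ξ n ω) :=
      measurable_evo (H := fun _ : ℝ≥0 => H fun i => L i ω) ((hHℓ _).comp measurable_snd)
        measurable_id measurable_const
    have hevc : ∀ y z, evo M (fun z => c (fun i => L i ω) * H (fun i => L i ω) z) y z =
        c (fun i => L i ω) * evo M (H fun i => L i ω) y z := fun y z =>
      lintegral_const_mul _ ((hHℓ _).comp (M.measurable_Z_apply y))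
    rw [lintegral_stepLaw (add_pos_of_nonneg_of_pos zero_le hω).ne' hev, evo_zero (hHℓ _),
      mul_add]
    simp only [hevc]
    have hevr : Measurable fun r : ℝ => evo M (H fun i => L i ω) (r - relocTime L n ω).toNNReal
        (startPoint M L R ξ n ω) := hev.comp (by fun_prop)
    have hcω : c (fun i => L i ω) = (memoryMeasure γ δ (Set.Ico 0 (relocTime L (n + 1) ω)))⁻¹ := rfl
    rw [lintegral_const_mul _ hevr, ← relocTime_succ, mul_left_comm, hcω]
  · have m1 : Measurable fun ω => memoryMeasure γ δ (Set.Ico 0 (relocTime L n ω : ℝ)) :=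
      measurable_memoryMeasure_Ico.comp (hL.measurable_relocTime n)
    have m2 : Measurable fun ω => H (fun i => L i ω) (startPoint M L R ξ n ω) :=
      hH.comp (hLm.prodMk (h.measurable_startPoint n))
    exact m1.mul ((hcm.comp hLm).mul m2)

/-- The law of the starting points in terms of the semigroup and of the depth. -/
lemma IsBuiltFrom.lintegral_startPoint (h : IsBuiltFrom M φ (memoryKernel γ δ) Pr X L R ξ)
    (hφ : φ {0} = 0) (hγ : 0 < γ) (hδ0 : 0 < δ) (n : ℕ) {H : (ℕ → ℝ≥0) → E → ℝ≥0∞}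
    (hH : Measurable (Function.uncurry H)) :
    ∫⁻ ω, H (fun i => L i ω) (startPoint M L R ξ n ω) ∂Pr =
      ∫⁻ ω, ∫⁻ s, evo M (H fun i => L i ω) s 0 ∂(depthLaw γ δ n fun i => L i ω) ∂Pr := by
  have hHℓ : ∀ ℓ, Measurable (H ℓ) := fun ℓ => hH.comp measurable_prodMk_left
  induction n generalizing H with
  | zero =>
    refine lintegral_congr fun ω => ?_
    have : Measurable fun s => evo M (H fun i => L i ω) s (0 : E) :=
      measurable_evo (H := fun _ : ℝ≥0 => H fun i => L i ω) ((hHℓ _).comp measurable_snd)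
        measurable_id measurable_const
    rw [depthLaw, lintegral_dirac' _ this, evo_zero (hHℓ _)]
    rfl
  | succ n ih =>
    have hstep : ∀ x l, IsProbabilityMeasure (stepLaw γ δ x l) :=
      isProbabilityMeasure_stepLaw hγ hδ0
    let κ : Kernel ((ℕ → ℝ≥0) × E) ℝ≥0 := ⟨fun p => stepLaw γ δ (partialTime p.1 n) (p.1 n),
      (measurable_stepLaw γ δ).comp (((measurable_partialTime n).comp measurable_fst).prodMk
        ((measurable_pi_apply n).comp measurable_fst))⟩
    have : IsMarkovKernel κ := ⟨fun p => hstep _ _⟩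
    have hH' : Measurable (Function.uncurry fun (ℓ : ℕ → ℝ≥0) (z : E) =>
        ∫⁻ y, evo M (H ℓ) y z ∂(stepLaw γ δ (partialTime ℓ n) (ℓ n))) := by
      have hm : Measurable fun q : ((ℕ → ℝ≥0) × E) × ℝ≥0 => evo M (H q.1.1) q.2 q.1.2 :=
        measurable_evo (H := fun q : ((ℕ → ℝ≥0) × E) × ℝ≥0 => H q.1.1)
          (hH.comp ((by fun_prop : Measurable fun a : (((ℕ → ℝ≥0) × E) × ℝ≥0) × E => a.1.1.1).prodMk
            measurable_snd))
          measurable_snd (by fun_prop)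
      exact hm.lintegral_kernel_prod_right' (κ := κ)
    rw [h.lintegral_startPoint_step hφ hγ hδ0 n hH]
    -- The induction hypothesis is applied to the functional averaged over the last step, which
    -- depends on the run lengths as well as on the position. Chapman–Kolmogorov then turns the two
    -- successive ages into their sum, that is, into the convolution defining `depthLaw`.
    refine (ih hH' fun ℓ => hH'.comp measurable_prodMk_left).trans (lintegral_congr fun ω => ?_)
    have hev : Measurable fun s => evo M (H fun i => L i ω) s (0 : E) :=
      measurable_evo (H := fun _ : ℝ≥0 => H fun i => L i ω) ((hHℓ _).comp measurable_snd)
        measurable_id measurable_const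
    have := isProbabilityMeasure_depthLaw hγ hδ0 n fun i => L i ω
    rw [depthLaw, Measure.lintegral_conv hev]
    refine lintegral_congr fun s => ?_
    simp_rw [← evo_evo (hHℓ _)]
    unfold evo
    rw [lintegral_lintegral_swap]
    refine Measurable.aemeasurable ?_
    exact measurable_evo (M := M) (H := fun _ : W × ℝ≥0 => H fun i => L i ω)
      ((hHℓ _).comp measurable_snd) measurable_snd ((M.measurable_Z_apply s).comp measurable_fst)

variable [IsProbabilityMeasure φ]

/-- The law of the walk at time `t` is that of the Markov process at a random age. -/
lemma IsBuiltFrom.lintegral_walk (h : IsBuiltFrom M φ (memoryKernel γ δ) Pr X L R ξ)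
    (hφ : φ {0} = 0) (hγ : 0 < γ) (hδ0 : 0 < δ) (t : ℝ≥0) {H : E → ℝ≥0∞} (hH : Measurable H) :
    ∫⁻ ω, H (X t ω) ∂Pr = ∫⁻ s, evo M H s 0 ∂(meanAgeLaw γ δ Pr L t) := by
  have hev : Measurable fun s => evo M H s (0 : E) :=
    measurable_evo (H := fun _ : ℝ≥0 => H) (hH.comp measurable_snd) measurable_id measurable_const
  have hL := h.isRunSequence
  have hLm := hL.measurable_path
  have hN : Measurable fun ℓ : ℕ → ℝ≥0 => runIndex ℓ t :=
    measurable_runIndex.comp (measurable_id.prodMk measurable_const)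
  have hNs : ∀ n, MeasurableSet {ℓ : ℕ → ℝ≥0 | runIndex ℓ t = n} := fun n =>
    hN (measurableSet_singleton n)
  -- The index of the run under way at `t` is a function of the run lengths, so its indicator can be
  -- carried inside the test functions of the run and starting-point identities.
  have e1 : ∀ n, ∫⁻ ω, (if runIndex (fun i => L i ω) t = n then
      H (runPosition M (fun i => L i ω) (fun i => ξ i ω) t n) else 0) ∂Pr =
      ∫⁻ ω, (if runIndex (fun i => L i ω) t = n then
        ∫⁻ y, evo M H y 0 ∂(ageLaw γ δ t fun i => L i ω) else 0) ∂Pr := by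
    intro n
    have hG : Measurable (Function.uncurry fun (p : (ℕ → ℝ≥0) × E) (w : W) =>
        if runIndex p.1 t = n then H (M.Z (t - partialTime p.1 n) w) else 0) :=
      Measurable.ite ((measurable_fst.comp measurable_fst) (hNs n))
        (hH.comp (M.measurable_Z.comp (Measurable.prodMk (by fun_prop) measurable_snd)))
        measurable_const
    have hH' : Measurable (Function.uncurry fun (ℓ : ℕ → ℝ≥0) (z : E) =>
        if runIndex ℓ t = n then evo M H (t - partialTime ℓ n) z else 0) :=
      Measurable.ite (measurable_fst (hNs n))
        (measurable_evo (H := fun _ : (ℕ → ℝ≥0) × E => H) (hH.comp measurable_snd) (by fun_prop)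
          measurable_snd) measurable_const
    have a1 := h.lintegral_run n hG
    have a2 := h.lintegral_startPoint hφ hγ hδ0 n hH'
    refine a1.trans (Eq.trans (lintegral_congr fun ω => ?_) (a2.trans (lintegral_congr fun ω => ?_)))
    · by_cases hn : runIndex (fun i => L i ω) t = n
      · simp only [hn, if_true]; rfl
      · simp [hn]
    · by_cases hn : runIndex (fun i => L i ω) t = n
      · simp only [hn, if_true, ageLaw]
        rw [lintegral_map hev (by fun_prop)]
        exact lintegral_congr fun s => evo_evo hH _ _ _
      · simp [hn, evo]
  have hsum : ∀ {F : ℕ → Ω → ℝ≥0∞} (ω : Ω), ∑' n, (if runIndex (fun i => L i ω) t = n then F n ω else 0) =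
      F (runIndex (fun i => L i ω) t) ω := fun {F} ω => by
    rw [tsum_eq_single (runIndex (fun i => L i ω) t) fun n hn => if_neg hn.symm, if_pos rfl]
  have hmeas1 : ∀ n, Measurable fun ω => if runIndex (fun i => L i ω) t = n then
      H (runPosition M (fun i => L i ω) (fun i => ξ i ω) t n) else 0 := fun n =>
    Measurable.ite (hLm (hNs n)) (hH.comp (measurable_runPosition hLm
      (measurable_pi_lambda _ h.measurable_ξ) measurable_const measurable_const)) measurable_const
  have hage : Measurable fun ω => ∫⁻ y, evo M H y 0 ∂(ageLaw γ δ t fun i => L i ω) := by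
    exact (Measure.measurable_lintegral hev).comp ((measurable_ageLaw hγ hδ0 t).comp hLm)
  have hmeas2 : ∀ n, Measurable fun ω => if runIndex (fun i => L i ω) t = n then
      ∫⁻ y, evo M H y 0 ∂(ageLaw γ δ t fun i => L i ω) else 0 := fun n =>
    Measurable.ite (hLm (hNs n)) hage measurable_const
  have hX : ∫⁻ ω, H (X t ω) ∂Pr = ∫⁻ ω, ∑' n, (if runIndex (fun i => L i ω) t = n then
      H (runPosition M (fun i => L i ω) (fun i => ξ i ω) t n) else 0) ∂Pr := by
    refine lintegral_congr_ae ?_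
    filter_upwards [h.path, hL.ae_exists_lt_relocTime hφ] with ω hp hex
    obtain ⟨m, hm⟩ := hex t
    obtain ⟨h1, h2⟩ := partialTime_runIndex (ℓ := fun i => L i ω) hm
    rw [hsum (F := fun n ω => H (runPosition M (fun i => L i ω) (fun i => ξ i ω) t n)) ω,
      hp _ _ h1 h2]
    rfl
  rw [hX, lintegral_tsum fun n => (hmeas1 n).aemeasurable]
  simp_rw [e1]
  have hbind : Measurable fun ω => ageLaw γ δ t fun i => L i ω := (measurable_ageLaw hγ hδ0 t).comp hLm
  rw [← lintegral_tsum fun n => (hmeas2 n).aemeasurable, meanAgeLaw,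
    Measure.lintegral_bind hbind.aemeasurable hev.aemeasurable]
  refine lintegral_congr fun ω => ?_
  rw [hsum (F := fun _ ω => ∫⁻ y, evo M H y 0 ∂(ageLaw γ δ t fun i => L i ω)) ω]

lemma IsBuiltFrom.aemeasurable_walk (h : IsBuiltFrom M φ (memoryKernel γ δ) Pr X L R ξ)
    (hφ : φ {0} = 0) (t : ℝ≥0) : AEMeasurable (X t) Pr := by
  have hLm := h.isRunSequence.measurable_path
  refine ⟨fun ω => runPosition M (fun i => L i ω) (fun i => ξ i ω) t (runIndex (fun i => L i ω) t),
    measurable_runPosition hLm (measurable_pi_lambda _ h.measurable_ξ) measurable_const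
      (measurable_runIndex.comp (hLm.prodMk measurable_const)), ?_⟩
  filter_upwards [h.path, h.isRunSequence.ae_exists_lt_relocTime hφ] with ω hp hex
  obtain ⟨m, hm⟩ := hex t
  obtain ⟨h1, h2⟩ := partialTime_runIndex (ℓ := fun i => L i ω) hm
  exact hp _ _ h1 h2

end

/-! ### Continuous convergence -/

/-- If joint convergence failed, there would be bad pairs `(T_n, x_n)` with `T_n → ∞` and `x_n → x`.
The perturbation equal to `(x_n - x)√T_n` at the times `T_n`, and zero elsewhere, is `o(√t)` and
contradicts the hypothesis. -/
lemma tendsto_prod_nhds_of_isLittleO {Y : Type*} [TopologicalSpace Y] {Φ : ℝ → ℝ → Y} {x : ℝ}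
    {y : Y} (h : ∀ ε : ℝ → ℝ, ε =o[atTop] (fun t => √t) →
      Tendsto (fun t => Φ t (t + x * √t + ε t)) atTop (𝓝 y)) :
    Tendsto (fun p : ℝ × ℝ => Φ p.1 (p.1 + p.2 * √p.1)) (atTop ×ˢ 𝓝 x) (𝓝 y) := by
  rw [tendsto_def]
  intro V hV
  by_contra hcon
  have hfreq : ∃ᶠ p : ℝ × ℝ in atTop ×ˢ 𝓝 x, Φ p.1 (p.1 + p.2 * √p.1) ∉ V :=
    not_eventually.1 hcon
  obtain ⟨q, hq, hqV⟩ := exists_seq_forall_of_frequently hfreq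
  obtain ⟨hq1, hq2⟩ := tendsto_prod_iff'.1 hq
  obtain ⟨ψ, hψ, hmono⟩ := strictMono_subseq_of_tendsto_atTop hq1
  set T := fun n => (q (ψ n)).1 with hT
  have hTm : StrictMono T := hmono
  have hT' : Tendsto T atTop atTop := hq1.comp hψ.tendsto_atTop
  have hX : Tendsto (fun n => (q (ψ n)).2) atTop (𝓝 x) := hq2.comp hψ.tendsto_atTop
  -- Passing to strictly increasing times makes `T` injective, so the perturbation is well defined
  -- at each `T n`.
  set ε : ℝ → ℝ := Function.extend T (fun n => ((q (ψ n)).2 - x) * √(T n)) 0 with hε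
  have hεT : ∀ n, ε (T n) = ((q (ψ n)).2 - x) * √(T n) := fun n =>
    hTm.injective.extend_apply _ _ _
  have hεo : ε =o[atTop] (fun t => √t) := by
    rw [isLittleO_iff]
    intro c hc
    obtain ⟨N, hN⟩ := eventually_atTop.1 ((Metric.tendsto_nhds.1 hX) c hc)
    filter_upwards [eventually_ge_atTop (T N)] with t ht
    by_cases hex : ∃ n, T n = t
    · obtain ⟨n, rfl⟩ := hex
      rw [hεT, norm_mul]
      gcongr
      exact (hN n (hTm.le_iff_le.1 ht)).le
    · rw [hε, Function.extend_apply' _ _ _ hex]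
      simp only [Pi.zero_apply, norm_zero]
      positivity
  have hlim := ((h ε hεo).comp hT').eventually hV
  obtain ⟨n, hn⟩ := hlim.exists
  refine hqV (ψ n) ?_
  have e : T n + x * √(T n) + ε (T n) = T n + (q (ψ n)).2 * √(T n) := by rw [hεT]; ring
  simp only [Function.comp_apply] at hn
  rw [e] at hn
  exact hn

/-- Joint convergence puts `Φ i z` in a given closed neighbourhood of `F x` for all late `i` and all
`z` near `x`; letting `i` run for fixed `z` puts `F z` there too. Regularity supplies the closed
neighbourhoods. -/
lemma continuous_of_tendsto_prod_nhds {ι A B : Type*} [TopologicalSpace A] [TopologicalSpace B]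
    [RegularSpace B] {l : Filter ι} [l.NeBot] {Φ : ι → A → B} {F : A → B}
    (h : ∀ x, Tendsto (fun p : ι × A => Φ p.1 p.2) (l ×ˢ 𝓝 x) (𝓝 (F x))) : Continuous F := by
  have hpt : ∀ x, Tendsto (fun i => Φ i x) l (𝓝 (F x)) := fun x =>
    (h x).comp (tendsto_id.prodMk tendsto_const_nhds)
  rw [continuous_iff_continuousAt]
  intro x
  rw [ContinuousAt, (closed_nhds_basis (F x)).tendsto_right_iff]
  rintro V ⟨hV, hVc⟩
  have h1 : ∀ᶠ p : A × ι in 𝓝 x ×ˢ l, Φ p.2 p.1 ∈ V := by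
    rw [prod_comm]
    exact (h x).eventually hV
  filter_upwards [h1.curry] with z hz
  exact hVc.mem_of_tendsto (hpt z) hz

/-- Weak convergence integrates continuously convergent bounded functions. -/
lemma tendsto_integral_of_tendsto_prod_nhds {ι : Type*} {l : Filter ι} [l.NeBot]
    {τ : ι → ProbabilityMeasure ℝ} {τ₀ : ProbabilityMeasure ℝ} (hτ : Tendsto τ l (𝓝 τ₀))
    {Φ : ι → ℝ → ℝ} {F : ℝ → ℝ} (hΦ : ∀ i, Measurable (Φ i)) {B : ℝ} (hB : ∀ i x, |Φ i x| ≤ B)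
    (h : ∀ x, Tendsto (fun p : ι × ℝ => Φ p.1 p.2) (l ×ˢ 𝓝 x) (𝓝 (F x))) :
    Tendsto (fun i => ∫ x, Φ i x ∂(τ i : Measure ℝ)) l (𝓝 (∫ x, F x ∂(τ₀ : Measure ℝ))) := by
  have hFc : Continuous F := continuous_of_tendsto_prod_nhds h
  have hFB : ∀ x, |F x| ≤ B := fun x =>
    le_of_tendsto' ((h x).comp (tendsto_id.prodMk tendsto_const_nhds)).abs fun i => hB i x
  have hB0 : 0 ≤ B := (abs_nonneg _).trans (hFB 0)
  rw [ProbabilityMeasure.tendsto_iff_forall_integral_tendsto] at hτ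
  have hF := hτ (BoundedContinuousFunction.ofNormedAddCommGroup F hFc B hFB)
  refine tendsto_of_tendsto_of_dist hF ?_
  -- A continuous cut-off, zero on `[-R, R]` and one outside `[-(R+1), R+1]`. Testing weak
  -- convergence against it bounds the tails of all late `τ i` by a tail of `τ₀`.
  set χ : ℕ → ℝ → ℝ := fun R x => min 1 (max 0 (|x| - R)) with hχ
  have hχ0 : ∀ R x, 0 ≤ χ R x := fun R x => le_min zero_le_one (le_max_left _ _)
  have hχ1 : ∀ R x, |χ R x| ≤ 1 := fun R x => by
    rw [abs_of_nonneg (hχ0 R x)]; exact min_le_left _ _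
  have hχc : ∀ R, Continuous (χ R) := fun R => by fun_prop
  have hχl : Tendsto (fun R => ∫ x, χ R x ∂(τ₀ : Measure ℝ)) atTop (𝓝 0) := by
    have := tendsto_integral_of_dominated_convergence (μ := (τ₀ : Measure ℝ)) (F := χ)
      (f := fun _ => 0) (fun _ => 1) (fun R => (hχc R).aestronglyMeasurable) (integrable_const _)
      (fun R => Eventually.of_forall (hχ1 R)) (Eventually.of_forall fun x => by
        refine tendsto_const_nhds.congr' ?_
        filter_upwards [eventually_ge_atTop ⌈|x|⌉₊] with R hR
        have : |x| ≤ R := (Nat.le_ceil _).trans (by exact_mod_cast hR)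
        simp only [hχ]
        rw [max_eq_left (by linarith), min_eq_right zero_le_one])
    simpa using this
  rw [Metric.tendsto_nhds]
  intro ε hε
  set η := ε / (2 * (1 + 2 * B)) with hη
  have hη0 : 0 < η := by positivity
  obtain ⟨R, hR⟩ := (hχl.eventually (gt_mem_nhds hη0)).exists
  have hχi := hτ (BoundedContinuousFunction.ofNormedAddCommGroup (χ R) (hχc R) 1 (hχ1 R))
  -- Local joint convergence becomes uniform on a compact ball.
  have hK : ∀ᶠ p : ι × ℝ in l ×ˢ 𝓝ˢ (Metric.closedBall (0 : ℝ) (R + 1)), |Φ p.1 p.2 - F p.2| < η := by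
    rw [(isCompact_closedBall (0 : ℝ) (R + 1)).prod_nhdsSet_eq_biSup]
    simp only [eventually_iSup]
    intro y _
    have h1 := h y
    have h2 : Tendsto (fun p : ι × ℝ => F p.2) (l ×ˢ 𝓝 y) (𝓝 (F y)) :=
      (hFc.tendsto y).comp tendsto_snd
    have h3 := (h1.sub h2).abs
    rw [sub_self, abs_zero] at h3
    exact h3.eventually (gt_mem_nhds hη0)
  filter_upwards [hχi.eventually (gt_mem_nhds hR), hK.curry] with i hi1 hi2
  have hi2' : ∀ x ∈ Metric.closedBall (0 : ℝ) (R + 1), |Φ i x - F x| < η := fun x hx =>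
    hi2.self_of_nhdsSet x hx
  have hpt : ∀ x, |F x - Φ i x| ≤ η + 2 * B * χ R x := fun x => by
    rw [abs_sub_comm]
    by_cases hx : x ∈ Metric.closedBall (0 : ℝ) (R + 1)
    · have := hi2' x hx
      have := mul_nonneg hB0 (hχ0 R x)
      linarith
    · have hx' : (R : ℝ) + 1 < |x| := by simpa using hx
      have e : χ R x = 1 := by
        simp only [hχ]
        rw [min_eq_left]
        exact le_max_of_le_right (by linarith)
      rw [e]
      have := abs_sub (Φ i x) (F x)
      linarith [hB i x, hFB x]
  have iF : Integrable F (τ i : Measure ℝ) :=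
    Integrable.of_bound hFc.aestronglyMeasurable B (Eventually.of_forall hFB)
  have iΦ : Integrable (Φ i) (τ i : Measure ℝ) :=
    Integrable.of_bound (hΦ i).aestronglyMeasurable B (Eventually.of_forall (hB i))
  have iχ : Integrable (χ R) (τ i : Measure ℝ) :=
    Integrable.of_bound (hχc R).aestronglyMeasurable 1 (Eventually.of_forall (hχ1 R))
  rw [Real.dist_0_eq_abs, abs_of_nonneg dist_nonneg, Real.dist_eq]
  change |∫ x, F x ∂(τ i : Measure ℝ) - ∫ x, Φ i x ∂(τ i : Measure ℝ)| < ε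
  rw [← integral_sub iF iΦ]
  have hi1' : ∫ x, χ R x ∂(τ i : Measure ℝ) < η := hi1
  calc _ ≤ ∫ x, |F x - Φ i x| ∂(τ i : Measure ℝ) := abs_integral_le_integral_abs
    _ ≤ ∫ x, (η + 2 * B * χ R x) ∂(τ i : Measure ℝ) :=
        integral_mono (iF.sub iΦ).abs ((integrable_const _).add (iχ.const_mul _)) hpt
    _ = η + 2 * B * ∫ x, χ R x ∂(τ i : Measure ℝ) := by
        rw [integral_add (integrable_const _) (iχ.const_mul _), integral_const_mul]; simp
    _ ≤ η + 2 * B * η := by gcongr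
    _ = ε / 2 := by rw [hη]; field_simp
    _ < ε := by linarith

/-! ### The normalised Markov process at ages close to the centring -/

section

variable {d : ℕ} {P : MarkovSemigroup (EuclideanSpace ℝ (Fin d))} {W : Type*} [MeasurableSpace W]
  {M : MarkovProcess P W} {a : ℝ → EuclideanSpace ℝ (Fin d)} {b : ℝ → ℝ}
  {f : ℝ → EuclideanSpace ℝ (Fin d)} {g : ℝ → ℝ}
  {ν : Measure (EuclideanSpace ℝ (Fin d))} [IsProbabilityMeasure ν]

lemma HasScalingLimits.tendsto_shift (h : HasScalingLimits a b f g) (x : ℝ) :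
    Tendsto (fun p : ℝ × ℝ => (b p.1)⁻¹ • (a (p.1 + p.2 * √p.1) - a p.1)) (atTop ×ˢ 𝓝 x) (𝓝 (f x)) :=
  tendsto_prod_nhds_of_isLittleO (Φ := fun t u => (b t)⁻¹ • (a u - a t)) fun ε hε => (h x ε hε).1

lemma HasScalingLimits.tendsto_scale (h : HasScalingLimits a b f g) (x : ℝ) :
    Tendsto (fun p : ℝ × ℝ => b (p.1 + p.2 * √p.1) / b p.1) (atTop ×ˢ 𝓝 x) (𝓝 (g x)) :=
  tendsto_prod_nhds_of_isLittleO (Φ := fun t u => b u / b t) fun ε hε => (h x ε hε).2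

lemma HasScalingLimits.continuous_shift (h : HasScalingLimits a b f g) : Continuous f :=
  continuous_of_tendsto_prod_nhds (Φ := fun t x => (b t)⁻¹ • (a (t + x * √t) - a t)) h.tendsto_shift

lemma HasScalingLimits.continuous_scale (h : HasScalingLimits a b f g) : Continuous g :=
  continuous_of_tendsto_prod_nhds (Φ := fun t x => b (t + x * √t) / b t) h.tendsto_scale

lemma tendsto_add_mul_sqrt (x : ℝ) :
    Tendsto (fun p : ℝ × ℝ => p.1 + p.2 * √p.1) (atTop ×ˢ 𝓝 x) atTop := by
  have h1 : Tendsto (fun p : ℝ × ℝ => √p.1 + p.2) (atTop ×ˢ 𝓝 x) atTop :=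
    (Real.tendsto_sqrt_atTop.comp tendsto_fst).atTop_add tendsto_snd
  have h2 : Tendsto (fun p : ℝ × ℝ => √p.1) (atTop ×ˢ 𝓝 x) atTop :=
    Real.tendsto_sqrt_atTop.comp tendsto_fst
  refine (h2.atTop_mul_atTop₀ h1).congr' ?_
  filter_upwards [tendsto_fst.eventually (eventually_ge_atTop (0 : ℝ))] with p hp
  rw [mul_add, Real.mul_self_sqrt hp]
  ring

/-- Slutsky's argument for the Markov process observed at an age `s + x √s`. -/
lemma tendsto_integral_rescaled (hA1 : IsErgodic M a b ν) (hA2 : HasScalingLimits a b f g)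
    (h : BoundedContinuousFunction (EuclideanSpace ℝ (Fin d)) ℝ) (x : ℝ) :
    Tendsto (fun p : ℝ × ℝ =>
      ∫ w, h ((b p.1)⁻¹ • (M.Z (p.1 + p.2 * √p.1).toNNReal w - a p.1)) ∂(M.law 0))
      (atTop ×ˢ 𝓝 x) (𝓝 (∫ y, h (f x + g x • y) ∂ν)) := by
  set u : ℝ × ℝ → ℝ≥0 := fun p => (p.1 + p.2 * √p.1).toNNReal with hu
  have hut : Tendsto u (atTop ×ˢ 𝓝 x) atTop := tendsto_real_toNNReal_atTop.comp (tendsto_add_mul_sqrt x)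
  have hY : TendstoInDistribution (fun (p : ℝ × ℝ) (w : W) => (b (u p))⁻¹ • (M.Z (u p) w - a (u p)))
      (atTop ×ˢ 𝓝 x) (fun y => y) (fun _ => M.law 0) ν :=
    ⟨fun p => (hA1.2 0).1 (u p), (hA1.2 0).2, (hA1.2 0).3.comp hut⟩
  -- With `u = s + x√s`, the quantity `(Z u - a s) / b s` is the shift `(a u - a s) / b s` plus the
  -- scale `b u / b s` times `(Z u - a u) / b u`; the shift and the scale are deterministic.
  set c : ℝ × ℝ → ℝ × EuclideanSpace ℝ (Fin d) := fun p =>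
    (b (p.1 + p.2 * √p.1) / b p.1, (b p.1)⁻¹ • (a (p.1 + p.2 * √p.1) - a p.1)) with hc
  have hct : Tendsto c (atTop ×ˢ 𝓝 x) (𝓝 (g x, f x)) :=
    (hA2.tendsto_scale x).prodMk_nhds (hA2.tendsto_shift x)
  have hcm : TendstoInMeasure (M.law 0) (fun p _ => c p) (atTop ×ˢ 𝓝 x) (fun _ => (g x, f x)) := by
    intro ε hε
    refine tendsto_const_nhds.congr' ?_
    filter_upwards [hct.eventually (Metric.eball_mem_nhds _ hε)] with p hp
    have : {w : W | ε ≤ edist (c p) (g x, f x)} = ∅ := by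
      ext w; simpa using hp
    rw [this, measure_empty]
  have hS := hY.continuous_comp_prodMk_of_tendstoInMeasure_const
    (g := fun q : EuclideanSpace ℝ (Fin d) × (ℝ × EuclideanSpace ℝ (Fin d)) => q.2.2 + q.2.1 • q.1)
    (by fun_prop) hcm (fun p => aemeasurable_const)
  have hInt := (ProbabilityMeasure.tendsto_iff_forall_integral_tendsto.1 hS.3) h
  have hm : Continuous fun y : EuclideanSpace ℝ (Fin d) => f x + g x • y := by fun_prop
  simp only [ProbabilityMeasure.coe_mk] at hInt
  rw [integral_map hm.aemeasurable h.continuous.aestronglyMeasurable] at hInt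
  refine hInt.congr' ?_
  filter_upwards [(tendsto_add_mul_sqrt x).eventually (eventually_ge_atTop 0)] with p hp
  rw [integral_map (hS.1 p) h.continuous.aestronglyMeasurable]
  refine integral_congr_ae (Eventually.of_forall fun w => ?_)
  have hup : ((u p : ℝ≥0) : ℝ) = p.1 + p.2 * √p.1 := Real.coe_toNNReal _ hp
  have hb : b (p.1 + p.2 * √p.1) ≠ 0 := (hA1.1 _ hp).ne'
  simp only [hc, hup]
  congr 1
  rw [smul_smul, div_mul_eq_mul_div, mul_inv_cancel₀ hb, one_div, ← smul_add]
  congr 1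
  abel

end

/-! ### The limit theorem -/

section

variable {E W Ω : Type*} [MeasurableSpace E] [Zero E] [MeasurableSpace W]
  [MeasurableSpace Ω] {P : MarkovSemigroup E} {M : MarkovProcess P W} {φ : Measure ℝ≥0}
  {γ δ : ℝ} {Pr : Measure Ω} {X : ℝ≥0 → Ω → E} {L R : ℕ → Ω → ℝ≥0} {ξ : ℕ → Ω → W}
  [IsProbabilityMeasure Pr] [IsProbabilityMeasure φ]

/-- The law of the walk at time `t` is that of the Markov process at a random age, for integrals of
bounded real functions. -/
lemma IsBuiltFrom.integral_walk (h : IsBuiltFrom M φ (memoryKernel γ δ) Pr X L R ξ)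
    (hφ : φ {0} = 0) (hγ : 0 < γ) (hδ0 : 0 < δ) (t : ℝ≥0) {H : E → ℝ} (hH : Measurable H) {B : ℝ}
    (hB : ∀ z, |H z| ≤ B) :
    ∫ ω, H (X t ω) ∂Pr = ∫ s, ∫ w, H (M.Z s w) ∂(M.law 0) ∂(meanAgeLaw γ δ Pr L t) := by
  have hXm := h.aemeasurable_walk hφ t
  have hκ : Measurable fun s : ℝ≥0 => (M.law 0).map (M.Z s) := by
    refine Measure.measurable_of_measurable_coe _ fun A hA => ?_
    have e : (fun s => (M.law 0).map (M.Z s) A) = fun s =>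
        M.law 0 (Prod.mk s ⁻¹' (Function.uncurry M.Z ⁻¹' A)) := by
      funext s
      rw [Measure.map_apply (M.measurable_Z_apply s) hA]
      rfl
    rw [e]
    exact measurable_measure_prodMk_left (M.measurable_Z hA)
  let κ : Kernel ℝ≥0 E := ⟨fun s => (M.law 0).map (M.Z s), hκ⟩
  have e : Pr.map (X t) = (κ ∘ₖ Kernel.const Unit (meanAgeLaw γ δ Pr L t)) () := by
    rw [Kernel.comp_apply, Kernel.const_apply]
    ext A hA
    have h1 := h.lintegral_walk hφ hγ hδ0 t (measurable_const.indicator hA : Measurable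
      (A.indicator fun _ => (1 : ℝ≥0∞)))
    rw [← lintegral_map' (measurable_const.indicator hA).aemeasurable hXm,
      lintegral_indicator_const hA, one_mul] at h1
    rw [h1, Measure.bind_apply hA κ.aemeasurable]
    refine lintegral_congr fun s => ?_
    rw [evo, ← lintegral_map (measurable_const.indicator hA) (M.measurable_Z_apply s),
      lintegral_indicator_const hA, one_mul]
    rfl
  have hp : IsProbabilityMeasure (Pr.map (X t)) := Measure.isProbabilityMeasure_map hXm
  rw [← integral_map hXm hH.aestronglyMeasurable, e]
  rw [e] at hp
  rw [Kernel.integral_comp (Integrable.of_bound hH.aestronglyMeasurable B (Eventually.of_forall hB)),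
    Kernel.const_apply]
  refine integral_congr_ae (Eventually.of_forall fun s => ?_)
  exact integral_map (M.measurable_Z_apply s).aemeasurable hH.aestronglyMeasurable

end

section

variable {Ω : Type*} [MeasurableSpace Ω] {Pr : Measure Ω} {φ : Measure ℝ≥0} {L : ℕ → Ω → ℝ≥0}
  [IsProbabilityMeasure Pr] [IsProbabilityMeasure φ]

/-- The law of the normalised age of the walk at time `t`. -/
def normalisedAgeLaw (γ δ : ℝ) (φ : Measure ℝ≥0) (Pr : Measure Ω) (L : ℕ → Ω → ℝ≥0) (t : ℝ≥0) :
    Measure ℝ :=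
  (meanAgeLaw γ δ Pr L t).map fun y : ℝ≥0 => ((y : ℝ) - centring γ δ φ t) / √(centring γ δ φ t)

/-- The normalised age is asymptotically Gaussian. -/
lemma IsRunSequence.tendsto_normalisedAgeLaw (hL : IsRunSequence Pr φ L) (hφ : φ {0} = 0) {γ δ : ℝ}
    (hγ : 0 < γ) (hδ0 : 0 < δ) (hδ1 : δ < 1)
    (hmom : Integrable (fun l : ℝ≥0 => (l : ℝ) ^ momentOrder δ) φ)
    (hp : ∀ t, IsProbabilityMeasure (normalisedAgeLaw γ δ φ Pr L t)) :
    Tendsto (β := ProbabilityMeasure ℝ) (fun t => ⟨normalisedAgeLaw γ δ φ Pr L t, hp t⟩) atTop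
      (𝓝 ⟨gaussianReal 0 (2 * moment φ 3 / (3 * moment φ 2)).toNNReal, inferInstance⟩) := by
  have hmn : ∀ k, 0 ≤ moment φ k := fun k => integral_nonneg fun l => by positivity
  have hv : 0 ≤ 2 * moment φ 3 / (3 * moment φ 2) := by
    have := hmn 2
    have := hmn 3
    positivity
  -- Lévy's continuity theorem is applied along sequences of times.
  refine tendsto_of_seq_tendsto fun q hq => ?_
  refine ProbabilityMeasure.tendsto_iff_tendsto_charFun.2 fun u => ?_
  have h := (hL.tendsto_integral_exp_meanAgeLaw (Pr := Pr) hφ hγ hδ0 hδ1 hmom u).comp hq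
  have e1 : charFun (gaussianReal 0 (2 * moment φ 3 / (3 * moment φ 2)).toNNReal) u =
      Complex.exp (-((u ^ 2 * (2 * moment φ 3 / (3 * moment φ 2)) / 2 : ℝ) : ℂ)) := by
    have e0 : (((2 * moment φ 3 / (3 * moment φ 2)).toNNReal : ℝ≥0) : ℝ) =
      2 * moment φ 3 / (3 * moment φ 2) := Real.coe_toNNReal _ hv
    rw [charFun_gaussianReal, e0]
    congr 1
    push_cast
    ring
  simp only [ProbabilityMeasure.coe_mk]
  rw [e1]
  refine h.congr fun n => ?_
  change _ = charFun (normalisedAgeLaw γ δ φ Pr L (q n)) u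
  rw [Function.comp_apply, charFun_apply_real, normalisedAgeLaw, integral_map (by fun_prop)
    (by fun_prop : Measurable _).aestronglyMeasurable]
  refine integral_congr_ae (Eventually.of_forall fun y => ?_)
  simp only
  congr 1
  push_cast
  ring

end

section

variable {d : ℕ} {P : MarkovSemigroup (EuclideanSpace ℝ (Fin d))} {W : Type*} [MeasurableSpace W]
  {M : MarkovProcess P W} {a : ℝ → EuclideanSpace ℝ (Fin d)} {b : ℝ → ℝ}
  {f : ℝ → EuclideanSpace ℝ (Fin d)} {g : ℝ → ℝ}
  {ν : Measure (EuclideanSpace ℝ (Fin d))} [IsProbabilityMeasure ν]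
  {Ω : Type*} [MeasurableSpace Ω] {φ : Measure ℝ≥0}
  {γ δ : ℝ} {Pr : Measure Ω} {X : ℝ≥0 → Ω → EuclideanSpace ℝ (Fin d)} {L R : ℕ → Ω → ℝ≥0}
  {ξ : ℕ → Ω → W} [IsProbabilityMeasure Pr] [IsProbabilityMeasure φ]

/-- Disintegrating over the normalised age `x` replaces the walk by the process at age `s + x√s`.
The integrand converges jointly in `(s, x)` and the law of `x` converges weakly, so the integrals
converge. -/
lemma IsBuiltFrom.tendsto_integral (hX : IsBuiltFrom M φ (memoryKernel γ δ) Pr X L R ξ)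
    (hφ : φ {0} = 0) (hγ : 0 < γ) (hδ0 : 0 < δ) (hδ1 : δ < 1)
    (hmom : Integrable (fun l : ℝ≥0 => (l : ℝ) ^ momentOrder δ) φ)
    (hA1 : IsErgodic M a b ν) (hA2 : HasScalingLimits a b f g)
    (h : BoundedContinuousFunction (EuclideanSpace ℝ (Fin d)) ℝ) :
    Tendsto (fun t : ℝ≥0 =>
      ∫ ω, h ((b (centring γ δ φ t))⁻¹ • (X t ω - a (centring γ δ φ t))) ∂Pr) atTop
      (𝓝 (∫ x, ∫ y, h (f x + g x • y) ∂ν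
        ∂(gaussianReal 0 (2 * moment φ 3 / (3 * moment φ 2)).toNNReal))) := by
  have hL := hX.isRunSequence
  have hp : ∀ t, IsProbabilityMeasure (normalisedAgeLaw γ δ φ Pr L t) := fun t => by
    have := hL.isProbabilityMeasure_meanAgeLaw hγ hδ0 t
    exact Measure.isProbabilityMeasure_map (by fun_prop)
  have hτ := hL.tendsto_normalisedAgeLaw hφ hγ hδ0 hδ1 hmom hp
  have hc : Tendsto (fun t : ℝ≥0 => centring γ δ φ t) atTop atTop :=
    (tendsto_centring_atTop hφ hγ hδ0 hδ1 hmom).comp (NNReal.tendsto_coe_atTop.2 tendsto_id)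
  set Φ : ℝ → ℝ → ℝ := fun s x =>
    ∫ w, h ((b s)⁻¹ • (M.Z (s + x * √s).toNNReal w - a s)) ∂(M.law 0) with hΦ
  have hZ : ∀ s, Measurable fun p : ℝ × W =>
      h ((b s)⁻¹ • (M.Z (s + p.1 * √s).toNNReal p.2 - a s)) := fun s =>
    have hs : Measurable fun p : ℝ × W => ((s + p.1 * √s).toNNReal, p.2) := by fun_prop
    have hz : Measurable fun p : ℝ × W => M.Z (s + p.1 * √s).toNNReal p.2 := M.measurable_Z.comp hs
    h.continuous.measurable.comp (by fun_prop)
  have hΦm : ∀ s, Measurable (Φ s) := fun s =>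
    (hZ s).stronglyMeasurable.integral_prod_right.measurable
  have hΦB : ∀ s x, |Φ s x| ≤ ‖h‖ := fun s x => by
    refine (norm_integral_le_of_norm_le_const (C := ‖h‖)
      (Eventually.of_forall fun w => h.norm_coe_le_norm _)).trans (by simp)
  have hlim := tendsto_integral_of_tendsto_prod_nhds hτ (Φ := fun t : ℝ≥0 => Φ (centring γ δ φ t))
    (fun t => hΦm _) (fun t x => hΦB _ x) (fun x =>
      (tendsto_integral_rescaled hA1 hA2 h x).comp (hc.prodMap tendsto_id))
  refine hlim.congr' ?_
  filter_upwards [hc.eventually_gt_atTop 0] with t ht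
  set s := centring γ δ φ t with hs
  have hH : Measurable fun z : EuclideanSpace ℝ (Fin d) => h ((b s)⁻¹ • (z - a s)) :=
    h.continuous.measurable.comp (by fun_prop)
  simp only [ProbabilityMeasure.coe_mk]
  rw [hX.integral_walk hφ hγ hδ0 t hH (B := ‖h‖) fun z => h.norm_coe_le_norm _, normalisedAgeLaw,
    integral_map (by fun_prop) (hΦm s).aestronglyMeasurable]
  refine integral_congr_ae (Eventually.of_forall fun y => ?_)
  have hsq : √s ≠ 0 := (Real.sqrt_pos.2 ht).ne'
  have e : (s + ((y : ℝ) - s) / √s * √s).toNNReal = y := by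
    rw [div_mul_cancel₀ _ hsq, add_sub_cancel, Real.toNNReal_coe]
  simp only [hΦ, ← hs, e]

end

end MonkeyWalk

end

theorem theorem1 {d : ℕ} {P : MonkeyWalk.MarkovSemigroup (EuclideanSpace ℝ (Fin d))}
    {W : Type*} [MeasurableSpace W] (M : MonkeyWalk.MarkovProcess P W)
    (φ : Measure ℝ≥0) [IsProbabilityMeasure φ] (hφ : φ {0} = 0)
    (γ δ : ℝ) (hγ : 0 < γ) (hδ0 : 0 < δ) (hδ1 : δ < 1)
    (hmom : Integrable (fun l : ℝ≥0 => (l : ℝ) ^ (max 8 (⌊1 / (1 - δ)⌋₊ + 1))) φ)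
    (a : ℝ → EuclideanSpace ℝ (Fin d)) (b : ℝ → ℝ)
    (ν : Measure (EuclideanSpace ℝ (Fin d))) [IsProbabilityMeasure ν]
    (hA1 : MonkeyWalk.IsErgodic M a b ν)
    (f : ℝ → EuclideanSpace ℝ (Fin d)) (g : ℝ → ℝ)
    (hA2 : MonkeyWalk.HasScalingLimits a b f g)
    {Ω : Type*} [MeasurableSpace Ω] (Pr : Measure Ω) [IsProbabilityMeasure Pr]
    (X : ℝ≥0 → Ω → EuclideanSpace ℝ (Fin d))
    (hX : MonkeyWalk.IsMonkeyWalk M φ (MonkeyWalk.memoryKernel γ δ) Pr X)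
    {Ω' : Type*} [MeasurableSpace Ω'] (Pr' : Measure Ω') [IsProbabilityMeasure Pr']
    (G : Ω' → ℝ) (Λ : Ω' → EuclideanSpace ℝ (Fin d))
    (hG : HasLaw G (gaussianReal 0
      (2 * MonkeyWalk.moment φ 3 / (3 * MonkeyWalk.moment φ 2)).toNNReal) Pr')
    (hΛ : HasLaw Λ ν Pr') (hindep : IndepFun G Λ Pr') :
    TendstoInDistribution
      (fun (t : ℝ≥0) (ω : Ω) =>
        (b (MonkeyWalk.centring γ δ φ t))⁻¹ • (X t ω - a (MonkeyWalk.centring γ δ φ t)))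
      atTop (fun ω' => f (G ω') + g (G ω') • Λ ω') (fun _ => Pr) Pr' := by
  obtain ⟨L, R, ξ, hX⟩ := hX
  -- Continuity of `f` and `g` is not assumed; it comes from the perturbations allowed in the
  -- scaling limits, and gives measurability of the limit variable.
  have hf : Continuous f := hA2.continuous_shift
  have hg : Continuous g := hA2.continuous_scale
  have hcont : Continuous fun p : ℝ × EuclideanSpace ℝ (Fin d) => f p.1 + g p.1 • p.2 := by fun_prop
  have hmeas : ∀ t : ℝ≥0, AEMeasurable (fun ω =>
      (b (MonkeyWalk.centring γ δ φ t))⁻¹ • (X t ω - a (MonkeyWalk.centring γ δ φ t))) Pr := fun t => by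
    have := hX.aemeasurable_walk hφ t
    fun_prop
  have hpair : AEMeasurable (fun ω' => (G ω', Λ ω')) Pr' := hG.aemeasurable.prodMk hΛ.aemeasurable
  have hlimit : AEMeasurable (fun ω' => f (G ω') + g (G ω') • Λ ω') Pr' :=
    hcont.measurable.comp_aemeasurable hpair
  refine ⟨hmeas, hlimit, ?_⟩
  refine ProbabilityMeasure.tendsto_iff_forall_integral_tendsto.2 fun h => ?_
  have hlim := hX.tendsto_integral hφ hγ hδ0 hδ1 hmom hA1 hA2 h
  simp only [ProbabilityMeasure.coe_mk]
  have hh : Continuous fun p : ℝ × EuclideanSpace ℝ (Fin d) => h (f p.1 + g p.1 • p.2) :=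
    h.continuous.comp hcont
  have e : ∫ z, h z ∂(Pr'.map fun ω' => f (G ω') + g (G ω') • Λ ω') =
      ∫ x, ∫ y, h (f x + g x • y) ∂ν ∂(gaussianReal 0
        (2 * MonkeyWalk.moment φ 3 / (3 * MonkeyWalk.moment φ 2)).toNNReal) := by
    -- Independence makes the joint law a product, so the expectation of the limit is the iterated
    -- integral found above.
    have hmap := (indepFun_iff_map_prod_eq_prod_map_map hG.aemeasurable hΛ.aemeasurable).1 hindep
    rw [hG.map_eq, hΛ.map_eq] at hmap
    rw [integral_map hlimit h.continuous.aestronglyMeasurable,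
      ← integral_prod (fun p : ℝ × EuclideanSpace ℝ (Fin d) => h (f p.1 + g p.1 • p.2))
        (Integrable.of_bound hh.aestronglyMeasurable ‖h‖
          (Eventually.of_forall fun p => h.norm_coe_le_norm _)), ← hmap,
      integral_map hpair hh.aestronglyMeasurable]
  rw [e]
  refine hlim.congr fun t => ?_
  rw [integral_map (hmeas t) h.continuous.aestronglyMeasurable]
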